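/- Let $(z,z')$ be a random pair, $A(z)\in\mathbb R^{d\times d}$ a random matrix and $b(z')\in\mathbb R^d$ a random vector with finite expectations, $c\in\mathbb R$ a constant, and $\mathcal W\subseteq\mathbb R^d$ a nonempty bounded polyhedron. Put $$f(w,z,z')=w^\top A(z)w+w^\top b(z')+c,\qquad P(w)=w^\top\mathbb E[A(z)]w+w^\top\mathbb E[b(z')]+c,\qquad P_*=\min_{w\in\mathcal W}P(w),$$ and let $\mathcal W_*$ be the set of minimizers of $P$ over $\mathcal W$. The problem $\min_{w\in\mathcal W}P(w)$ satisfies EBC$(\theta,\alpha)$, where $\theta\in(0,1]$ and $0<\alpha<\infty$, if $\|w-w^*\|_2^2\le\alpha\,(P(w)-P(w^*))^\theta$ for every $w\in\mathcal W$, where $w^*$ is the point of $\mathcal W_*$ closest to $w$. Assume that $\mathbb E[A(z)]$ is (symmetric) positive semidefinite. Let $(z_1,z_1'),(z_2,z_2'),\dots$ be i.i.d. copies of $(z,z')$. An ERM solution is any minimizer $\widehat w$ of $\frac1n\sum_{i=1}^n f(w,z_i,z_i')$ over $w\in\mathcal W$. Then: (i) There is $\alpha\in(0,\infty)$ such that the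 problem satisfies EBC$(1,\alpha)$. In (ii), (iii), (iv) let $\alpha$ be any number such that EBC$(1,\alpha)$ holds; in (ii)-(iv) assume that $\max(\|A(z)\|_2,\|b(z')\|_2)\le\sigma<\infty$ almost surely, and let $R$ be such that $\|w\|_2\le R$ on $\mathcal W$. (ii) There is a constant $C$ depending only on $\alpha,\sigma,R$ such that for all $n\ge2$ and $\delta\in(0,1)$, with probability at least $1-\delta$, every ERM solution satisfies $$P(\widehat w)-P_*\le C\,\frac{d\log n+\log(1/\delta)}{n}.$$ (iii) Suppose in addition that almost surely $f(\cdot,z,z')$ is non-negative on $\mathbb R^d$ and is convex and $L$-smooth on $\mathcal W$, that is, $0\le f(w,z,z')-f(u,z,z')-\nabla f(u,z,z')^\top(w-u)\le\frac L2\|w-u\|_2^2$ for all $w,u\in\mathcal W$. Then there are constants $C,N>0$ depending only on $\alpha,\sigma,R,L$ such that for all $n\ge2$ with $n\ge N\,d\log n$ and all $\delta\in(0,1)$, with probability at least $1-\delta$, every ERM solution satisfies $$P(\widehat w)-P_*\le C\left[\left(\frac{d\log n+\log(1/\delta)}{n}\right)^2+\frac{(d\log n+\log(1/\delta))\,P_*}{n}\right].$$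 If $f(\cdot,z,z')$ is almost surely non-negative only on $\mathcal W$, the same holds with constants $C,N$ that may depend on the problem (but not on $n$ and $\delta$). (iv) Let $G>0$ be such that almost surely $f(\cdot,z,z')$ is $G$-Lipschitz on $\mathcal W$, let $w_1\in\mathcal W$, and let $R_0\ge\|w_1-w_1^*\|_2$, where $w_1^*$ is the point of $\mathcal W_*$ closest to $w_1$. For $n\ge100$ put $m=\lfloor\frac12\log_2\frac{2n}{\log_2n}\rfloor-1$, $n_0=\lfloor n/m\rfloor$, $\widehat w_0=w_1$ and $R_k=R_0/2^k$. ASA computes $\widehat w_1,\dots,\widehat w_m$ as follows: for $k=1,\dots,m$, $\widehat w_k$ is the average of the $n_0+1$ iterates $u_1=\widehat w_{k-1}$, $u_{t+1}=\Pi_k\big(u_t-\gamma_k\nabla f(u_t,\cdot)\big)$, $t=1,\dots,n_0$, where the gradient in $w$ is taken at a fresh sample in each step, $\gamma_k=\frac{R_{k-1}}{G\sqrt{n_0+1}}$, and $\Pi_k$ is the Euclidean projection onto $\mathcal W\cap\{w:\|w-\widehat w_{k-1}\|_2\le R_{k-1}\}$; in total at most $n$ samples are used, each once. There is an absolute constant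 $C$ such that for all $n\ge100$ and $\delta\in(0,1)$, with probability at least $1-\delta$, $$P(\widehat w_m)-P_*\le C\,\max(\alpha G^2,R_0G)\,\frac{\log n\,\log(\log(n)/\delta)}{n}.$$ -/

import Mathlib

open MeasureTheory ProbabilityTheory
open scoped Matrix Matrix.Norms.L2Operator RealInnerProductSpace

universe u v w

noncomputable section

/-! Optimization vocabulary -/

/-- A polyhedron of `ℝ^d`: the intersection of finitely many closed half-spaces. -/
def IsPolyhedron {d : ℕ} (W : Set (EuclideanSpace ℝ (Fin d))) : Prop :=
  ∃ (k : ℕ) (a : Fin k → EuclideanSpace ℝ (Fin d)) (β : Fin k → ℝ),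
    W = {x | ∀ i, ⟪a i, x⟫ ≤ β i}

/-- The set of minimizers of `F` over `W`. -/
def argminOn {E : Type*} (F : E → ℝ) (W : Set E) : Set E :=
  {x | x ∈ W ∧ ∀ y ∈ W, F x ≤ F y}

/-- `y` is a point of `K` closest to `x` in Euclidean norm. -/
def IsClosest {d : ℕ} (K : Set (EuclideanSpace ℝ (Fin d)))
    (x y : EuclideanSpace ℝ (Fin d)) : Prop :=
  y ∈ K ∧ ∀ v ∈ K, ‖x - y‖ ≤ ‖x - v‖

/-- The Euclidean projection onto `K`; it is the unique closest point of `K` as soon as `K` is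
nonempty, closed and convex. -/
def proj {d : ℕ} (K : Set (EuclideanSpace ℝ (Fin d)))
    (x : EuclideanSpace ℝ (Fin d)) : EuclideanSpace ℝ (Fin d) :=
  Classical.epsilon (IsClosest K x)

/-- The error bound condition `EBC(θ, α)` for the minimization of `F` over `W`: every `x ∈ W` has a
closest minimizer `xs`, and `‖x - xs‖² ≤ α (F x - F xs)^θ`. (Both sides are the same for all
closest minimizers of `x`.) -/
def EBC {d : ℕ} (W : Set (EuclideanSpace ℝ (Fin d))) (F : EuclideanSpace ℝ (Fin d) → ℝ)
    (θ α : ℝ) : Prop :=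
  0 < θ ∧ θ ≤ 1 ∧ 0 < α ∧
    ∀ x ∈ W, ∃ xs, IsClosest (argminOn F W) x xs ∧ ‖x - xs‖ ^ 2 ≤ α * (F x - F xs) ^ θ

/-! Stochastic quadratic problems -/

/-- The data of a stochastic quadratic problem in dimension `d`: the joint law `μ` of the random
pair `(z, z')`, the random matrix `A(z)`, the random vector `b(z')`, the constant `c` and the
feasible set `W`. -/
structure QuadProblem (d : ℕ) (Z : Type u) (Z' : Type v)
    [MeasurableSpace Z] [MeasurableSpace Z'] where
  μ : Measure (Z × Z')
  A : Z → Matrix (Fin d) (Fin d) ℝ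
  b : Z' → EuclideanSpace ℝ (Fin d)
  c : ℝ
  W : Set (EuclideanSpace ℝ (Fin d))

namespace QuadProblem

variable {d : ℕ} {Z : Type u} {Z' : Type v} [MeasurableSpace Z] [MeasurableSpace Z']

/-- The expected matrix `E[A(z)]`. -/
def meanA (Q : QuadProblem d Z Z') : Matrix (Fin d) (Fin d) ℝ :=
  Matrix.of fun i j => ∫ p, Q.A p.1 i j ∂Q.μ

/-- The expected vector `E[b(z')]`. -/
def meanb (Q : QuadProblem d Z Z') : EuclideanSpace ℝ (Fin d) :=
  ∫ p, Q.b p.2 ∂Q.μ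

/-- The random function `f(w, z, z') = wᵀ A(z) w + wᵀ b(z') + c`. -/
def loss (Q : QuadProblem d Z Z') (x : EuclideanSpace ℝ (Fin d)) (p : Z × Z') : ℝ :=
  x.ofLp ⬝ᵥ (Q.A p.1 *ᵥ x.ofLp) + ⟪x, Q.b p.2⟫ + Q.c

/-- The objective `P(w) = wᵀ E[A(z)] w + wᵀ E[b(z')] + c`. -/
def risk (Q : QuadProblem d Z Z') (x : EuclideanSpace ℝ (Fin d)) : ℝ :=
  x.ofLp ⬝ᵥ (Q.meanA *ᵥ x.ofLp) + ⟪x, Q.meanb⟫ + Q.c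

/-- The optimal risk `P_* = min_{w ∈ W} P(w)`. -/
def optRisk (Q : QuadProblem d Z Z') : ℝ :=
  sInf (Q.risk '' Q.W)

/-- The empirical risk of the first `n` terms of a sample sequence. -/
def empRisk (Q : QuadProblem d Z Z') (n : ℕ) (s : ℕ → Z × Z')
    (x : EuclideanSpace ℝ (Fin d)) : ℝ :=
  (1 / (n : ℝ)) * ∑ i ∈ Finset.range n, Q.loss x (s i)

/-- The standing assumptions: `A(z)` and `b(z')` are random variables with finite expectations,
`E[A(z)]` is (symmetric) positive semidefinite and `W` is a nonempty bounded polyhedron. -/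
structure Standing (Q : QuadProblem d Z Z') : Prop where
  isProbability : IsProbabilityMeasure Q.μ
  measurable_A : ∀ i j, Measurable fun z => Q.A z i j
  measurable_b : Measurable Q.b
  integrable_A : ∀ i j, Integrable (fun p => Q.A p.1 i j) Q.μ
  integrable_b : Integrable (fun p => Q.b p.2) Q.μ
  posSemidef : Q.meanA.PosSemidef
  polyhedron : IsPolyhedron Q.W
  bounded : Bornology.IsBounded Q.W
  nonempty : Q.W.Nonempty

/-- `max(‖A(z)‖₂, ‖b(z')‖₂) ≤ σ`, with the spectral norm of `A(z)`, for almost every pair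
`(z, z')`. -/
def BoundedBy (Q : QuadProblem d Z Z') (σ : ℝ) : Prop :=
  ∀ᵐ p ∂Q.μ, max ‖Q.A p.1‖ ‖Q.b p.2‖ ≤ σ

/-- `f(·, z, z')` is `G`-Lipschitz on `W`, with the same constant for almost all data. -/
def LossLipschitz (Q : QuadProblem d Z Z') (G : ℝ) : Prop :=
  ∀ᵐ p ∂Q.μ, ∀ x ∈ Q.W, ∀ y ∈ Q.W, |Q.loss x p - Q.loss y p| ≤ G * ‖x - y‖

/-- `f(·, z, z')` is convex and `L`-smooth on `W`, with the same constant for almost all data. -/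
def LossConvexSmooth (Q : QuadProblem d Z Z') (L : ℝ) : Prop :=
  ∀ᵐ p ∂Q.μ, ∀ x ∈ Q.W, ∀ y ∈ Q.W,
    0 ≤ Q.loss x p - Q.loss y p - ⟪gradient (fun t => Q.loss t p) y, x - y⟫ ∧
    Q.loss x p - Q.loss y p - ⟪gradient (fun t => Q.loss t p) y, x - y⟫ ≤ L / 2 * ‖x - y‖ ^ 2

/-! The stochastic approximation algorithm -/

/-- The iterates of the projected stochastic (sub)gradient method on the feasible set `K` with step
size `γ`, started at `x₁` and fed with the samples `s 0, s 1, …`. Index `t` is the `(t+1)`-st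
iterate. -/
def ssgIter (Q : QuadProblem d Z Z') (K : Set (EuclideanSpace ℝ (Fin d))) (γ : ℝ)
    (x₁ : EuclideanSpace ℝ (Fin d)) (s : ℕ → Z × Z') : ℕ → EuclideanSpace ℝ (Fin d)
  | 0 => x₁
  | t + 1 =>
      proj K (ssgIter Q K γ x₁ s t
        - γ • gradient (fun y => Q.loss y (s t)) (ssgIter Q K γ x₁ s t))

/-- `SSG(x₁, γ, T, K)`: run `T` steps and return the average of the `T + 1` iterates. -/
def ssg (Q : QuadProblem d Z Z') (x₁ : EuclideanSpace ℝ (Fin d)) (γ : ℝ) (T : ℕ)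
    (K : Set (EuclideanSpace ℝ (Fin d))) (s : ℕ → Z × Z') : EuclideanSpace ℝ (Fin d) :=
  (1 / ((T : ℝ) + 1)) • ∑ t ∈ Finset.range (T + 1), ssgIter Q K γ x₁ s t

/-- The stage outputs of ASA with `n₀` steps per stage. Stage `k + 1` starts at the output of stage
`k`, uses the radius `R₀ / 2^k`, the step size `R₀ / 2^k / (G √(n₀ + 1))`, the feasible set
`W ∩ B(output of stage k, R₀ / 2^k)` and the fresh samples number `k n₀, …, k n₀ + n₀ - 1`. -/
def asaStage (Q : QuadProblem d Z Z') (G R₀ : ℝ) (n₀ : ℕ) (x₁ : EuclideanSpace ℝ (Fin d))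
    (s : ℕ → Z × Z') : ℕ → EuclideanSpace ℝ (Fin d)
  | 0 => x₁
  | k + 1 =>
      ssg Q (asaStage Q G R₀ n₀ x₁ s k)
        (R₀ / 2 ^ k / (G * Real.sqrt ((n₀ : ℝ) + 1))) n₀
        (Q.W ∩ Metric.closedBall (asaStage Q G R₀ n₀ x₁ s k) (R₀ / 2 ^ k))
        (fun t => s (k * n₀ + t))

end QuadProblem

/-- The number of stages `m = ⌊(1/2) log₂ (2n / log₂ n)⌋ - 1` of ASA (it is positive for
`n ≥ 100`). -/
def asaNumStages (n : ℕ) : ℕ :=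
  ⌊(1 / 2 : ℝ) * Real.logb 2 (2 * (n : ℝ) / Real.logb 2 (n : ℝ))⌋₊ - 1

/-- `ASA(x₁, n, R₀)` with Lipschitz parameter `G`: `m` stages of `n₀ = ⌊n / m⌋` steps each, hence
one pass over (at most) the first `n` samples. -/
def QuadProblem.asa {d : ℕ} {Z : Type u} {Z' : Type v} [MeasurableSpace Z] [MeasurableSpace Z']
    (Q : QuadProblem d Z Z') (G : ℝ) (x₁ : EuclideanSpace ℝ (Fin d)) (n : ℕ) (R₀ : ℝ)
    (s : ℕ → Z × Z') : EuclideanSpace ℝ (Fin d) :=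
  Q.asaStage G R₀ (n / asaNumStages n) x₁ s (asaNumStages n)

/-! Samples and high probability -/

/-- `ξ 0, ξ 1, …` are independent random variables on `(Ω, Pr)` with common law `μ`. -/
structure IsIIDSample {Ω : Type w} {X : Type*} [MeasurableSpace Ω] [MeasurableSpace X]
    (Pr : Measure Ω) (μ : Measure X) (ξ : ℕ → Ω → X) : Prop where
  measurable : ∀ i, Measurable (ξ i)
  indep : iIndepFun ξ Pr
  law : ∀ i, Pr.map (ξ i) = μ

/-- "With probability at least `1 - δ`": the (outer) probability that `p` fails is at most `δ`. -/
def WithHighProb {Ω : Type w} [MeasurableSpace Ω] (Pr : Measure Ω) (δ : ℝ) (p : Ω → Prop) : Prop :=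
  Pr {ω | ¬ p ω} ≤ ENNReal.ofReal δ

/-- For every sample size `n` admitted by `adm` and every `δ ∈ (0,1)`, with probability at least
`1 - δ` every empirical risk minimizer computed from `n` i.i.d. samples has excess risk at most
`rate n δ`. Here `Ω` ranges over all probability spaces carrying an i.i.d. sequence. -/
def QuadProblem.ERMRate {d : ℕ} {Z : Type u} {Z' : Type v} [MeasurableSpace Z] [MeasurableSpace Z']
    (Q : QuadProblem d Z Z') (adm : ℕ → Prop) (rate : ℕ → ℝ → ℝ) : Prop :=
  ∀ (Ω : Type w) [MeasurableSpace Ω] (Pr : Measure Ω) [IsProbabilityMeasure Pr]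
    (ξ : ℕ → Ω → Z × Z'), IsIIDSample Pr Q.μ ξ →
    ∀ n : ℕ, adm n → ∀ δ : ℝ, 0 < δ → δ < 1 →
      WithHighProb Pr δ fun ω =>
        ∀ x ∈ argminOn (Q.empRisk n fun i => ξ i ω) Q.W, Q.risk x - Q.optRisk ≤ rate n δ

end

/-!
Minimizers of a convex quadratic `P` over a polyhedron form a polyhedron: if `x₀` is one of them,
`x` is another exactly when `𝔼[A] (x - x₀) = 0` and `⟪∇P x₀, x - x₀⟫ = 0`. Hoffman's bound
therefore controls the distance to this set by these two residuals, and both are controlled by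
`P x - P x₀`; this is the error bound with exponent `1`.

For empirical minimizers, the error bound makes the second moment of the excess loss at most
proportional to the excess risk, so a one-sided Bernstein inequality and a union bound over a net
exclude every point of large excess risk. A nonnegative quadratic dominates the square of its own
gradient, which improves the second moment and leaves only a term proportional to `P_*`.

Each stage of projected stochastic gradient descent errs by at most a multiple of
`G * radius * √(log / n₀)`, by Azuma-Hoeffding. The error bound turns a small risk into a small
distance, so the radius can be halved from stage to stage until the error reaches the noise floor
`α * G ^ 2 * log / n₀`; from then on the iterates move too little to leave it.
-/

section Argmin

variable {E : Type*} [TopologicalSpace E] {F : E → ℝ} {W : Set E}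

theorem argminOn_nonempty (hF : ContinuousOn F W) (hW : IsCompact W) (hne : W.Nonempty) :
    (argminOn F W).Nonempty := by
  obtain ⟨x, hx, hmin⟩ := hW.exists_isMinOn hne hF
  exact ⟨x, hx, fun y hy => hmin hy⟩

theorem isClosed_argminOn (hF : Continuous F) (hW : IsClosed W) : IsClosed (argminOn F W) := by
  have : argminOn F W = W ∩ ⋂ y ∈ W, {x | F x ≤ F y} := by
    ext x
    simp [argminOn]
  rw [this]
  exact hW.inter (isClosed_biInter fun y _ => isClosed_le hF continuous_const)

end Argmin

theorem convex_argminOn {E : Type*} [AddCommGroup E] [Module ℝ E] {F : E → ℝ} {W : Set E}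
    (hF : ConvexOn ℝ W F) : Convex ℝ (argminOn F W) := by
  intro x hx y hy s t hs ht hst
  obtain ⟨hmem, hle⟩ := hF.convex_le (F x) ⟨hx.1, le_rfl⟩ ⟨hy.1, hy.2 x hx.1⟩ hs ht hst
  exact ⟨hmem, fun v hv => hle.trans (hx.2 v hv)⟩

section Convex

variable {E : Type*} [NormedAddCommGroup E] [InnerProductSpace ℝ E]

theorem inner_sub_sub_nonpos_of_forall_norm_sub_le {K : Set E} (hK : Convex ℝ K) {x p v : E}
    (hp : p ∈ K) (hmin : ∀ w ∈ K, ‖x - p‖ ≤ ‖x - w‖) (hv : v ∈ K) : ⟪x - p, v - p⟫ ≤ 0 := by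
  have : Nonempty K := ⟨⟨p, hp⟩⟩
  refine (norm_eq_iInf_iff_real_inner_le_zero hK hp).1 ?_ v hv
  refine le_antisymm (le_ciInf fun w => hmin w w.2) ?_
  exact ciInf_le ⟨0, by rintro _ ⟨w, rfl⟩; exact norm_nonneg _⟩ (⟨p, hp⟩ : K)

theorem isClosed_setOf_forall_inner_le {ι : Type*} (a : ι → E) (β : ι → ℝ) :
    IsClosed {x | ∀ i, ⟪a i, x⟫ ≤ β i} := by
  rw [Set.ofPred_forall]
  exact isClosed_iInter fun i => isClosed_le (by fun_prop) continuous_const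

theorem convex_setOf_forall_inner_le {ι : Type*} (a : ι → E) (β : ι → ℝ) :
    Convex ℝ {x | ∀ i, ⟪a i, x⟫ ≤ β i} := by
  rw [Set.ofPred_forall]
  exact convex_iInter fun i => convex_halfSpace_le (innerₗ E (a i)).isLinear (β i)

theorem inner_nonneg_of_mem_argminOn [CompleteSpace E] {F : E → ℝ} {W : Set E}
    (hW : Convex ℝ W) {F' x y : E} (hF : HasGradientAt F F' y) (hy : y ∈ argminOn F W)
    (hx : x ∈ W) : 0 ≤ ⟪F', x - y⟫ := by
  have hmin : IsLocalMinOn F W y := Filter.eventually_of_mem self_mem_nhdsWithin hy.2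
  simpa using hmin.hasFDerivWithinAt_nonneg hF.hasFDerivAt.hasFDerivWithinAt
    (sub_mem_posTangentConeAt_of_segment_subset (hW.segment_subset hy.1 hx))

theorem abs_inner_le_of_lipschitz [CompleteSpace E] {F : E → ℝ} {W : Set E} (hW : Convex ℝ W)
    {G : ℝ} (hG : ∀ x ∈ W, ∀ y ∈ W, |F x - F y| ≤ G * ‖x - y‖) {F' x y : E}
    (hF : HasGradientAt F F' y) (hy : y ∈ W) (hx : x ∈ W) : |⟪F', x - y⟫| ≤ G * ‖x - y‖ := by
  have hslope : Filter.Tendsto (fun t : ℝ => t⁻¹ • (F (y + t • (x - y)) - F y))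
      (nhdsWithin 0 (Set.Ioi 0)) (nhds ⟪F', x - y⟫) := by
    have := (hF.hasFDerivAt.hasLineDerivAt (x - y)).tendsto_slope_zero_right
    simpa using this
  refine le_of_tendsto hslope.abs ?_
  filter_upwards [Ioc_mem_nhdsGT one_pos] with t ht
  have hmem : y + t • (x - y) ∈ W := hW.add_smul_sub_mem hy hx ⟨ht.1.le, ht.2⟩
  have h := hG _ hmem y hy
  rw [add_sub_cancel_left, norm_smul, Real.norm_eq_abs, abs_of_pos ht.1] at h
  rw [smul_eq_mul, abs_mul, abs_inv, abs_of_pos ht.1, inv_mul_le_iff₀ ht.1]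
  linarith

end Convex

section Hoffman

variable {E : Type*} [NormedAddCommGroup E] [InnerProductSpace ℝ E]

open ProperCone (innerDual mem_innerDual)

theorem exists_pos_forall_mul_norm_le_sum_max_inner [FiniteDimensional ℝ E] {ι : Type*}
    (a : ι → E) (s : Finset ι) :
    ∃ c : ℝ, 0 < c ∧ ∀ u ∈ innerDual (innerDual (a '' s) : Set E),
      c * ‖u‖ ≤ ∑ i ∈ s, max ⟪a i, u⟫ 0 := by
  set C := innerDual (innerDual (a '' s) : Set E)
  set f : E → ℝ := fun u => ∑ i ∈ s, max ⟪a i, u⟫ 0 with hf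
  have hf_pos : ∀ u ∈ C, u ≠ 0 → 0 < f u := by
    intro u hu hu0
    by_contra hcon
    have hzero : ∀ i ∈ s, max ⟪a i, u⟫ 0 = 0 :=
      (Finset.sum_eq_zero_iff_of_nonneg fun i _ => le_max_right _ _).1
        (le_antisymm (not_lt.1 hcon) (Finset.sum_nonneg fun i _ => le_max_right _ _))
    have hneg : -u ∈ innerDual (a '' s) := by
      rintro _ ⟨i, hi, rfl⟩
      simpa using max_eq_right_iff.1 (hzero i hi)
    have h := mem_innerDual.1 hu hneg
    rw [inner_neg_left, real_inner_self_eq_norm_sq] at h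
    nlinarith [norm_pos_iff.2 hu0]
  have hf_smul : ∀ (r : ℝ) (u : E), 0 ≤ r → f (r • u) = r * f u := by
    intro r u hr
    simp only [hf, inner_smul_right, Finset.mul_sum, mul_max_of_nonneg _ _ hr, mul_zero]
  have hcompact : IsCompact (Metric.sphere (0 : E) 1 ∩ C) :=
    (isCompact_sphere 0 1).inter_right C.isClosed
  obtain ⟨c, hc, hle⟩ : ∃ c : ℝ, 0 < c ∧ ∀ u ∈ Metric.sphere (0 : E) 1 ∩ C, c ≤ f u := by
    refine hcompact.exists_forall_le' (by fun_prop) fun u hu => hf_pos u hu.2 ?_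
    exact ne_zero_of_mem_unit_sphere ⟨u, hu.1⟩
  refine ⟨c, hc, fun u hu => ?_⟩
  rcases eq_or_ne u 0 with rfl | hu0
  · simp
  have hn : 0 < ‖u‖ := norm_pos_iff.2 hu0
  have h := hle (‖u‖⁻¹ • u) ⟨by simp [norm_smul, hn.ne'], C.smul_mem hu (inv_nonneg.2 hn.le)⟩
  rwa [hf_smul _ _ (inv_nonneg.2 hn.le), inv_mul_eq_div, le_div_iff₀ hn] at h

/-- By the bipolar theorem, the double dual is the cone spanned by the active normals. -/
theorem sub_mem_innerDual_innerDual_active [CompleteSpace E] {ι : Type*} [Finite ι] {a : ι → E}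
    {β : ι → ℝ} {x p : E} (hp : ∀ i, ⟪a i, p⟫ ≤ β i)
    (hmin : ∀ y, (∀ i, ⟪a i, y⟫ ≤ β i) → ‖x - p‖ ≤ ‖x - y‖) :
    x - p ∈ innerDual (innerDual (a '' {i | ⟪a i, p⟫ = β i}) : Set E) := by
  intro y hy
  have hfeasible : ∀ᶠ t in nhdsWithin (0 : ℝ) (Set.Ioi 0), ∀ i, ⟪a i, p - t • y⟫ ≤ β i := by
    refine Filter.eventually_all.2 fun i => ?_
    rcases (hp i).eq_or_lt with hi | hi
    · filter_upwards [self_mem_nhdsWithin] with t ht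
      rw [inner_sub_right, inner_smul_right, hi]
      have : 0 ≤ ⟪a i, y⟫ := hy ⟨i, hi, rfl⟩
      linarith [mul_nonneg (Set.mem_Ioi.1 ht).le this]
    · have hcont : ContinuousAt (fun t : ℝ => ⟪a i, p - t • y⟫) 0 := by fun_prop
      refine nhdsWithin_le_nhds ((hcont.eventually_lt_const ?_).mono fun t => le_of_lt)
      simpa using hi
  obtain ⟨t, hfeas, ht⟩ := (hfeasible.and self_mem_nhdsWithin).exists
  have h := inner_sub_sub_nonpos_of_forall_norm_sub_le (convex_setOf_forall_inner_le a β) hp hmin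
    hfeas
  rw [sub_sub_cancel_left, inner_neg_right, inner_smul_right, real_inner_comm,
    neg_nonpos] at h
  exact nonneg_of_mul_nonneg_right h ht

/-- **Hoffman's error bound**: `κ` does not depend on the right-hand sides because there are only
finitely many sets of active constraints. -/
theorem exists_hoffman_bound [FiniteDimensional ℝ E] {ι : Type*} [Fintype ι] (a : ι → E) :
    ∃ κ : ℝ, 0 < κ ∧ ∀ (β : ι → ℝ) (x y : E), (∀ i, ⟪a i, y⟫ ≤ β i) →
      ∃ p, (∀ i, ⟪a i, p⟫ ≤ β i) ∧ ‖x - p‖ ≤ κ * ∑ i, max (⟪a i, x⟫ - β i) 0 := by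
  classical
  choose c hc hle using exists_pos_forall_mul_norm_le_sum_max_inner a
  obtain ⟨s₀, hs₀⟩ := Finite.exists_min c
  refine ⟨(c s₀)⁻¹, inv_pos.2 (hc s₀), fun β x y hy => ?_⟩
  obtain ⟨p, hp, hdist⟩ :=
    (isClosed_setOf_forall_inner_le a β).exists_infDist_eq_dist ⟨y, hy⟩ x
  have hmin : ∀ v, (∀ i, ⟪a i, v⟫ ≤ β i) → ‖x - p‖ ≤ ‖x - v‖ := by
    intro v hv
    rw [← dist_eq_norm, ← dist_eq_norm, ← hdist]
    exact Metric.infDist_le_dist_of_mem hv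
  set s : Finset ι := {i | ⟪a i, p⟫ = β i} with hs
  have hcone : x - p ∈ innerDual (innerDual (a '' s) : Set E) := by
    simpa [hs] using sub_mem_innerDual_innerDual_active hp hmin
  refine ⟨p, hp, ?_⟩
  rw [inv_mul_eq_div, le_div_iff₀ (hc s₀), mul_comm]
  calc c s₀ * ‖x - p‖ ≤ c s * ‖x - p‖ := by gcongr; exact hs₀ s
    _ ≤ ∑ i ∈ s, max ⟪a i, x - p⟫ 0 := hle s _ hcone
    _ = ∑ i ∈ s, max (⟪a i, x⟫ - β i) 0 :=
      Finset.sum_congr rfl fun i hi => by rw [inner_sub_right, (Finset.mem_filter.1 hi).2]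
    _ ≤ ∑ i, max (⟪a i, x⟫ - β i) 0 :=
      Finset.sum_le_univ_sum_of_nonneg fun i => le_max_right _ _

theorem exists_hoffman_bound_eq [FiniteDimensional ℝ E] {ι ι' : Type*} [Fintype ι] [Fintype ι']
    (a : ι → E) (e : ι' → E) :
    ∃ κ : ℝ, 0 < κ ∧ ∀ (β : ι → ℝ) (x y : E), (∀ i, ⟪a i, y⟫ ≤ β i) →
      ∃ p, (∀ i, ⟪a i, p⟫ ≤ β i) ∧ (∀ j, ⟪e j, p - y⟫ = 0) ∧
        ‖x - p‖ ≤ κ * (∑ i, max (⟪a i, x⟫ - β i) 0 + ∑ j, |⟪e j, x - y⟫|) := by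
  obtain ⟨κ, hκ, h⟩ := exists_hoffman_bound (Sum.elim a (Sum.elim e (-e)))
  refine ⟨κ, hκ, fun β x y hy => ?_⟩
  obtain ⟨p, hp, hle⟩ := h (Sum.elim β (Sum.elim (fun j => ⟪e j, y⟫) fun j => -⟪e j, y⟫)) x y
    (by rintro (i | j | j) <;> simp [hy])
  refine ⟨p, fun i => hp (Sum.inl i), fun j => ?_, hle.trans_eq ?_⟩
  · have h₁ : ⟪e j, p⟫ ≤ ⟪e j, y⟫ := hp (Sum.inr (Sum.inl j))
    have h₂ : ⟪e j, y⟫ ≤ ⟪e j, p⟫ := by simpa using hp (Sum.inr (Sum.inr j))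
    rw [inner_sub_right, le_antisymm h₁ h₂, sub_self]
  · have habs : ∀ r : ℝ, max r 0 + max (-r) 0 = |r| := fun r => by
      rw [← posPart_add_negPart, posPart_def, negPart_def]
    simp only [Fintype.sum_sum_type, Sum.elim_inl, Sum.elim_inr, Pi.neg_apply, inner_neg_left,
      ← Finset.sum_add_distrib, inner_sub_right, ← habs, neg_sub, sub_neg_eq_add, neg_add_eq_sub]

end Hoffman

section Closest

variable {d : ℕ} {K : Set (EuclideanSpace ℝ (Fin d))}

theorem IsPolyhedron.isClosed (h : IsPolyhedron K) : IsClosed K := by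
  obtain ⟨k, a, β, rfl⟩ := h
  exact isClosed_setOf_forall_inner_le a β

theorem IsPolyhedron.convex (h : IsPolyhedron K) : Convex ℝ K := by
  obtain ⟨k, a, β, rfl⟩ := h
  exact convex_setOf_forall_inner_le a β

theorem exists_isClosest (hc : IsClosed K) (hne : K.Nonempty) (x : EuclideanSpace ℝ (Fin d)) :
    ∃ y, IsClosest K x y := by
  obtain ⟨y, hy, h⟩ := hc.exists_infDist_eq_dist hne x
  refine ⟨y, hy, fun v hv => ?_⟩
  rw [← dist_eq_norm, ← dist_eq_norm, ← h]
  exact Metric.infDist_le_dist_of_mem hv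

theorem isClosest_proj (hc : IsClosed K) (hne : K.Nonempty) (x : EuclideanSpace ℝ (Fin d)) :
    IsClosest K x (proj K x) :=
  Classical.epsilon_spec (exists_isClosest hc hne x)

end Closest

section Quad

variable {d : ℕ}

/-- The quadratic function `xᵀ A x + xᵀ b + c`, the common form of the loss and of the risk. -/
noncomputable def quad (A : Matrix (Fin d) (Fin d) ℝ) (b : EuclideanSpace ℝ (Fin d)) (c : ℝ)
    (x : EuclideanSpace ℝ (Fin d)) : ℝ :=
  x.ofLp ⬝ᵥ (A *ᵥ x.ofLp) + ⟪x, b⟫ + c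

/-- The gradient of `quad A b c`. The matrix `A` is not assumed symmetric. -/
noncomputable def quadGrad (A : Matrix (Fin d) (Fin d) ℝ) (b x : EuclideanSpace ℝ (Fin d)) :
    EuclideanSpace ℝ (Fin d) :=
  Matrix.toEuclideanCLM (n := Fin d) (𝕜 := ℝ) (A + Aᵀ) x + b

section Algebra

variable (A : Matrix (Fin d) (Fin d) ℝ) (b : EuclideanSpace ℝ (Fin d)) (c : ℝ)
  (x y h : EuclideanSpace ℝ (Fin d))

theorem inner_quadGrad : ⟪quadGrad A b x, h⟫ =
    h.ofLp ⬝ᵥ (A *ᵥ x.ofLp) + x.ofLp ⬝ᵥ (A *ᵥ h.ofLp) + ⟪h, b⟫ := by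
  rw [quadGrad, real_inner_comm, inner_add_right, Matrix.inner_toEuclideanCLM, Matrix.add_mulVec,
    dotProduct_add, Matrix.mulVec_transpose, dotProduct_comm h.ofLp (_ ᵥ* _),
    ← Matrix.dotProduct_mulVec]

theorem quad_add : quad A b c (x + h) =
    quad A b c x + ⟪quadGrad A b x, h⟫ + h.ofLp ⬝ᵥ (A *ᵥ h.ofLp) := by
  rw [inner_quadGrad, quad, quad]
  simp only [WithLp.ofLp_add, Matrix.mulVec_add, dotProduct_add, add_dotProduct, inner_add_left]
  ring

theorem quad_sub : quad A b c x - quad A b c y =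
    ⟪quadGrad A b y, x - y⟫ + (x - y).ofLp ⬝ᵥ (A *ᵥ (x - y).ofLp) := by
  have := quad_add A b c y (x - y)
  rw [add_sub_cancel] at this
  linarith

theorem abs_dotProduct_mulVec_le : |x.ofLp ⬝ᵥ (A *ᵥ y.ofLp)| ≤ ‖A‖ * ‖x‖ * ‖y‖ := by
  rw [← Matrix.inner_toEuclideanCLM]
  have hA : ‖Matrix.toEuclideanCLM (n := Fin d) (𝕜 := ℝ) A y‖ ≤ ‖A‖ * ‖y‖ := by
    rw [← Matrix.l2_opNorm_toEuclideanCLM]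
    exact ContinuousLinearMap.le_opNorm _ _
  calc _ ≤ ‖x‖ * ‖Matrix.toEuclideanCLM (n := Fin d) (𝕜 := ℝ) A y‖ := abs_real_inner_le_norm _ _
    _ ≤ ‖x‖ * (‖A‖ * ‖y‖) := by gcongr
    _ = ‖A‖ * ‖x‖ * ‖y‖ := by ring

theorem hasGradientAt_quad : HasGradientAt (quad A b c) (quadGrad A b x) x := by
  rw [hasGradientAt_iff_isLittleO_nhds_zero]
  have hremainder : (fun h => quad A b c (x + h) - quad A b c x - ⟪quadGrad A b x, h⟫)
      = fun h => h.ofLp ⬝ᵥ (A *ᵥ h.ofLp) := by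
    funext h
    rw [quad_add]
    ring
  rw [hremainder]
  refine Asymptotics.IsBigO.trans_isLittleO (g := fun h => ‖h‖ ^ 2) ?_
    (Asymptotics.isLittleO_norm_pow_id one_lt_two)
  refine Asymptotics.IsBigO.of_bound ‖A‖ (Filter.Eventually.of_forall fun h => ?_)
  rw [Real.norm_eq_abs, norm_pow, norm_norm, sq, ← mul_assoc]
  exact abs_dotProduct_mulVec_le A h h

theorem continuous_quad : Continuous (quad A b c) :=
  continuous_iff_continuousAt.2 fun x => (hasGradientAt_quad A b c x).differentiableAt.continuousAt

end Algebra

section PosSemidef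

variable {A : Matrix (Fin d) (Fin d) ℝ} {b x y : EuclideanSpace ℝ (Fin d)} {c : ℝ}

theorem inner_quadGrad_le_of_posSemidef (hA : A.PosSemidef) :
    ⟪quadGrad A b y, x - y⟫ ≤ quad A b c x - quad A b c y := by
  have : 0 ≤ (x - y).ofLp ⬝ᵥ (A *ᵥ (x - y).ofLp) := hA.dotProduct_mulVec_nonneg _
  rw [quad_sub]
  linarith

theorem convexOn_quad (hA : A.PosSemidef) {W : Set (EuclideanSpace ℝ (Fin d))}
    (hW : Convex ℝ W) : ConvexOn ℝ W (quad A b c) := by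
  refine ⟨hW, fun x _ y _ s t hs ht hst => ?_⟩
  set z := s • x + t • y with hz
  have hx := mul_le_mul_of_nonneg_left
    (inner_quadGrad_le_of_posSemidef (b := b) (c := c) (x := x) (y := z) hA) hs
  have hy := mul_le_mul_of_nonneg_left
    (inner_quadGrad_le_of_posSemidef (b := b) (c := c) (x := y) (y := z) hA) ht
  have hgrad : s * ⟪quadGrad A b z, x - z⟫ + t * ⟪quadGrad A b z, y - z⟫ = 0 := by
    rw [← inner_smul_right, ← inner_smul_right, ← inner_add_right]
    have : s • (x - z) + t • (y - z) = z - (s + t) • z := by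
      rw [hz]
      module
    rw [this, hst, one_smul, sub_self, inner_zero_right]
  have hsum : quad A b c z = (s + t) * quad A b c z := by rw [hst, one_mul]
  rw [smul_eq_mul, smul_eq_mul]
  linarith

/-- The Cauchy-Schwarz inequality for the form of `H`, applied to `h` and the `j`-th basis
vector. -/
theorem sq_mulVec_apply_le_of_posSemidef {n : Type*} [Fintype n] {H : Matrix n n ℝ}
    (hH : H.PosSemidef) (h : n → ℝ) (j : n) : (H *ᵥ h) j ^ 2 ≤ H j j * (h ⬝ᵥ (H *ᵥ h)) := by
  classical
  have hsymm : H.IsSymm := hH.isHermitian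
  have := (Matrix.toBilin' H).apply_sq_le_of_symm
    (fun v => by simpa [Matrix.toBilin'_apply'] using hH.dotProduct_mulVec_nonneg v)
    ⟨(Matrix.isSymm_toBilin'_iff_isSymm.2 hsymm).eq⟩ (Pi.single j 1) h
  simpa [Matrix.toBilin'_apply'] using this

end PosSemidef

end Quad

section ErrorBound

variable {d : ℕ} {A : Matrix (Fin d) (Fin d) ℝ} {b : EuclideanSpace ℝ (Fin d)} {c : ℝ}
  {W : Set (EuclideanSpace ℝ (Fin d))} {x₀ : EuclideanSpace ℝ (Fin d)}

theorem inner_toLp_row (A : Matrix (Fin d) (Fin d) ℝ) (j : Fin d) (x : EuclideanSpace ℝ (Fin d)) :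
    ⟪WithLp.toLp 2 (A j), x⟫ = (A *ᵥ x.ofLp) j := by
  rw [real_inner_comm, EuclideanSpace.inner_eq_star_dotProduct]
  simp [Matrix.mulVec]

theorem mem_argminOn_quad_of_mulVec_eq_zero (hx₀ : x₀ ∈ argminOn (quad A b c) W)
    {y : EuclideanSpace ℝ (Fin d)} (hy : y ∈ W) (hA : A *ᵥ (y - x₀).ofLp = 0)
    (hgrad : ⟪quadGrad A b x₀, y - x₀⟫ = 0) : y ∈ argminOn (quad A b c) W := by
  refine ⟨hy, fun v hv => le_trans ?_ (hx₀.2 v hv)⟩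
  have := quad_sub A b c y x₀
  rw [hA, hgrad, dotProduct_zero] at this
  linarith

theorem inner_quadGrad_add_sum_abs_mulVec_le (hA : A.PosSemidef) (hW : Convex ℝ W)
    (hx₀ : x₀ ∈ argminOn (quad A b c) W) {x : EuclideanSpace ℝ (Fin d)} (hx : x ∈ W) {D : ℝ}
    (hD : quad A b c x - quad A b c x₀ ≤ D) :
    |⟪quadGrad A b x₀, x - x₀⟫| + ∑ j, |(A *ᵥ (x - x₀).ofLp) j|
      ≤ (√D + ∑ j, √(A j j)) * √(quad A b c x - quad A b c x₀) := by
  set Δ := quad A b c x - quad A b c x₀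
  have hgrad : 0 ≤ ⟪quadGrad A b x₀, x - x₀⟫ :=
    inner_nonneg_of_mem_argminOn hW (hasGradientAt_quad A b c x₀) hx₀ hx
  have hform : 0 ≤ (x - x₀).ofLp ⬝ᵥ (A *ᵥ (x - x₀).ofLp) := hA.dotProduct_mulVec_nonneg _
  have hsum : ⟪quadGrad A b x₀, x - x₀⟫ + (x - x₀).ofLp ⬝ᵥ (A *ᵥ (x - x₀).ofLp) = Δ :=
    (quad_sub A b c x x₀).symm
  have hΔ0 : 0 ≤ Δ := sub_nonneg.2 (hx₀.2 x hx)
  rw [add_mul, Finset.sum_mul, abs_of_nonneg hgrad]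
  refine add_le_add ?_ (Finset.sum_le_sum fun j _ => ?_)
  · calc ⟪quadGrad A b x₀, x - x₀⟫ ≤ Δ := by linarith
      _ = √Δ * √Δ := (Real.mul_self_sqrt hΔ0).symm
      _ ≤ √D * √Δ := by gcongr
  · rw [← Real.sqrt_mul hA.diag_nonneg]
    refine Real.abs_le_sqrt ((sq_mulVec_apply_le_of_posSemidef hA _ j).trans ?_)
    exact mul_le_mul_of_nonneg_left (by linarith) hA.diag_nonneg

/-- The minimizers form a polyhedron on which `A (x - x₀) = 0` and `⟪∇F x₀, x - x₀⟫ = 0`, so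
Hoffman's bound controls the distance to them by the violation of these equations. -/
theorem exists_EBC_quad (hA : A.PosSemidef) (hW : IsPolyhedron W) (hb : Bornology.IsBounded W)
    (hne : W.Nonempty) : ∃ α, EBC W (quad A b c) 1 α := by
  have hcomp : IsCompact W := Metric.isCompact_of_isClosed_isBounded hW.isClosed hb
  have hcont := continuous_quad A b c
  have hconv := hW.convex
  obtain ⟨x₀, hx₀⟩ := argminOn_nonempty hcont.continuousOn hcomp hne
  obtain ⟨D, hD⟩ := hcomp.bddAbove_image hcont.continuousOn
  obtain ⟨k, a, β, rfl⟩ := hW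
  set g := quadGrad A b x₀
  obtain ⟨κ, hκ, hH⟩ := exists_hoffman_bound_eq a
    (fun o : Option (Fin d) => o.elim g fun j => WithLp.toLp 2 (A j))
  set B := √(D - quad A b c x₀) + ∑ j, √(A j j)
  refine ⟨(κ * B) ^ 2 + 1, one_pos, le_rfl, by positivity, fun x hx => ?_⟩
  obtain ⟨xs, hxs⟩ := exists_isClosest (isClosed_argminOn hcont hcomp.isClosed) ⟨x₀, hx₀⟩ x
  refine ⟨xs, hxs, ?_⟩
  obtain ⟨p, hpW, hpe, hpx⟩ := hH β x x₀ hx₀.1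
  have hp : p ∈ argminOn (quad A b c) {x | ∀ i, ⟪a i, x⟫ ≤ β i} := by
    refine mem_argminOn_quad_of_mulVec_eq_zero hx₀ hpW (funext fun j => ?_) (hpe none)
    rw [← inner_toLp_row]
    exact hpe (some j)
  have hfeas : ∑ i, max (⟪a i, x⟫ - β i) 0 = 0 :=
    Finset.sum_eq_zero fun i _ => max_eq_right (sub_nonpos.2 (hx i))
  simp only [hfeas, zero_add, Fintype.sum_option, Option.elim, inner_toLp_row] at hpx
  rw [Real.rpow_one, le_antisymm (hxs.1.2 _ hx₀.1) (hx₀.2 _ hxs.1.1)]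
  set Δ := quad A b c x - quad A b c x₀
  have hΔ0 : 0 ≤ Δ := sub_nonneg.2 (hx₀.2 x hx)
  have hdist : ‖x - xs‖ ≤ κ * (B * √Δ) := (hxs.2 p hp).trans <| hpx.trans <|
    mul_le_mul_of_nonneg_left (inner_quadGrad_add_sum_abs_mulVec_le hA hconv hx₀ hx
      (sub_le_sub_right (hD ⟨x, hx, rfl⟩) _)) hκ.le
  calc ‖x - xs‖ ^ 2 ≤ (κ * (B * √Δ)) ^ 2 := by gcongr
    _ = (κ * B) ^ 2 * Δ := by rw [← mul_assoc, mul_pow, Real.sq_sqrt hΔ0]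
    _ ≤ ((κ * B) ^ 2 + 1) * Δ := by gcongr; linarith

end ErrorBound

theorem measurable_dotProduct_mulVec {S : Type*} [MeasurableSpace S] {d : ℕ} {x y : S → Fin d → ℝ}
    {M : S → Matrix (Fin d) (Fin d) ℝ} (hx : Measurable x)
    (hM : ∀ i j, Measurable fun a => M a i j) (hy : Measurable y) :
    Measurable fun a => x a ⬝ᵥ (M a *ᵥ y a) := by
  simp only [dotProduct, Matrix.mulVec]
  fun_prop

namespace QuadProblem

/-- The part of the standing assumptions that concerns the data only: `A(z)` and `b(z')` are random
variables with finite expectations. -/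
structure HasFiniteMeans {d : ℕ} {Z : Type u} {Z' : Type v} [MeasurableSpace Z]
    [MeasurableSpace Z'] (Q : QuadProblem d Z Z') : Prop where
  isProbability : IsProbabilityMeasure Q.μ
  measurable_A : ∀ i j, Measurable fun z => Q.A z i j
  measurable_b : Measurable Q.b
  integrable_A : ∀ i j, Integrable (fun p => Q.A p.1 i j) Q.μ
  integrable_b : Integrable (fun p => Q.b p.2) Q.μ

variable {d : ℕ} {Z : Type u} {Z' : Type v} [MeasurableSpace Z] [MeasurableSpace Z']
  {Q : QuadProblem d Z Z'}

theorem Standing.hasFiniteMeans (hQ : Q.Standing) : Q.HasFiniteMeans :=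
  ⟨hQ.isProbability, hQ.measurable_A, hQ.measurable_b, hQ.integrable_A, hQ.integrable_b⟩

theorem risk_eq_quad : Q.risk = quad Q.meanA Q.meanb Q.c := rfl

theorem hasGradientAt_loss (x : EuclideanSpace ℝ (Fin d)) (p : Z × Z') :
    HasGradientAt (fun y => Q.loss y p) (quadGrad (Q.A p.1) (Q.b p.2) x) x :=
  hasGradientAt_quad _ _ _ _

theorem optRisk_eq {x : EuclideanSpace ℝ (Fin d)} (hx : x ∈ argminOn Q.risk Q.W) :
    Q.optRisk = Q.risk x := by
  refine IsLeast.csInf_eq ⟨⟨x, hx.1, rfl⟩, ?_⟩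
  rintro _ ⟨y, hy, rfl⟩
  exact hx.2 y hy

theorem exists_minimizer_of_EBC {α : ℝ} (hE : EBC Q.W Q.risk 1 α) {x : EuclideanSpace ℝ (Fin d)}
    (hx : x ∈ Q.W) :
    ∃ y ∈ Q.W, Q.risk y = Q.optRisk ∧ ‖x - y‖ ^ 2 ≤ α * (Q.risk x - Q.optRisk) := by
  obtain ⟨y, hy, h⟩ := hE.2.2.2 x hx
  rw [Real.rpow_one, ← optRisk_eq hy.1] at h
  exact ⟨y, hy.1.1, (optRisk_eq hy.1).symm, h⟩

theorem BoundedBy.lossLipschitz {σ R : ℝ} (h : Q.BoundedBy σ) (hR : ∀ x ∈ Q.W, ‖x‖ ≤ R) :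
    Q.LossLipschitz (2 * σ * R + σ) := by
  filter_upwards [h] with p hp x hx y hy
  obtain ⟨hA, hb⟩ := max_le_iff.1 hp
  have hσ : 0 ≤ σ := (norm_nonneg _).trans hA
  have hsplit : Q.loss x p - Q.loss y p = x.ofLp ⬝ᵥ (Q.A p.1 *ᵥ (x - y).ofLp)
      + (x - y).ofLp ⬝ᵥ (Q.A p.1 *ᵥ y.ofLp) + ⟪x - y, Q.b p.2⟫ := by
    simp only [loss, WithLp.ofLp_sub, Matrix.mulVec_sub, dotProduct_sub, sub_dotProduct,
      inner_sub_left]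
    ring
  rw [hsplit]
  calc _ ≤ |x.ofLp ⬝ᵥ (Q.A p.1 *ᵥ (x - y).ofLp)| + |(x - y).ofLp ⬝ᵥ (Q.A p.1 *ᵥ y.ofLp)|
        + |⟪x - y, Q.b p.2⟫| := abs_add_three _ _ _
    _ ≤ ‖Q.A p.1‖ * ‖x‖ * ‖x - y‖ + ‖Q.A p.1‖ * ‖x - y‖ * ‖y‖ + ‖x - y‖ * ‖Q.b p.2‖ := by
      gcongr
      exacts [abs_dotProduct_mulVec_le _ _ _, abs_dotProduct_mulVec_le _ _ _,
        abs_real_inner_le_norm _ _]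
    _ ≤ σ * R * ‖x - y‖ + σ * ‖x - y‖ * R + ‖x - y‖ * σ := by
      gcongr
      exacts [hR x hx, hR y hy]
    _ = (2 * σ * R + σ) * ‖x - y‖ := by ring

namespace HasFiniteMeans

theorem integrable_dotProduct (hQ : Q.HasFiniteMeans) (x y : Fin d → ℝ) :
    Integrable (fun p => x ⬝ᵥ (Q.A p.1 *ᵥ y)) Q.μ := by
  simp only [dotProduct, Matrix.mulVec]
  exact integrable_finsetSum _ fun i _ => .const_mul
    (integrable_finsetSum _ fun j _ => (hQ.integrable_A i j).mul_const _) _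

theorem integral_dotProduct (hQ : Q.HasFiniteMeans) (x y : Fin d → ℝ) :
    ∫ p, x ⬝ᵥ (Q.A p.1 *ᵥ y) ∂Q.μ = x ⬝ᵥ (Q.meanA *ᵥ y) := by
  simp only [dotProduct, Matrix.mulVec, meanA, Matrix.of_apply]
  rw [integral_finsetSum _ fun i _ => Integrable.const_mul
    (integrable_finsetSum _ fun j _ => (hQ.integrable_A i j).mul_const _) _]
  refine Finset.sum_congr rfl fun i _ => ?_
  rw [integral_const_mul, integral_finsetSum _ fun j _ => (hQ.integrable_A i j).mul_const _]
  simp_rw [integral_mul_const]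

theorem integrable_inner_b (hQ : Q.HasFiniteMeans) (x : EuclideanSpace ℝ (Fin d)) :
    Integrable (fun p => ⟪x, Q.b p.2⟫) Q.μ := hQ.integrable_b.const_inner x

theorem integral_inner_b (hQ : Q.HasFiniteMeans) (x : EuclideanSpace ℝ (Fin d)) :
    ∫ p, ⟪x, Q.b p.2⟫ ∂Q.μ = ⟪x, Q.meanb⟫ := integral_inner hQ.integrable_b x

theorem measurable_loss (hQ : Q.HasFiniteMeans) (x : EuclideanSpace ℝ (Fin d)) :
    Measurable (Q.loss x) := by
  have hquad := measurable_dotProduct_mulVec (measurable_const (a := x.ofLp))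
    (fun i j => (hQ.measurable_A i j).comp (measurable_fst (β := Z')))
    (measurable_const (a := x.ofLp))
  exact (hquad.add (measurable_const.inner (hQ.measurable_b.comp measurable_snd))).add_const _

theorem integrable_loss (hQ : Q.HasFiniteMeans) (x : EuclideanSpace ℝ (Fin d)) :
    Integrable (Q.loss x) Q.μ :=
  have := hQ.isProbability
  ((hQ.integrable_dotProduct _ _).add (hQ.integrable_inner_b x)).add (integrable_const _)

theorem integral_loss (hQ : Q.HasFiniteMeans) (x : EuclideanSpace ℝ (Fin d)) :
    ∫ p, Q.loss x p ∂Q.μ = Q.risk x := by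
  have := hQ.isProbability
  have hquad := hQ.integrable_dotProduct x.ofLp x.ofLp
  have hlin := hQ.integrable_inner_b x
  simp only [loss, risk]
  rw [integral_add (by exact hquad.add hlin) (integrable_const _), integral_add hquad hlin,
    hQ.integral_dotProduct, hQ.integral_inner_b, integral_const, probReal_univ, one_smul]

theorem optRisk_nonneg (hQ : Q.HasFiniteMeans) (hpos : ∀ᵐ p ∂Q.μ, ∀ x ∈ Q.W, 0 ≤ Q.loss x p) :
    0 ≤ Q.optRisk := by
  refine Real.sInf_nonneg ?_
  rintro _ ⟨x, hx, rfl⟩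
  rw [← hQ.integral_loss x]
  exact integral_nonneg_of_ae (hpos.mono fun p hp => hp x hx)

end HasFiniteMeans

end QuadProblem

section Concentration

variable {Ω : Type w} {X : Type*} [MeasurableSpace Ω] [MeasurableSpace X] {Pr : Measure Ω}
  {μ : Measure X} {ξ : ℕ → Ω → X}

theorem WithHighProb.mono {δ : ℝ} {p q : Ω → Prop} (h : WithHighProb Pr δ p)
    (hpq : ∀ ω, p ω → q ω) : WithHighProb Pr δ q :=
  (measure_mono fun ω => mt (hpq ω)).trans h

theorem WithHighProb.of_forall {δ : ℝ} {p : Ω → Prop} (h : ∀ ω, p ω) : WithHighProb Pr δ p := by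
  simp [WithHighProb, h]

theorem WithHighProb.of_forall_mem {ι : Type*} {V : Finset ι} {δ η : ℝ} {p : Ω → Prop}
    {q : ι → Ω → Prop} (hq : ∀ v ∈ V, WithHighProb Pr η (q v)) (hcard : V.card * η ≤ δ)
    (hp : ∀ᵐ ω ∂Pr, (∀ v ∈ V, q v ω) → p ω) : WithHighProb Pr δ p := by
  have hbad : {ω | ¬ p ω} ≤ᵐ[Pr] ⋃ v ∈ V, {ω | ¬ q v ω} := by
    filter_upwards [hp] with ω hω hpω
    obtain ⟨v, hv, hqv⟩ : ∃ v ∈ V, ¬ q v ω := by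
      by_contra! hall
      exact hpω (hω hall)
    exact Set.mem_biUnion hv hqv
  calc Pr {ω | ¬ p ω} ≤ ∑ v ∈ V, Pr {ω | ¬ q v ω} :=
        (measure_mono_ae hbad).trans (measure_biUnion_finset_le _ _)
    _ ≤ ∑ _v ∈ V, ENNReal.ofReal η := Finset.sum_le_sum hq
    _ = ENNReal.ofReal (V.card * η) := by
        rw [Finset.sum_const, nsmul_eq_mul, ENNReal.ofReal_mul (Nat.cast_nonneg _),
          ENNReal.ofReal_natCast]
    _ ≤ ENNReal.ofReal δ := ENNReal.ofReal_le_ofReal hcard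

theorem IsIIDSample.isProbabilityMeasure (h : IsIIDSample Pr μ ξ) : IsProbabilityMeasure μ := by
  have := h.indep.isProbabilityMeasure
  rw [← h.law 0]
  exact Measure.isProbabilityMeasure_map (h.measurable 0).aemeasurable

theorem IsIIDSample.ae_forall (h : IsIIDSample Pr μ ξ) {p : X → Prop} (hp : ∀ᵐ x ∂μ, p x) :
    ∀ᵐ ω ∂Pr, ∀ i, p (ξ i ω) := by
  refine ae_all_iff.2 fun i => ?_
  rw [← h.law i] at hp
  exact ae_of_ae_map (h.measurable i).aemeasurable hp

theorem mgf_neg_le_exp_of_bounded [IsProbabilityMeasure μ] {g : X → ℝ} (hg : Measurable g)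
    {B l : ℝ} (hB : ∀ᵐ x ∂μ, |g x| ≤ B) (hl : 0 ≤ l) (hlB : l * B ≤ 1) :
    mgf g μ (-l) ≤ Real.exp (l ^ 2 * ∫ x, g x ^ 2 ∂μ - l * ∫ x, g x ∂μ) := by
  have hint : Integrable g μ := .of_bound hg.aestronglyMeasurable B hB
  have hint_sq : Integrable (fun x => g x ^ 2) μ := by
    refine .of_bound (hg.pow_const 2).aestronglyMeasurable (B ^ 2) (hB.mono fun x hx => ?_)
    rw [norm_pow]
    exact pow_le_pow_left₀ (norm_nonneg _) hx 2
  have hpoint : ∀ᵐ x ∂μ, Real.exp (-l * g x) ≤ 1 + -l * g x + l ^ 2 * g x ^ 2 := by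
    filter_upwards [hB] with x hx
    have hsmall : |-l * g x| ≤ 1 := by
      rw [abs_mul, abs_neg, abs_of_nonneg hl]
      exact (mul_le_mul_of_nonneg_left hx hl).trans hlB
    have := (abs_le.1 (Real.abs_exp_sub_one_sub_id_le hsmall)).2
    rw [mul_pow, neg_sq] at this
    linarith
  have hlin : Integrable (fun x => 1 + -l * g x) μ := (integrable_const _).add (hint.const_mul _)
  calc mgf g μ (-l) ≤ ∫ x, (1 + -l * g x + l ^ 2 * g x ^ 2) ∂μ :=
        integral_mono_of_nonneg (.of_forall fun x => (Real.exp_pos _).le)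
          (hlin.add (hint_sq.const_mul _)) hpoint
    _ = (l ^ 2 * ∫ x, g x ^ 2 ∂μ - l * ∫ x, g x ∂μ) + 1 := by
        rw [integral_add hlin (hint_sq.const_mul _), integral_add (integrable_const _)
          (hint.const_mul _), integral_const_mul, integral_const_mul, integral_const,
          probReal_univ, one_smul]
        ring
    _ ≤ _ := Real.add_one_le_exp _

theorem IsIIDSample.measure_sum_le_le_exp_mul_mgf (h : IsIIDSample Pr μ ξ) {g : X → ℝ}
    (hg : Measurable g) {l : ℝ} (hl : 0 ≤ l) (hint : Integrable (fun x => Real.exp (-l * g x)) μ)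
    (n : ℕ) (a : ℝ) :
    Pr.real {ω | ∑ i ∈ Finset.range n, g (ξ i ω) ≤ a} ≤ Real.exp (l * a) * mgf g μ (-l) ^ n := by
  have := h.indep.isProbabilityMeasure
  have hindep : iIndepFun (fun i => g ∘ ξ i) Pr := h.indep.comp _ fun _ => hg
  have hmeas i : Measurable (g ∘ ξ i) := hg.comp (h.measurable i)
  have hmgf i : mgf (g ∘ ξ i) Pr (-l) = mgf g μ (-l) := by
    rw [← h.law i, mgf_map (h.measurable i).aemeasurable]
    exact (hg.const_mul _).exp.aestronglyMeasurable
  have hint_comp i : Integrable (fun ω => Real.exp (-l * (g ∘ ξ i) ω)) Pr := by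
    rw [← h.law i] at hint
    exact hint.comp_measurable (h.measurable i)
  have := measure_le_le_exp_mul_mgf (μ := Pr) (X := ∑ i ∈ Finset.range n, g ∘ ξ i) a
    (neg_nonpos.2 hl) (hindep.integrable_exp_mul_sum hmeas fun i _ => hint_comp i)
  simpa only [hindep.mgf_sum hmeas, hmgf, Finset.prod_const, Finset.card_range, neg_neg,
    Finset.sum_apply, Function.comp_apply] using this

/-- A one-sided Bernstein inequality, by Chernoff's bound at `4 T / E[g]`. -/
theorem IsIIDSample.measure_sum_le_half (h : IsIIDSample Pr μ ξ) {g : X → ℝ} (hg : Measurable g)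
    {B T Δ : ℝ} (hB : ∀ᵐ x ∂μ, |g x| ≤ B) (hmean : ∫ x, g x ∂μ = Δ) (hΔ : 0 < Δ) (hT : 0 ≤ T)
    (hTB : 4 * T * B ≤ Δ) (hvar : 16 * T * ∫ x, g x ^ 2 ∂μ ≤ Δ ^ 2) (n : ℕ) :
    Pr {ω | ∑ i ∈ Finset.range n, g (ξ i ω) ≤ n * Δ / 2}
      ≤ ENNReal.ofReal (Real.exp (-(n * T))) := by
  have := h.isProbabilityMeasure
  have := h.indep.isProbabilityMeasure
  set v := ∫ x, g x ^ 2 ∂μ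
  set l := 4 * T / Δ with hl
  have hl0 : 0 ≤ l := by positivity
  have hlΔ : l * Δ = 4 * T := div_mul_cancel₀ _ hΔ.ne'
  have hlB : l * B ≤ 1 := by rwa [hl, div_mul_eq_mul_div, div_le_one hΔ]
  have hlv : l ^ 2 * v ≤ T := by
    rw [hl, div_pow, div_mul_eq_mul_div, div_le_iff₀ (by positivity)]
    nlinarith
  have hint : Integrable (fun x => Real.exp (-l * g x)) μ := by
    refine .of_bound (hg.const_mul _).exp.aestronglyMeasurable (Real.exp (l * B))
      (hB.mono fun x hx => ?_)
    rw [Real.norm_eq_abs, Real.abs_exp, neg_mul, ← mul_neg]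
    exact Real.exp_le_exp.2 (mul_le_mul_of_nonneg_left (neg_le.1 (abs_le.1 hx).1) hl0)
  rw [← ofReal_measureReal]
  refine ENNReal.ofReal_le_ofReal ?_
  calc _ ≤ Real.exp (l * (n * Δ / 2)) * mgf g μ (-l) ^ n :=
        h.measure_sum_le_le_exp_mul_mgf hg hl0 hint n _
    _ ≤ Real.exp (l * (n * Δ / 2)) * Real.exp (l ^ 2 * v - l * Δ) ^ n := by
        gcongr
        · exact mgf_nonneg
        · rw [← hmean]
          exact mgf_neg_le_exp_of_bounded hg hB hl0 hlB
    _ = Real.exp (n * (l ^ 2 * v - l * Δ / 2)) := by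
        rw [← Real.exp_nat_mul, ← Real.exp_add]
        ring_nf
    _ ≤ Real.exp (-(n * T)) := by
        rw [Real.exp_le_exp, ← mul_neg]
        gcongr
        linarith

end Concentration

/-- The deviation `(d log n + log (1/δ)) / n` in terms of which the rates of empirical risk
minimization are expressed. -/
noncomputable def deviation (d n : ℕ) (δ : ℝ) : ℝ := (d * Real.log n + Real.log (1 / δ)) / n

/-- The factor by which the logarithmic size of a sufficiently fine net of the ball of radius `R`
exceeds `d log n`. -/
noncomputable def netFactor (R : ℝ) : ℝ := Real.log (3 * (⌈R⌉₊ + 1)) / Real.log 2 + 3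

section Net

variable {d n : ℕ} {R δ : ℝ} {W : Set (EuclideanSpace ℝ (Fin d))}

theorem mul_deviation (d : ℕ) (hn : 0 < n) (δ : ℝ) :
    n * deviation d n δ = d * Real.log n + Real.log (1 / δ) := by
  rw [deviation]
  field_simp

theorem log_one_div_nonneg (hδ : 0 < δ) (hδ1 : δ < 1) : 0 ≤ Real.log (1 / δ) :=
  Real.log_nonneg ((one_le_div hδ).2 hδ1.le)

theorem deviation_nonneg (d n : ℕ) (hδ : 0 < δ) (hδ1 : δ < 1) : 0 ≤ deviation d n δ := by
  have := log_one_div_nonneg hδ hδ1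
  have := Real.log_natCast_nonneg n
  rw [deviation]
  positivity

theorem half_natCast_le_mul_deviation (d : ℕ) (hn : 2 ≤ n) (hδ : 0 < δ) (hδ1 : δ < 1) :
    (d : ℝ) / 2 ≤ n * deviation d n δ := by
  have hlog : 1 / 2 ≤ Real.log n := by
    have := Real.log_two_gt_d9
    have := Real.log_le_log two_pos (by exact_mod_cast hn : (2 : ℝ) ≤ n)
    linarith
  have hd := mul_le_mul_of_nonneg_left hlog (Nat.cast_nonneg (α := ℝ) d)
  rw [mul_deviation d (by omega)]
  linarith [log_one_div_nonneg hδ hδ1]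

theorem one_le_netFactor (R : ℝ) : 1 ≤ netFactor R := by
  have hlog : 0 ≤ Real.log (3 * (⌈R⌉₊ + 1)) := Real.log_nonneg (by norm_cast; omega)
  have : 0 ≤ Real.log (3 * (⌈R⌉₊ + 1)) / Real.log 2 :=
    div_nonneg hlog (Real.log_nonneg one_le_two)
  rw [netFactor]
  linarith

theorem norm_sub_le_of_floor_mul_eq {k : ℕ} (hk : 0 < k) {x y : EuclideanSpace ℝ (Fin d)}
    (h : ∀ i, ⌊x i * k⌋ = ⌊y i * k⌋) : ‖x - y‖ ≤ (d : ℝ) / k := by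
  have hk0 : (0 : ℝ) < k := by exact_mod_cast hk
  have hcoord i : ‖(x - y) i‖ ≤ 1 / k := by
    have := Int.abs_sub_lt_one_of_floor_eq_floor (h i)
    rw [← sub_mul, abs_mul, abs_of_pos hk0] at this
    exact (le_div_iff₀ hk0).2 this.le
  rw [EuclideanSpace.norm_eq]
  refine Real.sqrt_le_iff.2 ⟨by positivity, ?_⟩
  calc ∑ i, ‖(x - y) i‖ ^ 2 ≤ ∑ _i : Fin d, (1 / (k : ℝ)) ^ 2 := by
        gcongr with i
        exact hcoord i
    _ = d * (1 / (k : ℝ)) ^ 2 := by simp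
    _ ≤ (d : ℝ) ^ 2 * (1 / (k : ℝ)) ^ 2 := by
        gcongr
        exact_mod_cast Nat.le_self_pow two_ne_zero d
    _ = (d / k) ^ 2 := by ring

/-- One representative of `W` is chosen in each cell of a grid of width `1 / k`. -/
theorem exists_finset_net {N k : ℕ} (hk : 0 < k) (hW : ∀ x ∈ W, ‖x‖ ≤ N) :
    ∃ V : Finset (EuclideanSpace ℝ (Fin d)), ↑V ⊆ W ∧ V.card ≤ (2 * (N * k) + 1) ^ d ∧
      ∀ x ∈ W, ∃ v ∈ V, ‖x - v‖ ≤ (d : ℝ) / k := by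
  set cell : EuclideanSpace ℝ (Fin d) → Fin d → ℤ := fun x i => ⌊x i * k⌋
  set cells : Finset (Fin d → ℤ) :=
    Fintype.piFinset fun _ => Finset.Icc (-((N * k : ℕ) : ℤ)) ((N * k : ℕ) : ℤ) with hcells
  have hmem : Set.MapsTo cell W cells := fun x hx => Fintype.mem_piFinset.2 fun i => by
    have hxi := abs_le.1 ((PiLp.norm_apply_le x i).trans (hW x hx))
    have : (0 : ℝ) ≤ k := k.cast_nonneg
    refine Finset.mem_Icc.2 ⟨Int.le_floor.2 ?_, Int.cast_le.1 ((Int.floor_le (x i * k)).trans ?_)⟩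
      <;> push_cast <;> nlinarith
  obtain ⟨V, hVW, hV⟩ := Set.exists_subset_bijOn W cell
  have himage : (cell '' V).Finite :=
    cells.finite_toSet.subset (hV.image_eq ▸ hmem.image_subset)
  have hfin : V.Finite := himage.of_finite_image hV.injOn
  refine ⟨hfin.toFinset, by simpa using hVW, ?_, fun x hx => ?_⟩
  · have hcard : hfin.toFinset.card ≤ cells.card :=
      Finset.card_le_card_of_injOn cell (fun v hv => hmem (hVW (by simpa using hv)))
        (by simpa using hV.injOn)
    refine hcard.trans_eq ?_
    rw [hcells, Fintype.card_piFinset_const, Int.card_Icc]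
    congr 1
    omega
  · obtain ⟨v, hv, hvx⟩ := hV.surjOn ⟨x, hx, rfl⟩
    exact ⟨v, by simpa using hv, norm_sub_le_of_floor_mul_eq hk fun i => (congrFun hvx i).symm⟩

theorem log_three_mul_pow_le_netFactor_mul_log (R : ℝ) (hn : 2 ≤ n) :
    Real.log (3 * (⌈R⌉₊ + 1) * n ^ 3) ≤ netFactor R * Real.log n := by
  have hlog2 : 0 < Real.log 2 := Real.log_pos one_lt_two
  have hlogn : Real.log 2 ≤ Real.log n := Real.log_le_log two_pos (by exact_mod_cast hn)
  have hlogr : 0 ≤ Real.log (3 * (⌈R⌉₊ + 1)) := Real.log_nonneg (by norm_cast; omega)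
  have hratio : Real.log (3 * (⌈R⌉₊ + 1))
      ≤ Real.log (3 * (⌈R⌉₊ + 1)) / Real.log 2 * Real.log n := by
    rw [div_mul_eq_mul_div, le_div_iff₀ hlog2]
    gcongr
  rw [Real.log_mul (by positivity) (by positivity), Real.log_pow, netFactor, add_mul]
  push_cast
  linarith

theorem pow_mul_exp_neg_netFactor_le (R : ℝ) (d : ℕ) (hn : 2 ≤ n) (hδ : 0 < δ) (hδ1 : δ < 1) :
    (3 * (⌈R⌉₊ + 1) * (n : ℝ) ^ 3) ^ d * Real.exp (-(n * (netFactor R * deviation d n δ))) ≤ δ := by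
  have hlog := mul_le_mul_of_nonneg_left (log_three_mul_pow_le_netFactor_mul_log R hn)
    (Nat.cast_nonneg (α := ℝ) d)
  have hδlog := mul_le_mul_of_nonneg_right (one_le_netFactor R) (log_one_div_nonneg hδ hδ1)
  have hinv : Real.log (1 / δ) = -Real.log δ := by rw [one_div, Real.log_inv]
  have hpos : (0 : ℝ) < 3 * (⌈R⌉₊ + 1) * (n : ℝ) ^ 3 := by positivity
  rw [mul_left_comm, mul_deviation d (by omega)]
  calc _ = Real.exp (d * Real.log (3 * (⌈R⌉₊ + 1) * n ^ 3)
          - netFactor R * (d * Real.log n + Real.log (1 / δ))) := by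
        rw [sub_eq_add_neg, Real.exp_add, Real.exp_nat_mul, Real.exp_log hpos]
    _ ≤ Real.exp (Real.log δ) := by
        rw [Real.exp_le_exp]
        linarith
    _ = δ := Real.exp_log hδ

theorem exists_finset_net_card_mul_exp_le (hW : ∀ x ∈ W, ‖x‖ ≤ R) (hn : 2 ≤ n) (hδ : 0 < δ)
    (hδ1 : δ < 1) (hη : deviation d n δ ≤ 1 / 2) :
    ∃ V : Finset (EuclideanSpace ℝ (Fin d)), ↑V ⊆ W ∧
      V.card * Real.exp (-(n * (netFactor R * deviation d n δ))) ≤ δ ∧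
      ∀ x ∈ W, ∃ v ∈ V, ‖x - v‖ ≤ 4 * deviation d n δ ^ 2 := by
  have : (2 : ℝ) ≤ n := by exact_mod_cast hn
  have hdη := half_natCast_le_mul_deviation d hn hδ hδ1
  have hd : d ≤ n := by
    have : (d : ℝ) ≤ n := by nlinarith
    exact_mod_cast this
  have hW' : ∀ x ∈ W, ‖x‖ ≤ ((⌈R⌉₊ + 1 : ℕ) : ℝ) := fun x hx => by
    push_cast
    linarith [hW x hx, Nat.le_ceil R]
  obtain ⟨V, hVW, hcard, hnet⟩ :=
    exists_finset_net (k := n ^ 2 * max d 1) (by positivity) hW'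
  refine ⟨V, hVW, le_trans ?_ (pow_mul_exp_neg_netFactor_le R d hn hδ hδ1), fun x hx => ?_⟩
  · have hbase : 2 * ((⌈R⌉₊ + 1) * (n ^ 2 * max d 1)) + 1 ≤ 3 * (⌈R⌉₊ + 1) * n ^ 3 := by
      have hmax : n ^ 2 * max d 1 ≤ n ^ 2 * n := Nat.mul_le_mul_left _ (by omega)
      have hpos : 0 < n ^ 3 := by positivity
      nlinarith
    gcongr
    exact_mod_cast hcard.trans (Nat.pow_le_pow_left hbase d)
  · obtain ⟨v, hv, hxv⟩ := hnet x hx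
    refine ⟨v, hv, hxv.trans ?_⟩
    rcases Nat.eq_zero_or_pos d with rfl | hd0
    · rw [Nat.cast_zero, zero_div]
      positivity
    have hd1 : (1 : ℝ) ≤ d := by exact_mod_cast hd0
    have hsq : (1 / 2 : ℝ) ^ 2 ≤ (n * deviation d n δ) ^ 2 := by gcongr; linarith
    rw [max_eq_left hd0, div_le_iff₀ (by positivity)]
    push_cast
    nlinarith

end Net

/-- A random loss `ℓ` on `W` with mean `F`, almost surely `G`-Lipschitz: the general setting for the
analysis of empirical risk minimization. -/
structure IsLipschitzLoss {E X : Type*} [NormedAddCommGroup E] [MeasurableSpace X] (μ : Measure X)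
    (ℓ : E → X → ℝ) (F : E → ℝ) (W : Set E) (G : ℝ) : Prop where
  measurable : ∀ x ∈ W, Measurable (ℓ x)
  integrable : ∀ x ∈ W, Integrable (ℓ x) μ
  integral_eq : ∀ x ∈ W, ∫ p, ℓ x p ∂μ = F x
  lipschitz : ∀ᵐ p ∂μ, ∀ x ∈ W, ∀ y ∈ W, |ℓ x p - ℓ y p| ≤ G * ‖x - y‖
  nonneg : 0 ≤ G

namespace IsLipschitzLoss

variable {E X : Type*} [NormedAddCommGroup E] [MeasurableSpace X] {μ : Measure X}
  {ℓ : E → X → ℝ} {F : E → ℝ} {W : Set E} {G : ℝ} {x y : E}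

theorem integral_sub (hℓ : IsLipschitzLoss μ ℓ F W G) (hx : x ∈ W) (hy : y ∈ W) :
    ∫ p, (ℓ x p - ℓ y p) ∂μ = F x - F y := by
  rw [MeasureTheory.integral_sub (hℓ.integrable x hx) (hℓ.integrable y hy), hℓ.integral_eq x hx,
    hℓ.integral_eq y hy]

theorem ae_abs_sub_le (hℓ : IsLipschitzLoss μ ℓ F W G) (hx : x ∈ W) (hy : y ∈ W) :
    ∀ᵐ p ∂μ, |ℓ x p - ℓ y p| ≤ G * ‖x - y‖ :=
  hℓ.lipschitz.mono fun _ hp => hp x hx y hy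

theorem abs_sub_le [IsProbabilityMeasure μ] (hℓ : IsLipschitzLoss μ ℓ F W G) (hx : x ∈ W)
    (hy : y ∈ W) : |F x - F y| ≤ G * ‖x - y‖ := by
  have := norm_integral_le_of_norm_le_const (f := fun p => ℓ x p - ℓ y p)
    (hℓ.ae_abs_sub_le hx hy)
  rwa [hℓ.integral_sub hx hy, probReal_univ, mul_one] at this

theorem integral_sq_le [IsProbabilityMeasure μ] (hℓ : IsLipschitzLoss μ ℓ F W G) (hx : x ∈ W)
    (hy : y ∈ W) : ∫ p, (ℓ x p - ℓ y p) ^ 2 ∂μ ≤ G ^ 2 * ‖x - y‖ ^ 2 := by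
  have hbound : ∀ᵐ p ∂μ, ‖(ℓ x p - ℓ y p) ^ 2‖ ≤ G ^ 2 * ‖x - y‖ ^ 2 :=
    (hℓ.ae_abs_sub_le hx hy).mono fun p hp => by
      rw [norm_pow, ← mul_pow]
      exact pow_le_pow_left₀ (norm_nonneg _) hp 2
  have := norm_integral_le_of_norm_le_const hbound
  rw [probReal_univ, mul_one] at this
  exact (le_abs_self _).trans this

theorem withHighProb_half_lt_sum {Ω : Type*} [MeasurableSpace Ω] {Pr : Measure Ω}
    {ξ : ℕ → Ω → X} (hℓ : IsLipschitzLoss μ ℓ F W G) (hξ : IsIIDSample Pr μ ξ) {T : ℝ}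
    (hT : 0 ≤ T) (hx : x ∈ W) (hy : y ∈ W) (hxy : F y < F x)
    (hdist : 4 * T * (G * ‖x - y‖) ≤ F x - F y)
    (hvar : 16 * T * ∫ p, (ℓ x p - ℓ y p) ^ 2 ∂μ ≤ (F x - F y) ^ 2) (n : ℕ) :
    WithHighProb Pr (Real.exp (-(n * T))) fun ω =>
      n * (F x - F y) / 2 < ∑ i ∈ Finset.range n, (ℓ x (ξ i ω) - ℓ y (ξ i ω)) := by
  simp only [WithHighProb, not_lt]
  exact hξ.measure_sum_le_half ((hℓ.measurable x hx).sub (hℓ.measurable y hy))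
    (hℓ.ae_abs_sub_le hx hy) (hℓ.integral_sub hx hy) (sub_pos.2 hxy) hT hdist hvar n

end IsLipschitzLoss

theorem sub_le_two_mul_of_mem_argminOn_sum {E : Type*} [NormedAddCommGroup E] {n : ℕ}
    (hn : 0 < n) {f : ℕ → E → ℝ} {W : Set E} {G ε D : ℝ}
    (hf : ∀ i, ∀ x ∈ W, ∀ y ∈ W, |f i x - f i y| ≤ G * ‖x - y‖) (hG : 0 ≤ G) {x v y : E}
    (hx : x ∈ argminOn (fun x => 1 / (n : ℝ) * ∑ i ∈ Finset.range n, f i x) W) (hv : v ∈ W)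
    (hy : y ∈ W) (hxv : ‖x - v‖ ≤ ε)
    (hD : n * D / 2 < ∑ i ∈ Finset.range n, (f i v - f i y)) : D ≤ 2 * (G * ε) := by
  have hn0 : (0 : ℝ) < n := by exact_mod_cast hn
  have hmin : ∑ i ∈ Finset.range n, f i x ≤ ∑ i ∈ Finset.range n, f i y :=
    le_of_mul_le_mul_left (hx.2 y hy) (by positivity)
  have hnear : ∑ i ∈ Finset.range n, (f i v - f i x) ≤ n * (G * ε) := by
    refine (Finset.sum_le_card_nsmul _ _ (G * ε) fun i _ => ?_).trans_eq (by simp)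
    rw [norm_sub_rev] at hxv
    exact (le_abs_self _).trans ((hf i v hv x hx.1).trans (mul_le_mul_of_nonneg_left hxv hG))
  rw [Finset.sum_sub_distrib] at hD hnear
  have : n * (D / 2) < n * (G * ε) := by linarith
  linarith [lt_of_mul_lt_mul_left this hn0.le]

/-- The net `V` reduces uniform convergence to a union bound over the points of `V`. -/
theorem IsLipschitzLoss.withHighProb_erm {E X : Type*} [NormedAddCommGroup E] [MeasurableSpace X]
    {μ : Measure X} [IsProbabilityMeasure μ] {ℓ : E → X → ℝ} {F : E → ℝ} {W : Set E} {G : ℝ}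
    (hℓ : IsLipschitzLoss μ ℓ F W G) {V : Finset E} {ε τ T δ m : ℝ} {n : ℕ} (hn : 0 < n)
    (hT : 0 ≤ T) (hτ : 0 ≤ τ) (hVW : ↑V ⊆ W) (hV : ∀ x ∈ W, ∃ v ∈ V, ‖x - v‖ ≤ ε)
    (hcard : V.card * Real.exp (-(n * T)) ≤ δ)
    (hcmp : ∀ v ∈ V, τ < F v - m → ∃ y ∈ W, F y = m ∧ 4 * T * (G * ‖v - y‖) ≤ F v - m ∧
      16 * T * ∫ p, (ℓ v p - ℓ y p) ^ 2 ∂μ ≤ (F v - m) ^ 2)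
    {Ω : Type*} [MeasurableSpace Ω] {Pr : Measure Ω} {ξ : ℕ → Ω → X} (hξ : IsIIDSample Pr μ ξ) :
    WithHighProb Pr δ fun ω =>
      ∀ x ∈ argminOn (fun x => 1 / (n : ℝ) * ∑ i ∈ Finset.range n, ℓ x (ξ i ω)) W,
        F x - m ≤ τ + 3 * (G * ε) := by
  set good : E → Ω → Prop := fun v ω => τ < F v - m → ∃ y ∈ W,
    n * (F v - m) / 2 < ∑ i ∈ Finset.range n, (ℓ v (ξ i ω) - ℓ y (ξ i ω))
  have hgood : ∀ v ∈ V, WithHighProb Pr (Real.exp (-(n * T))) (good v) := fun v hv => by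
    by_cases hτv : τ < F v - m
    · obtain ⟨y, hy, rfl, hdist, hvar⟩ := hcmp v hv hτv
      exact (hℓ.withHighProb_half_lt_sum hξ hT (hVW hv) hy (by linarith) hdist hvar n).mono
        fun ω hω _ => ⟨y, hy, hω⟩
    · exact .of_forall fun ω h => absurd h hτv
  refine .of_forall_mem hgood hcard ?_
  filter_upwards [hξ.ae_forall hℓ.lipschitz] with ω hlip hω x hx
  obtain ⟨v, hv, hxv⟩ := hV x hx.1
  have hGε := mul_le_mul_of_nonneg_left hxv hℓ.nonneg
  have hFxv := (abs_le.1 (hℓ.abs_sub_le hx.1 (hVW hv))).2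
  by_cases hτv : τ < F v - m
  · obtain ⟨y, hy, hD⟩ := hω v hv hτv
    linarith [sub_le_two_mul_of_mem_argminOn_sum hn hlip hℓ.nonneg hx (hVW hv) hy hxv hD]
  · have : 0 ≤ G * ε := (mul_nonneg hℓ.nonneg (norm_nonneg _)).trans hGε
    linarith

theorem four_mul_mul_le_of_sq_le {α G T r Δ : ℝ} (hΔ : 0 ≤ Δ) (hr : r ^ 2 ≤ α * Δ)
    (hT : 16 * T ^ 2 * G ^ 2 * α ≤ Δ) : 4 * T * (G * r) ≤ Δ := by
  refine abs_le_of_sq_le_sq' ?_ hΔ |>.2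
  calc (4 * T * (G * r)) ^ 2 = 16 * T ^ 2 * G ^ 2 * r ^ 2 := by ring
    _ ≤ 16 * T ^ 2 * G ^ 2 * (α * Δ) := by gcongr
    _ = 16 * T ^ 2 * G ^ 2 * α * Δ := by ring
    _ ≤ Δ * Δ := by gcongr
    _ = Δ ^ 2 := by ring

theorem sixteen_mul_mul_le_sq {β γ κ T Δ : ℝ} (hΔ : 0 ≤ Δ) (hβ : 48 * T * β ≤ Δ)
    (hγ : (48 * T * γ) ^ 2 ≤ Δ) (hκ : 48 * T * κ ≤ 1) :
    16 * T * (β * Δ + γ * (Δ * √Δ) + κ * Δ ^ 2) ≤ Δ ^ 2 := by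
  have hsqrt : 48 * T * γ ≤ √Δ := Real.le_sqrt_of_sq_le hγ
  have hβΔ : 48 * T * β * Δ ≤ Δ * Δ := by gcongr
  have hγΔ : 48 * T * γ * (Δ * √Δ) ≤ √Δ * (Δ * √Δ) := by gcongr
  have hκΔ : 48 * T * κ * Δ ^ 2 ≤ 1 * Δ ^ 2 := by gcongr
  have : √Δ * (Δ * √Δ) = Δ ^ 2 := by rw [mul_left_comm, Real.mul_self_sqrt hΔ, sq]
  linarith

/-- The constant in the rate of empirical risk minimization over a set of radius `R` when
`E[(ℓ x - ℓ y)²] ≤ β Δ + γ Δ ^ (3/2) + κ Δ²` for an optimal `y` with `‖x - y‖² ≤ α Δ`, where `Δ` is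
the excess risk of `x`. -/
noncomputable def ermFactor (α G R γ κ : ℝ) : ℝ :=
  48 * netFactor R + (48 * netFactor R * γ) ^ 2 + 16 * netFactor R ^ 2 * G ^ 2 * |α| + 12 * |G|
    + 2 * |G| * |R| * (48 * netFactor R * κ + 2) ^ 2

theorem ermFactor_pos (α G R γ κ : ℝ) : 0 < ermFactor α G R γ κ := by
  have := one_le_netFactor R
  rw [ermFactor]
  positivity

section Rate

variable {d n : ℕ} {X : Type*} [MeasurableSpace X] {μ : Measure X} [IsProbabilityMeasure μ]
  {ℓ : EuclideanSpace ℝ (Fin d) → X → ℝ} {F : EuclideanSpace ℝ (Fin d) → ℝ}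
  {W : Set (EuclideanSpace ℝ (Fin d))} {α β γ κ G R m δ : ℝ} {Ω : Type*} [MeasurableSpace Ω]
  {Pr : Measure Ω} {ξ : ℕ → Ω → X}

theorem IsLipschitzLoss.withHighProb_erm_of_deviation_le (hℓ : IsLipschitzLoss μ ℓ F W G)
    (hW : ∀ x ∈ W, ‖x‖ ≤ R) (hα : 0 ≤ α) (hβ : 0 ≤ β) (hκ : 0 ≤ κ)
    (hcmp : ∀ x ∈ W, ∃ y ∈ W, F y = m ∧ ‖x - y‖ ^ 2 ≤ α * (F x - m) ∧
      ∫ p, (ℓ x p - ℓ y p) ^ 2 ∂μ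
        ≤ β * (F x - m) + γ * ((F x - m) * √(F x - m)) + κ * (F x - m) ^ 2)
    (hξ : IsIIDSample Pr μ ξ) (hn : 2 ≤ n) (hδ : 0 < δ) (hδ1 : δ < 1)
    (hη : deviation d n δ * (48 * netFactor R * κ + 2) ≤ 1) :
    WithHighProb Pr δ fun ω =>
      ∀ x ∈ argminOn (fun x => 1 / (n : ℝ) * ∑ i ∈ Finset.range n, ℓ x (ξ i ω)) W,
        F x - m ≤ ermFactor α G R γ κ * (β * deviation d n δ + deviation d n δ ^ 2) := by
  set η := deviation d n δ
  set K := netFactor R with hK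
  have hη0 : 0 ≤ η := deviation_nonneg d n hδ hδ1
  have hK1 : 1 ≤ K := one_le_netFactor R
  have hκη : 0 ≤ η * (48 * K * κ) := by positivity
  obtain ⟨V, hVW, hcard, hV⟩ := exists_finset_net_card_mul_exp_le hW hn hδ hδ1 (by linarith)
  set τ := 48 * (K * η) * β + (48 * (K * η) * γ) ^ 2 + 16 * (K * η) ^ 2 * G ^ 2 * α
  have hτβ : 0 ≤ 48 * (K * η) * β := by positivity
  have hτγ : 0 ≤ (48 * (K * η) * γ) ^ 2 := by positivity
  have hτα : 0 ≤ 16 * (K * η) ^ 2 * G ^ 2 * α := by positivity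
  have hτ : 0 ≤ τ := by positivity
  refine (hℓ.withHighProb_erm (T := K * η) (by omega) (by positivity) hτ hVW hV hcard (m := m)
    (fun v hv hτv => ?_) hξ).mono fun ω hω x hx => (hω x hx).trans ?_
  · obtain ⟨y, hy, hFy, hdist, hvar⟩ := hcmp v (hVW hv)
    have hΔ : 0 ≤ F v - m := by linarith
    refine ⟨y, hy, hFy, four_mul_mul_le_of_sq_le hΔ hdist (by linarith),
      (mul_le_mul_of_nonneg_left hvar (by positivity)).trans
        (sixteen_mul_mul_le_sq hΔ (by linarith) (by linarith) (by linarith))⟩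
  · have hG := hℓ.nonneg
    have hC : 48 * K ≤ ermFactor α G R γ κ ∧ (48 * K * γ) ^ 2 + 16 * K ^ 2 * G ^ 2 * α + 12 * G
        ≤ ermFactor α G R γ κ := by
      have : 0 ≤ 2 * G * |R| * (48 * K * κ + 2) ^ 2 := by positivity
      have : 0 ≤ 16 * K ^ 2 * G ^ 2 * α := by positivity
      rw [ermFactor, ← hK, abs_of_nonneg hα, abs_of_nonneg hG]
      constructor <;> linarith [sq_nonneg (48 * K * γ)]
    calc τ + 3 * (G * (4 * η ^ 2)) = 48 * K * (β * η)
          + ((48 * K * γ) ^ 2 + 16 * K ^ 2 * G ^ 2 * α + 12 * G) * η ^ 2 := by ring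
      _ ≤ ermFactor α G R γ κ * (β * η) + ermFactor α G R γ κ * η ^ 2 := by
          gcongr
          exacts [hC.1, hC.2]
      _ = _ := by ring

theorem IsLipschitzLoss.sub_le_ermFactor_mul (hℓ : IsLipschitzLoss μ ℓ F W G)
    (hW : ∀ x ∈ W, ‖x‖ ≤ R) {x y : EuclideanSpace ℝ (Fin d)} (hx : x ∈ W) (hy : y ∈ W) {t : ℝ}
    (ht : 1 ≤ t * (48 * netFactor R * κ + 2) ^ 2) : F x - F y ≤ ermFactor α G R γ κ * t := by
  have hR := (norm_nonneg x).trans (hW x hx)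
  have := one_le_netFactor R
  have hG := hℓ.nonneg
  have ht0 : 0 ≤ t := by
    by_contra! hlt
    nlinarith [sq_nonneg (48 * netFactor R * κ + 2)]
  calc F x - F y ≤ G * ‖x - y‖ := (le_abs_self _).trans (hℓ.abs_sub_le hx hy)
    _ ≤ G * (R + R) := by
        gcongr
        exact (norm_sub_le _ _).trans (add_le_add (hW x hx) (hW y hy))
    _ = 2 * G * R * 1 := by ring
    _ ≤ 2 * G * R * (t * (48 * netFactor R * κ + 2) ^ 2) := by gcongr
    _ = 2 * |G| * |R| * (48 * netFactor R * κ + 2) ^ 2 * t := by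
        rw [abs_of_nonneg hG, abs_of_nonneg hR]
        ring
    _ ≤ ermFactor α G R γ κ * t := by
        gcongr
        rw [ermFactor, le_add_iff_nonneg_left]
        positivity

theorem IsLipschitzLoss.withHighProb_erm_le (hℓ : IsLipschitzLoss μ ℓ F W G)
    (hW : ∀ x ∈ W, ‖x‖ ≤ R) (hα : 0 ≤ α) (hβ : 0 ≤ β) (hκ : 0 ≤ κ)
    (hcmp : ∀ x ∈ W, ∃ y ∈ W, F y = m ∧ ‖x - y‖ ^ 2 ≤ α * (F x - m) ∧
      ∫ p, (ℓ x p - ℓ y p) ^ 2 ∂μ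
        ≤ β * (F x - m) + γ * ((F x - m) * √(F x - m)) + κ * (F x - m) ^ 2)
    (hξ : IsIIDSample Pr μ ξ) (hn : 2 ≤ n) (hδ : 0 < δ) (hδ1 : δ < 1) :
    WithHighProb Pr δ fun ω =>
      ∀ x ∈ argminOn (fun x => 1 / (n : ℝ) * ∑ i ∈ Finset.range n, ℓ x (ξ i ω)) W,
        F x - m ≤ ermFactor α G R γ κ * (β * deviation d n δ + min (deviation d n δ ^ 2) 1) := by
  have hη0 := deviation_nonneg d n hδ hδ1
  have hq : 2 ≤ 48 * netFactor R * κ + 2 := by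
    have := one_le_netFactor R
    have : 0 ≤ 48 * netFactor R * κ := by positivity
    linarith
  rcases le_or_gt (deviation d n δ * (48 * netFactor R * κ + 2)) 1 with hη | hη
  · have hη1 : deviation d n δ ≤ 1 := by nlinarith
    rw [min_eq_left (pow_le_one₀ hη0 hη1)]
    exact hℓ.withHighProb_erm_of_deviation_le hW hα hβ hκ hcmp hξ hn hδ hδ1 hη
  · refine .of_forall fun ω x hx => ?_
    obtain ⟨y, hy, rfl, -⟩ := hcmp x hx.1
    refine (hℓ.sub_le_ermFactor_mul (α := α) (γ := γ) (κ := κ) hW hx.1 hy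
      (t := min (deviation d n δ ^ 2) 1) ?_).trans ?_
    · rw [min_mul_of_nonneg _ _ (sq_nonneg _), ← mul_pow, one_mul]
      exact le_min (one_le_pow₀ hη.le) (one_le_pow₀ (by linarith))
    · exact mul_le_mul_of_nonneg_left (le_add_of_nonneg_left (by positivity))
        (ermFactor_pos _ _ _ _ _).le

end Rate

section NonnegQuad

variable {d : ℕ} {A : Matrix (Fin d) (Fin d) ℝ} {b : EuclideanSpace ℝ (Fin d)} {c : ℝ}

/-- The discriminant of `t ↦ quad A b c (y + t • h) ≥ 0` is nonpositive. -/
theorem sq_inner_quadGrad_le (hf : ∀ x, 0 ≤ quad A b c x) (y h : EuclideanSpace ℝ (Fin d)) :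
    ⟪quadGrad A b y, h⟫ ^ 2 ≤ 4 * quad A b c y * (‖A‖ * ‖h‖ ^ 2) := by
  have hline : ∀ t : ℝ, 0 ≤ (h.ofLp ⬝ᵥ (A *ᵥ h.ofLp)) * (t * t) + ⟪quadGrad A b y, h⟫ * t
      + quad A b c y := fun t => by
    have := hf (y + t • h)
    rw [quad_add, inner_smul_right, WithLp.ofLp_smul, Matrix.mulVec_smul, dotProduct_smul,
      smul_dotProduct, smul_eq_mul, smul_eq_mul] at this
    linarith
  have hdiscrim := discrim_le_zero hline
  rw [discrim] at hdiscrim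
  have hnorm := mul_le_mul_of_nonneg_left (abs_le.1 (abs_dotProduct_mulVec_le A h h)).2 (hf y)
  linarith

theorem sq_quad_sub_le_of_nonneg (hf : ∀ x, 0 ≤ quad A b c x) {σ : ℝ} (hA : ‖A‖ ≤ σ)
    (x y : EuclideanSpace ℝ (Fin d)) :
    (quad A b c x - quad A b c y) ^ 2
      ≤ 8 * σ * ‖x - y‖ ^ 2 * quad A b c y + 2 * σ ^ 2 * (‖x - y‖ ^ 2) ^ 2 := by
  have hσ : ‖A‖ * ‖x - y‖ ^ 2 ≤ σ * ‖x - y‖ ^ 2 := by gcongr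
  have hlin : ⟪quadGrad A b y, x - y⟫ ^ 2 ≤ 4 * quad A b c y * (σ * ‖x - y‖ ^ 2) :=
    (sq_inner_quadGrad_le hf y (x - y)).trans
      (mul_le_mul_of_nonneg_left hσ (mul_nonneg four_pos.le (hf y)))
  have hquad : ((x - y).ofLp ⬝ᵥ (A *ᵥ (x - y).ofLp)) ^ 2 ≤ (σ * ‖x - y‖ ^ 2) ^ 2 := by
    rw [← sq_abs]
    refine pow_le_pow_left₀ (abs_nonneg _) ((abs_dotProduct_mulVec_le A _ _).trans ?_) 2
    rwa [mul_assoc, ← sq]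
  rw [quad_sub]
  exact (add_sq_le).trans (by linarith)

end NonnegQuad

namespace QuadProblem

variable {d : ℕ} {Z : Type u} {Z' : Type v} [MeasurableSpace Z] [MeasurableSpace Z']
  {Q : QuadProblem d Z Z'} {α G R σ : ℝ}

theorem ERMRate.mono {adm adm' : ℕ → Prop} {rate rate' : ℕ → ℝ → ℝ}
    (h : QuadProblem.ERMRate.{u, v, w} Q adm rate) (hadm : ∀ n, adm' n → adm n)
    (hrate : ∀ n δ, 0 < δ → δ < 1 → rate n δ ≤ rate' n δ) :
    QuadProblem.ERMRate.{u, v, w} Q adm' rate' :=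
  fun Ω _ Pr _ ξ hξ n hn δ hδ hδ1 => (h Ω Pr ξ hξ n (hadm n hn) δ hδ hδ1).mono
    fun _ hω x hx => (hω x hx).trans (hrate n δ hδ hδ1)

theorem BoundedBy.nonneg [IsProbabilityMeasure Q.μ] (h : Q.BoundedBy σ) : 0 ≤ σ :=
  let ⟨_, hp⟩ := Filter.Eventually.exists h
  (norm_nonneg _).trans ((le_max_left _ _).trans hp)

namespace HasFiniteMeans

theorem isLipschitzLoss (hQ : Q.HasFiniteMeans) (hG : Q.LossLipschitz G) :
    IsLipschitzLoss Q.μ Q.loss Q.risk Q.W |G| where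
  measurable x _ := hQ.measurable_loss x
  integrable x _ := hQ.integrable_loss x
  integral_eq x _ := hQ.integral_loss x
  lipschitz := hG.mono fun _ hp x hx y hy =>
    (hp x hx y hy).trans (mul_le_mul_of_nonneg_right (le_abs_self G) (norm_nonneg _))
  nonneg := abs_nonneg G

theorem integral_sq_le_of_nonneg (hQ : Q.HasFiniteMeans) (hσ : Q.BoundedBy σ)
    (hpos : ∀ᵐ p ∂Q.μ, ∀ x, 0 ≤ Q.loss x p) (x y : EuclideanSpace ℝ (Fin d)) :
    ∫ p, (Q.loss x p - Q.loss y p) ^ 2 ∂Q.μ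
      ≤ 8 * σ * ‖x - y‖ ^ 2 * Q.risk y + 2 * σ ^ 2 * (‖x - y‖ ^ 2) ^ 2 := by
  have := hQ.isProbability
  have hint := (hQ.integrable_loss y).const_mul (8 * σ * ‖x - y‖ ^ 2)
  calc _ ≤ ∫ p, (8 * σ * ‖x - y‖ ^ 2 * Q.loss y p + 2 * σ ^ 2 * (‖x - y‖ ^ 2) ^ 2) ∂Q.μ := by
        refine integral_mono_of_nonneg (.of_forall fun p => sq_nonneg _)
          (hint.add (integrable_const _)) ?_
        filter_upwards [hσ, hpos] with p hp hp0
        exact sq_quad_sub_le_of_nonneg hp0 ((le_max_left _ _).trans hp) x y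
    _ = _ := by
        rw [integral_add hint (integrable_const _), integral_const_mul, hQ.integral_loss,
          integral_const, probReal_univ, one_smul]

theorem integral_sq_le_of_risk_eq_zero (hQ : Q.HasFiniteMeans) (hG : Q.LossLipschitz G)
    (hpos : ∀ᵐ p ∂Q.μ, ∀ x ∈ Q.W, 0 ≤ Q.loss x p) {x y : EuclideanSpace ℝ (Fin d)} (hx : x ∈ Q.W)
    (hy : y ∈ Q.W) (hy0 : Q.risk y = 0) :
    ∫ p, (Q.loss x p - Q.loss y p) ^ 2 ∂Q.μ ≤ |G| * ‖x - y‖ * Q.risk x := by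
  have hzero : ∀ᵐ p ∂Q.μ, Q.loss y p = 0 := by
    rwa [← hQ.integral_loss, integral_eq_zero_iff_of_nonneg_ae
      (hpos.mono fun p hp => hp y hy) (hQ.integrable_loss y)] at hy0
  rw [← hQ.integral_loss x, ← integral_const_mul]
  refine integral_mono_of_nonneg (.of_forall fun p => sq_nonneg _)
    ((hQ.integrable_loss x).const_mul _) ?_
  filter_upwards [hpos, hzero, (hQ.isLipschitzLoss hG).ae_abs_sub_le hx hy] with p hp hp0 hpG
  rw [hp0, sub_zero, abs_of_nonneg (hp x hx)] at hpG
  rw [hp0, sub_zero, sq]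
  exact mul_le_mul_of_nonneg_right hpG (hp x hx)

theorem ermRate_of_integral_sq_le {β γ κ : ℝ} (hQ : Q.HasFiniteMeans) (hG : Q.LossLipschitz G)
    (hR : ∀ x ∈ Q.W, ‖x‖ ≤ R) (hE : EBC Q.W Q.risk 1 α) (hβ : 0 ≤ β) (hκ : 0 ≤ κ)
    (hvar : ∀ x ∈ Q.W, ∀ y ∈ Q.W, Q.risk y = Q.optRisk → 0 ≤ Q.risk x - Q.optRisk →
      ‖x - y‖ ^ 2 ≤ α * (Q.risk x - Q.optRisk) → ∫ p, (Q.loss x p - Q.loss y p) ^ 2 ∂Q.μ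
        ≤ β * (Q.risk x - Q.optRisk) + γ * ((Q.risk x - Q.optRisk) * √(Q.risk x - Q.optRisk))
          + κ * (Q.risk x - Q.optRisk) ^ 2) :
    QuadProblem.ERMRate.{u, v, w} Q (2 ≤ ·) fun n δ =>
      ermFactor α |G| R γ κ * (β * deviation d n δ + min (deviation d n δ ^ 2) 1) := by
  have := hQ.isProbability
  intro Ω _ Pr _ ξ hξ n hn δ hδ hδ1
  refine (hQ.isLipschitzLoss hG).withHighProb_erm_le hR hE.2.2.1.le hβ hκ (fun x hx => ?_) hξ hn
    hδ hδ1
  obtain ⟨y, hy, hrisk, hdist⟩ := exists_minimizer_of_EBC hE hx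
  have hΔ := nonneg_of_mul_nonneg_right ((sq_nonneg _).trans hdist) hE.2.2.1
  exact ⟨y, hy, hrisk, hdist, hvar x hx y hy hrisk hΔ hdist⟩

theorem ermRate_of_lossLipschitz (hQ : Q.HasFiniteMeans) (hG : Q.LossLipschitz G)
    (hR : ∀ x ∈ Q.W, ‖x‖ ≤ R) (hE : EBC Q.W Q.risk 1 α) :
    QuadProblem.ERMRate.{u, v, w} Q (2 ≤ ·) fun n δ =>
      ermFactor α |G| R 0 0 * (G ^ 2 * |α| + 1) * deviation d n δ := by
  have := hQ.isProbability
  refine (hQ.ermRate_of_integral_sq_le (β := G ^ 2 * |α|) (γ := 0) hG hR hE (by positivity) le_rfl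
    fun x hx y hy _ _ hdist => ?_).mono (fun _ => id) fun n δ hδ hδ1 => ?_
  · have := (hQ.isLipschitzLoss hG).integral_sq_le hx hy
    rw [sq_abs] at this
    calc _ ≤ G ^ 2 * (α * (Q.risk x - Q.optRisk)) := this.trans (by gcongr)
      _ = _ := by
        rw [abs_of_pos hE.2.2.1]
        ring
  · have hη := deviation_nonneg d n hδ hδ1
    have hmin : min (deviation d n δ ^ 2) 1 ≤ deviation d n δ := by
      rcases le_total (deviation d n δ) 1 with h | h
      · exact (min_le_left _ _).trans (pow_le_of_le_one hη h two_ne_zero)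
      · exact (min_le_right _ _).trans h
    rw [mul_assoc (ermFactor _ _ _ _ _)]
    refine mul_le_mul_of_nonneg_left ?_ (ermFactor_pos _ _ _ _ _).le
    linarith

theorem ermRate_of_nonneg (hQ : Q.HasFiniteMeans) (hσ : Q.BoundedBy σ)
    (hpos : ∀ᵐ p ∂Q.μ, ∀ x, 0 ≤ Q.loss x p) (hR : ∀ x ∈ Q.W, ‖x‖ ≤ R)
    (hE : EBC Q.W Q.risk 1 α) :
    QuadProblem.ERMRate.{u, v, w} Q (2 ≤ ·) fun n δ =>
      ermFactor α |2 * σ * R + σ| R 0 (2 * σ ^ 2 * α ^ 2) * (8 * |σ| * |α| + 1)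
        * (deviation d n δ ^ 2 + deviation d n δ * Q.optRisk) := by
  have := hQ.isProbability
  have hσ0 := hσ.nonneg
  have hα := hE.2.2.1.le
  have hP := hQ.optRisk_nonneg (hpos.mono fun p hp x _ => hp x)
  refine (hQ.ermRate_of_integral_sq_le (β := 8 * σ * α * Q.optRisk) (γ := 0)
    (κ := 2 * σ ^ 2 * α ^ 2) (hσ.lossLipschitz hR) hR hE (by positivity) (by positivity)
    fun x _ y _ hy hΔ hdist => ?_).mono (fun _ => id)
    fun n δ hδ hδ1 => ?_
  · rw [← hy] at hP
    calc _ ≤ 8 * σ * ‖x - y‖ ^ 2 * Q.risk y + 2 * σ ^ 2 * (‖x - y‖ ^ 2) ^ 2 :=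
          hQ.integral_sq_le_of_nonneg hσ hpos x y
      _ ≤ 8 * σ * (α * (Q.risk x - Q.optRisk)) * Q.risk y
          + 2 * σ ^ 2 * (α * (Q.risk x - Q.optRisk)) ^ 2 := by gcongr
      _ = _ := by
        rw [hy]
        ring
  · have hη := deviation_nonneg d n hδ hδ1
    rw [mul_assoc (ermFactor _ _ _ _ _), abs_of_nonneg hσ0, abs_of_nonneg hα]
    refine mul_le_mul_of_nonneg_left ?_ (ermFactor_pos _ _ _ _ _).le
    have : 0 ≤ 8 * σ * α * deviation d n δ ^ 2 := by positivity
    have : 0 ≤ deviation d n δ * Q.optRisk := by positivity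
    linarith [min_le_left (deviation d n δ ^ 2) 1]

theorem ermRate_of_optRisk_eq_zero (hQ : Q.HasFiniteMeans) (hG : Q.LossLipschitz G)
    (hpos : ∀ᵐ p ∂Q.μ, ∀ x ∈ Q.W, 0 ≤ Q.loss x p) (hR : ∀ x ∈ Q.W, ‖x‖ ≤ R)
    (hE : EBC Q.W Q.risk 1 α) (hP : Q.optRisk = 0) :
    QuadProblem.ERMRate.{u, v, w} Q (2 ≤ ·) fun n δ =>
      ermFactor α |G| R (|G| * √α) 0 * deviation d n δ ^ 2 := by
  refine (hQ.ermRate_of_integral_sq_le (β := 0) (γ := |G| * √α) hG hR hE le_rfl le_rfl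
    fun x hx y hy hy0 hΔ hdist => ?_).mono (fun _ => id) fun n δ _ _ => ?_
  · rw [hP, sub_zero] at hΔ hdist ⊢
    calc _ ≤ |G| * ‖x - y‖ * Q.risk x :=
          hQ.integral_sq_le_of_risk_eq_zero hG hpos hx hy (hy0.trans hP)
      _ ≤ |G| * √(α * Q.risk x) * Q.risk x := by
          gcongr
          exact Real.le_sqrt_of_sq_le hdist
      _ = _ := by
          rw [Real.sqrt_mul hE.2.2.1.le]
          ring
  · rw [zero_mul, zero_add]
    exact mul_le_mul_of_nonneg_left (min_le_left _ _) (ermFactor_pos _ _ _ _ _).le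

/-- For `P > 0` the slow rate `deviation` is itself of the order `P * deviation`, with a constant
that depends on `P`. -/
theorem exists_ermRate_of_nonnegOn (α G R P : ℝ) :
    ∃ C, 0 < C ∧ ∀ {d : ℕ} {Z : Type u} {Z' : Type v} [MeasurableSpace Z] [MeasurableSpace Z']
      {Q : QuadProblem d Z Z'}, Q.HasFiniteMeans → Q.LossLipschitz G →
      (∀ᵐ p ∂Q.μ, ∀ x ∈ Q.W, 0 ≤ Q.loss x p) → (∀ x ∈ Q.W, ‖x‖ ≤ R) → EBC Q.W Q.risk 1 α →
      Q.optRisk = P →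
      QuadProblem.ERMRate.{u, v, w} Q (2 ≤ ·) fun n δ =>
        C * (deviation d n δ ^ 2 + deviation d n δ * Q.optRisk) := by
  rcases eq_or_ne P 0 with rfl | hP
  · refine ⟨_, ermFactor_pos α |G| R (|G| * √α) 0, fun hQ hG hpos hR hE hP => ?_⟩
    simpa only [hP, mul_zero, add_zero] using hQ.ermRate_of_optRisk_eq_zero hG hpos hR hE hP
  · set C := ermFactor α |G| R 0 0 * (G ^ 2 * |α| + 1)
    have hC : 0 < C := mul_pos (ermFactor_pos _ _ _ _ _) (by positivity)
    refine ⟨C / |P|, by positivity, fun {d _ _ _ _ Q} hQ hG hpos hR hE hQP => ?_⟩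
    have hP0 : 0 ≤ P := hQP ▸ hQ.optRisk_nonneg hpos
    refine (hQ.ermRate_of_lossLipschitz hG hR hE).mono (fun _ => id) fun n δ _ _ => ?_
    rw [hQP, abs_of_nonneg hP0]
    calc C * deviation d n δ = C / P * (deviation d n δ * P) := by field_simp
      _ ≤ C / P * (deviation d n δ ^ 2 + deviation d n δ * P) := by
        gcongr
        exact le_add_of_nonneg_left (sq_nonneg _)

end HasFiniteMeans

end QuadProblem

section Adapted

variable {Ω : Type w} {X : Type*} [mX : MeasurableSpace X]

/-- The σ-algebra generated by the samples `ξ 0, …, ξ (N - 1)`. -/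
abbrev samplePast (ξ : ℕ → Ω → X) (N : ℕ) : MeasurableSpace Ω :=
  ⨆ i ∈ Set.Iio N, mX.comap (ξ i)

theorem samplePast_mono (ξ : ℕ → Ω → X) : Monotone (samplePast ξ) :=
  fun _ _ h => biSup_mono fun _ hi => lt_of_lt_of_le hi h

theorem measurable_samplePast (ξ : ℕ → Ω → X) {M N : ℕ} (h : M < N) :
    Measurable[samplePast ξ N] (ξ M) :=
  (comap_measurable (ξ M)).mono
    (le_biSup (fun i => mX.comap (ξ i)) (Set.mem_Iio.2 h)) le_rfl

theorem measurable_samplePast_sum {S : Type*} [MeasurableSpace S] {ξ : ℕ → Ω → X} {D : S → X → ℝ}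
    (hD : Measurable (Function.uncurry D)) {s : ℕ} {U : ℕ → Ω → S}
    (hU : ∀ t, Measurable[samplePast ξ (s + t)] (U t)) (N : ℕ) :
    Measurable[samplePast ξ (s + N)]
      fun ω => ∑ t ∈ Finset.range N, D (U t ω) (ξ (s + t) ω) := by
  refine Finset.measurable_fun_sum _ fun t ht => ?_
  have ht := Finset.mem_range.1 ht
  have hUt : Measurable[samplePast ξ (s + N)] (U t) :=
    (hU t).mono (samplePast_mono ξ (by omega)) le_rfl
  exact hD.comp (hUt.prodMk (measurable_samplePast ξ (by omega)))

variable [mΩ : MeasurableSpace Ω] {Pr : Measure Ω} {μ : Measure X} {ξ : ℕ → Ω → X}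

theorem IsIIDSample.samplePast_le (h : IsIIDSample Pr μ ξ) (N : ℕ) : samplePast ξ N ≤ mΩ :=
  iSup₂_le fun i _ => (h.measurable i).comap_le

theorem IsIIDSample.indepFun_past (h : IsIIDSample Pr μ ξ) {S : Type*} [MeasurableSpace S] {N : ℕ}
    {V : Ω → S} (hV : Measurable[samplePast ξ N] V) : IndepFun V (ξ N) Pr := by
  have hindep := indep_iSup_of_disjoint (fun i => (h.measurable i).comap_le) h.indep.iIndep
    (S := Set.Iio N) (T := {N}) (by simp)
  rw [IndepFun_iff_Indep]
  refine indep_of_indep_of_le_left (indep_of_indep_of_le_right hindep ?_) hV.comap_le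
  simp

theorem IsIIDSample.lintegral_past (h : IsIIDSample Pr μ ξ) {S : Type*} [MeasurableSpace S] {N : ℕ}
    {V : Ω → S} (hV : Measurable[samplePast ξ N] V) {F : S → X → ENNReal}
    (hF : Measurable (Function.uncurry F)) :
    ∫⁻ ω, F (V ω) (ξ N ω) ∂Pr = ∫⁻ ω, ∫⁻ x, F (V ω) x ∂μ ∂Pr := by
  have := h.indep.isProbabilityMeasure
  have := h.isProbabilityMeasure
  have hV' : Measurable V := hV.mono (h.samplePast_le N) le_rfl
  have hprod : Pr.map (fun ω => (V ω, ξ N ω)) = (Pr.map V).prod μ := by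
    rw [← h.law N]
    exact (indepFun_iff_map_prod_eq_prod_map_map hV'.aemeasurable
      (h.measurable N).aemeasurable).1 (h.indepFun_past hV)
  calc ∫⁻ ω, F (V ω) (ξ N ω) ∂Pr
      = ∫⁻ z, Function.uncurry F z ∂(Pr.map V).prod μ := by
        rw [← hprod, lintegral_map hF (hV'.prodMk (h.measurable N))]
        rfl
    _ = ∫⁻ ω, ∫⁻ x, F (V ω) x ∂μ ∂Pr := by
        rw [lintegral_prod _ hF.aemeasurable, lintegral_map hF.lintegral_prod_right' hV']
        rfl

theorem lintegral_exp_le_of_bounded [IsProbabilityMeasure μ] {g : X → ℝ} (hg : Measurable g) {c : ℝ}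
    (hb : ∀ᵐ x ∂μ, |g x| ≤ c) (h0 : ∫ x, g x ∂μ = 0) (l : ℝ) :
    ∫⁻ x, ENNReal.ofReal (Real.exp (l * g x)) ∂μ
      ≤ ENNReal.ofReal (Real.exp (c ^ 2 * l ^ 2 / 2)) := by
  have h := hasSubgaussianMGF_of_mem_Icc_of_integral_eq_zero (a := -c) (b := c) hg.aemeasurable
    (hb.mono fun x hx => abs_le.1 hx) h0
  rw [← ofReal_integral_eq_lintegral_ofReal (h.integrable_exp_mul l)
    (.of_forall fun x => (Real.exp_pos _).le)]
  refine ENNReal.ofReal_le_ofReal ((h.mgf_le l).trans_eq ?_)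
  congr 3
  push_cast
  rw [Real.norm_eq_abs, div_pow, sq_abs]
  ring

theorem hasSubgaussianMGF_of_lintegral_exp_le {g : X → ℝ} (hg : Measurable g) {c : NNReal}
    (h : ∀ l : ℝ, ∫⁻ x, ENNReal.ofReal (Real.exp (l * g x)) ∂μ
      ≤ ENNReal.ofReal (Real.exp (c * l ^ 2 / 2))) :
    HasSubgaussianMGF g c μ where
  integrable_exp_mul l := by
    refine ⟨(hg.const_mul l).exp.aestronglyMeasurable, ?_⟩
    rw [hasFiniteIntegral_iff_ofReal (.of_forall fun x => (Real.exp_pos _).le)]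
    exact (h l).trans_lt ENNReal.ofReal_lt_top
  mgf_le l := by
    rw [mgf, integral_eq_lintegral_of_nonneg_ae (.of_forall fun x => (Real.exp_pos _).le)
      (hg.const_mul l).exp.aestronglyMeasurable]
    exact ENNReal.toReal_le_of_le_ofReal (Real.exp_pos _).le (h l)

theorem IsIIDSample.lintegral_exp_add_le (h : IsIIDSample Pr μ ξ) {S : Type*} [MeasurableSpace S]
    {D : S → X → ℝ} (hD : Measurable (Function.uncurry D)) {c : ℝ} {T : Set S}
    (hb : ∀ a ∈ T, ∀ᵐ x ∂μ, |D a x| ≤ c) (h0 : ∀ a ∈ T, ∫ x, D a x ∂μ = 0) {N : ℕ} {Y : Ω → ℝ}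
    {V : Ω → S} (hY : Measurable[samplePast ξ N] Y) (hV : Measurable[samplePast ξ N] V)
    (hVT : ∀ ω, V ω ∈ T) (l : ℝ) :
    ∫⁻ ω, ENNReal.ofReal (Real.exp (l * (Y ω + D (V ω) (ξ N ω)))) ∂Pr
      ≤ (∫⁻ ω, ENNReal.ofReal (Real.exp (l * Y ω)) ∂Pr)
        * ENNReal.ofReal (Real.exp (c ^ 2 * l ^ 2 / 2)) := by
  have := h.isProbabilityMeasure
  have hDV (v : S) : Measurable (D v) := hD.comp measurable_prodMk_left
  have hF : Measurable (Function.uncurry fun (z : ℝ × S) (x : X) =>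
      ENNReal.ofReal (Real.exp (l * (z.1 + D z.2 x)))) := by
    have : Measurable fun q : (ℝ × S) × X => D q.1.2 q.2 :=
      hD.comp ((measurable_snd.comp measurable_fst).prodMk measurable_snd)
    exact (((measurable_fst.comp measurable_fst).add this).const_mul l).exp.ennreal_ofReal
  have hexp (y z : ℝ) : ENNReal.ofReal (Real.exp (l * (y + z)))
      = ENNReal.ofReal (Real.exp (l * y)) * ENNReal.ofReal (Real.exp (l * z)) := by
    rw [mul_add, Real.exp_add, ENNReal.ofReal_mul (Real.exp_pos _).le]
  calc ∫⁻ ω, ENNReal.ofReal (Real.exp (l * (Y ω + D (V ω) (ξ N ω)))) ∂Pr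
      = ∫⁻ ω, ∫⁻ x, ENNReal.ofReal (Real.exp (l * (Y ω + D (V ω) x))) ∂μ ∂Pr :=
        h.lintegral_past (hY.prodMk hV) hF
    _ ≤ ∫⁻ ω, ENNReal.ofReal (Real.exp (l * Y ω))
          * ENNReal.ofReal (Real.exp (c ^ 2 * l ^ 2 / 2)) ∂Pr := by
        refine lintegral_mono fun ω => ?_
        simp only [hexp]
        rw [lintegral_const_mul _ ((hDV _).const_mul l).exp.ennreal_ofReal]
        gcongr
        exact lintegral_exp_le_of_bounded (hDV _) (hb _ (hVT ω)) (h0 _ (hVT ω)) l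
    _ = _ := lintegral_mul_const _
        ((hY.mono (h.samplePast_le N) le_rfl).const_mul l).exp.ennreal_ofReal

theorem IsIIDSample.hasSubgaussianMGF_sum (h : IsIIDSample Pr μ ξ) {S : Type*} [MeasurableSpace S]
    {D : S → X → ℝ} (hD : Measurable (Function.uncurry D)) {c : NNReal} {T : Set S}
    (hb : ∀ a ∈ T, ∀ᵐ x ∂μ, |D a x| ≤ c) (h0 : ∀ a ∈ T, ∫ x, D a x ∂μ = 0) {s : ℕ}
    {U : ℕ → Ω → S} (hU : ∀ t, Measurable[samplePast ξ (s + t)] (U t)) (hUT : ∀ t ω, U t ω ∈ T)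
    (N : ℕ) :
    HasSubgaussianMGF (fun ω => ∑ t ∈ Finset.range N, D (U t ω) (ξ (s + t) ω)) (N * c ^ 2) Pr := by
  have := h.indep.isProbabilityMeasure
  have hsum := measurable_samplePast_sum hD hU
  refine hasSubgaussianMGF_of_lintegral_exp_le ((hsum N).mono (h.samplePast_le _) le_rfl)
    fun l => ?_
  induction N with
  | zero => simp
  | succ N ih =>
    simp only [Finset.sum_range_succ]
    calc ∫⁻ ω, ENNReal.ofReal (Real.exp (l * (∑ t ∈ Finset.range N, D (U t ω) (ξ (s + t) ω)
          + D (U N ω) (ξ (s + N) ω)))) ∂Pr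
        ≤ (∫⁻ ω, ENNReal.ofReal
            (Real.exp (l * ∑ t ∈ Finset.range N, D (U t ω) (ξ (s + t) ω))) ∂Pr)
          * ENNReal.ofReal (Real.exp (c ^ 2 * l ^ 2 / 2)) :=
          h.lintegral_exp_add_le hD hb h0 (hsum N) (hU N) (hUT N) l
      _ ≤ ENNReal.ofReal (Real.exp (↑(N * c ^ 2) * l ^ 2 / 2))
          * ENNReal.ofReal (Real.exp (c ^ 2 * l ^ 2 / 2)) := by gcongr
      _ = _ := by
          rw [← ENNReal.ofReal_mul (Real.exp_pos _).le, ← Real.exp_add]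
          congr 2
          push_cast
          ring

/-- The **Azuma-Hoeffding inequality** for increments `D (U t) (ξ (s + t))` along a predictable
sequence `U`. The version in Mathlib needs `Ω` to be a standard Borel space. -/
theorem IsIIDSample.withHighProb_sum_le (h : IsIIDSample Pr μ ξ) {S : Type*} [MeasurableSpace S]
    {D : S → X → ℝ} (hD : Measurable (Function.uncurry D)) {c : ℝ} (hc : 0 < c) {T : Set S}
    (hb : ∀ a ∈ T, ∀ᵐ x ∂μ, |D a x| ≤ c) (h0 : ∀ a ∈ T, ∫ x, D a x ∂μ = 0) {s : ℕ}
    {U : ℕ → Ω → S} (hU : ∀ t, Measurable[samplePast ξ (s + t)] (U t)) (hUT : ∀ t ω, U t ω ∈ T)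
    (N : ℕ) {ℓ : ℝ} (hℓ : 0 ≤ ℓ) :
    WithHighProb Pr (Real.exp (-ℓ)) fun ω =>
      ∑ t ∈ Finset.range N, D (U t ω) (ξ (s + t) ω) ≤ c * √(2 * (N * ℓ)) := by
  have := h.indep.isProbabilityMeasure
  obtain rfl | hN := N.eq_zero_or_pos
  · exact .of_forall fun _ => by simp
  have : (0 : ℝ) < N := Nat.cast_pos.2 hN
  lift c to NNReal using hc.le
  have htail := (h.hasSubgaussianMGF_sum hD hb h0 hU hUT N).measure_ge_le
    (ε := c * √(2 * (N * ℓ))) (by positivity)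
  have hexp : -(c * √(2 * (N * ℓ))) ^ 2 / (2 * ↑(N * c ^ 2)) = -ℓ := by
    rw [mul_pow, Real.sq_sqrt (by positivity)]
    push_cast
    field_simp
  rw [hexp] at htail
  refine (measure_mono fun ω hω => ?_).trans
    (ENNReal.le_ofReal_iff_toReal_le (measure_ne_top _ _) (Real.exp_pos _).le |>.2 htail)
  exact (not_le.1 hω).le

end Adapted

section Projection

variable {d : ℕ}

theorem IsClosest.inner_sub_sub_nonpos {K : Set (EuclideanSpace ℝ (Fin d))} (hK : Convex ℝ K)
    {x y v : EuclideanSpace ℝ (Fin d)} (h : IsClosest K x y) (hv : v ∈ K) : ⟪x - y, v - y⟫ ≤ 0 :=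
  inner_sub_sub_nonpos_of_forall_norm_sub_le hK h.1 h.2 hv

theorem IsClosest.norm_sub_sq_le {K K' : Set (EuclideanSpace ℝ (Fin d))} (hK : Convex ℝ K)
    (hK' : Convex ℝ K') {x x' y y' : EuclideanSpace ℝ (Fin d)} (h : IsClosest K x y)
    (h' : IsClosest K' x' y') {η : ℝ} (hη : ∃ v ∈ K, ‖v - y'‖ ≤ η) (hη' : ∃ v ∈ K', ‖v - y‖ ≤ η) :
    ‖y - y'‖ ^ 2 ≤ ‖x - x'‖ * ‖y - y'‖ + η * (‖x - y‖ + ‖x' - y'‖) := by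
  obtain ⟨v, hv, hvη⟩ := hη
  obtain ⟨v', hv', hvη'⟩ := hη'
  have hvar := h.inner_sub_sub_nonpos hK hv
  have hvar' := h'.inner_sub_sub_nonpos hK' hv'
  rw [← sub_sub_sub_cancel_right v y y', inner_sub_right] at hvar
  rw [← sub_add_sub_cancel v' y y', inner_add_right] at hvar'
  have hfar : -(‖x - y‖ * η) ≤ ⟪x - y, v - y'⟫ :=
    neg_le_of_abs_le ((abs_real_inner_le_norm _ _).trans (by gcongr))
  have hfar' : -(‖x' - y'‖ * η) ≤ ⟪x' - y', v' - y⟫ :=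
    neg_le_of_abs_le ((abs_real_inner_le_norm _ _).trans (by gcongr))
  have hcross := real_inner_le_norm (x - x') (y - y')
  have hsq : ⟪x' - y', y - y'⟫ - ⟪x - y, y - y'⟫ = ‖y - y'‖ ^ 2 - ⟪x - x', y - y'⟫ := by
    rw [← inner_sub_left, ← real_inner_self_eq_norm_sq, ← inner_sub_left]
    congr 1
    abel
  linarith

theorem proj_eq_self {K : Set (EuclideanSpace ℝ (Fin d))} {x : EuclideanSpace ℝ (Fin d)}
    (hx : x ∈ K) : proj K x = x := by
  have h : IsClosest K x (proj K x) := Classical.epsilon_spec ⟨x, hx, fun v _ => by simp⟩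
  have hle := h.2 x hx
  rw [sub_self, norm_zero] at hle
  exact (norm_sub_eq_zero_iff.1 (hle.antisymm (norm_nonneg _))).symm

theorem continuous_proj {K : Set (EuclideanSpace ℝ (Fin d))} (hc : IsClosed K) (hK : Convex ℝ K)
    (hne : K.Nonempty) : Continuous (proj K) := by
  refine (LipschitzWith.of_dist_le_mul (K := 1) fun x x' => ?_).continuous
  rw [dist_eq_norm, dist_eq_norm, NNReal.coe_one, one_mul]
  have h := isClosest_proj hc hne x
  have h' := isClosest_proj hc hne x'
  have hsq := h.norm_sub_sq_le hK hK h' (η := 0) ⟨_, h'.1, by simp⟩ ⟨_, h.1, by simp⟩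
  rw [zero_mul, add_zero, sq] at hsq
  by_contra! hlt
  exact hlt.not_ge (le_of_mul_le_mul_right hsq ((norm_nonneg _).trans_lt hlt))

theorem exists_mem_inter_closedBall {W : Set (EuclideanSpace ℝ (Fin d))} (hW : Convex ℝ W) {r : ℝ}
    (hr : 0 < r) {x x' y : EuclideanSpace ℝ (Fin d)} (hx : x ∈ W)
    (hy : y ∈ W ∩ Metric.closedBall x' r) :
    ∃ v ∈ W ∩ Metric.closedBall x r, ‖v - y‖ ≤ ‖x - x'‖ := by
  have hyx : ‖y - x‖ ≤ r + ‖x - x'‖ := by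
    rw [norm_sub_rev x x']
    exact (norm_sub_le_norm_sub_add_norm_sub y x' x).trans
      (add_le_add_left (mem_closedBall_iff_norm.1 hy.2) _)
  have hη := norm_nonneg (x - x')
  set η := ‖x - x'‖
  have hpos : 0 < r + η := by positivity
  refine ⟨y + (η / (r + η)) • (x - y), ⟨hW.add_smul_sub_mem hy.1 hx
    ⟨by positivity, div_le_one_of_le₀ (by linarith) hpos.le⟩, ?_⟩, ?_⟩
  · have hcomb : y + (η / (r + η)) • (x - y) - x = (r / (r + η)) • (y - x) := by
      have : r / (r + η) = 1 - η / (r + η) := by field_simp; ring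
      rw [this]
      module
    rw [mem_closedBall_iff_norm, hcomb, norm_smul, Real.norm_eq_abs,
      abs_of_nonneg (by positivity), div_mul_eq_mul_div, div_le_iff₀ hpos]
    gcongr
  · rw [add_sub_cancel_left, norm_smul, Real.norm_eq_abs, abs_of_nonneg (by positivity),
      norm_sub_rev, div_mul_eq_mul_div, div_le_iff₀ hpos]
    gcongr

theorem isClosest_proj_inter_closedBall {W : Set (EuclideanSpace ℝ (Fin d))} (hc : IsClosed W)
    {r : ℝ} (hr : 0 ≤ r) {x : EuclideanSpace ℝ (Fin d)} (hx : x ∈ W)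
    (y : EuclideanSpace ℝ (Fin d)) :
    IsClosest (W ∩ Metric.closedBall x r) y (proj (W ∩ Metric.closedBall x r) y) :=
  isClosest_proj (hc.inter Metric.isClosed_closedBall) ⟨x, hx, Metric.mem_closedBall_self hr⟩ y

theorem norm_proj_inter_closedBall_sub_sq_le {W : Set (EuclideanSpace ℝ (Fin d))}
    (hc : IsClosed W) (hW : Convex ℝ W) {r : ℝ} (hr : 0 < r) {x x' : EuclideanSpace ℝ (Fin d)}
    (hx : x ∈ W) (hx' : x' ∈ W) (y y' : EuclideanSpace ℝ (Fin d)) :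
    ‖proj (W ∩ Metric.closedBall x r) y - proj (W ∩ Metric.closedBall x' r) y'‖ ^ 2
      ≤ ‖y - y'‖ * (r + (‖x - x'‖ + r)) + ‖x - x'‖ * (‖y - x‖ + ‖y' - x'‖) := by
  have hconv (z : EuclideanSpace ℝ (Fin d)) : Convex ℝ (W ∩ Metric.closedBall z r) :=
    hW.inter (convex_closedBall z r)
  have h := isClosest_proj_inter_closedBall hc hr.le hx y
  have h' := isClosest_proj_inter_closedBall hc hr.le hx' y'
  set p := proj (W ∩ Metric.closedBall x r) y
  set p' := proj (W ∩ Metric.closedBall x' r) y'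
  have hpp' : ‖p - p'‖ ≤ r + (‖x - x'‖ + r) := by
    refine (norm_sub_le_norm_sub_add_norm_sub p x p').trans (add_le_add
      (mem_closedBall_iff_norm.1 h.1.2) ((norm_sub_le_norm_sub_add_norm_sub x x' p').trans ?_))
    rw [norm_sub_rev x' p']
    exact add_le_add_right (mem_closedBall_iff_norm.1 h'.1.2) _
  refine (h.norm_sub_sq_le (hconv x) (hconv x') h'
    (exists_mem_inter_closedBall hW hr hx h'.1) ?_).trans ?_
  · rw [norm_sub_rev]
    exact exists_mem_inter_closedBall hW hr hx' h.1
  · gcongr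
    · exact h.2 x ⟨hx, Metric.mem_closedBall_self hr.le⟩
    · exact h'.2 x' ⟨hx', Metric.mem_closedBall_self hr.le⟩

theorem continuous_proj_inter_closedBall {W : Set (EuclideanSpace ℝ (Fin d))} (hc : IsClosed W)
    (hW : Convex ℝ W) {r : ℝ} (hr : 0 < r) {T : Type*} [TopologicalSpace T]
    {x y : T → EuclideanSpace ℝ (Fin d)} (hx : Continuous x) (hxW : ∀ t, x t ∈ W)
    (hy : Continuous y) :
    Continuous fun t => proj (W ∩ Metric.closedBall (x t) r) (y t) := by
  refine continuous_iff_continuousAt.2 fun t₀ => tendsto_iff_norm_sub_tendsto_zero.2 ?_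
  have hlim : Filter.Tendsto (fun t => √(‖y t - y t₀‖ * (r + (‖x t - x t₀‖ + r))
      + ‖x t - x t₀‖ * (‖y t - x t‖ + ‖y t₀ - x t₀‖))) (nhds t₀) (nhds 0) := by
    have hcont : Continuous fun t => √(‖y t - y t₀‖ * (r + (‖x t - x t₀‖ + r))
      + ‖x t - x t₀‖ * (‖y t - x t‖ + ‖y t₀ - x t₀‖)) := by fun_prop
    simpa using hcont.tendsto t₀
  exact squeeze_zero (fun t => norm_nonneg _) (fun t => Real.le_sqrt_of_sq_le
    (norm_proj_inter_closedBall_sub_sq_le hc hW hr (hxW t) (hxW t₀) _ _)) hlim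

theorem IsClosest.norm_sub_sq_le_of_step {K : Set (EuclideanSpace ℝ (Fin d))} (hK : Convex ℝ K)
    {G γ : ℝ} (hγ : 0 ≤ γ) {u u' y g : EuclideanSpace ℝ (Fin d)} (hu' : IsClosest K (u - γ • g) u')
    (hy : y ∈ K) (hg : |⟪g, u' - u⟫| ≤ G * ‖u' - u‖) :
    ‖u' - y‖ ^ 2 ≤ ‖u - y‖ ^ 2 - 2 * γ * ⟪g, u - y⟫ + γ ^ 2 * G ^ 2 := by
  have hvar := hu'.inner_sub_sub_nonpos hK hy
  rw [sub_right_comm, inner_sub_left, real_inner_smul_left] at hvar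
  have hsq : ‖u - y‖ ^ 2 = ‖u' - u‖ ^ 2 - 2 * ⟪u - u', y - u'⟫ + ‖u' - y‖ ^ 2 := by
    rw [← sub_sub_sub_cancel_right u y u', norm_sub_sq_real, norm_sub_rev u u', norm_sub_rev y u']
  have hsplit : ⟪g, y - u'⟫ = -⟪g, u - y⟫ - ⟪g, u' - u⟫ := by
    rw [← inner_neg_right, ← inner_sub_right]
    congr 1
    abel
  have := mul_le_mul_of_nonneg_left (abs_le.1 hg).1 hγ
  rw [hsplit] at hvar
  nlinarith [sq_nonneg (‖u' - u‖ - γ * G)]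

end Projection

theorem sum_range_one_div_succ (N : ℕ) :
    ∑ _t ∈ Finset.range (N + 1), 1 / ((N : ℝ) + 1) = 1 := by
  rw [Finset.sum_const, Finset.card_range, nsmul_eq_mul, Nat.cast_succ]
  exact mul_one_div_cancel (by positivity)

theorem norm_sub_le_two_mul_of_mem_closedBall {E : Type*} [SeminormedAddCommGroup E] {x y z : E}
    {r : ℝ} (hx : x ∈ Metric.closedBall z r) (hy : y ∈ Metric.closedBall z r) :
    ‖x - y‖ ≤ 2 * r := by
  rw [two_mul, ← dist_eq_norm]
  exact (dist_triangle_right x y z).trans (add_le_add hx hy)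

namespace QuadProblem

variable {d : ℕ} {Z : Type u} {Z' : Type v} [MeasurableSpace Z] [MeasurableSpace Z']
  {Q : QuadProblem d Z Z'} {K : Set (EuclideanSpace ℝ (Fin d))} {G γ r : ℝ}
  {x y : EuclideanSpace ℝ (Fin d)}

theorem isClosest_ssgIter_succ (hc : IsClosed K) (hne : K.Nonempty) (s : ℕ → Z × Z') (t : ℕ) :
    IsClosest K (Q.ssgIter K γ x s t
      - γ • quadGrad (Q.A (s t).1) (Q.b (s t).2) (Q.ssgIter K γ x s t))
      (Q.ssgIter K γ x s (t + 1)) := by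
  rw [← (hasGradientAt_loss _ (s t)).gradient]
  exact isClosest_proj hc hne _

theorem ssgIter_mem (hc : IsClosed K) (hx : x ∈ K) (s : ℕ → Z × Z') (t : ℕ) :
    Q.ssgIter K γ x s t ∈ K := by
  cases t with
  | zero => exact hx
  | succ t => exact (isClosest_ssgIter_succ hc ⟨x, hx⟩ s t).1

theorem ssg_eq_sum (x : EuclideanSpace ℝ (Fin d)) (γ : ℝ) (N : ℕ)
    (K : Set (EuclideanSpace ℝ (Fin d))) (s : ℕ → Z × Z') :
    Q.ssg x γ N K s = ∑ t ∈ Finset.range (N + 1), (1 / ((N : ℝ) + 1)) • Q.ssgIter K γ x s t :=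
  Finset.smul_sum

theorem ssg_mem (hc : IsClosed K) (hK : Convex ℝ K) (hx : x ∈ K) (s : ℕ → Z × Z') (N : ℕ) :
    Q.ssg x γ N K s ∈ K := by
  rw [ssg_eq_sum]
  exact hK.sum_mem (fun _ _ => by positivity) (sum_range_one_div_succ N)
    fun t _ => ssgIter_mem hc hx s t

theorem mul_risk_ssg_sub_le (hA : Q.meanA.PosSemidef) (N : ℕ) (s : ℕ → Z × Z') (F : ℝ) :
    ((N : ℝ) + 1) * (Q.risk (Q.ssg x γ N K s) - F)
      ≤ ∑ t ∈ Finset.range (N + 1), (Q.risk (Q.ssgIter K γ x s t) - F) := by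
  have hconv : ConvexOn ℝ Set.univ Q.risk := convexOn_quad hA convex_univ
  have hjensen := hconv.map_sum_le (t := Finset.range (N + 1)) (p := Q.ssgIter K γ x s)
    (fun _ _ => by positivity) (sum_range_one_div_succ N) fun _ _ => Set.mem_univ _
  rw [← ssg_eq_sum, ← Finset.smul_sum, smul_eq_mul, one_div, ← div_eq_inv_mul,
    le_div_iff₀' (by positivity)] at hjensen
  rw [Finset.sum_sub_distrib, Finset.sum_const, Finset.card_range, nsmul_eq_mul, mul_sub,
    Nat.cast_succ]
  exact sub_le_sub_right hjensen _

/-- The fluctuation at the sample `p` of the directional derivative of the loss around that of the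
risk, at the point `a.1` in the direction `a.1 - a.2`. -/
noncomputable def gradNoise (Q : QuadProblem d Z Z')
    (a : EuclideanSpace ℝ (Fin d) × EuclideanSpace ℝ (Fin d)) (p : Z × Z') : ℝ :=
  ⟪quadGrad Q.meanA Q.meanb a.1, a.1 - a.2⟫ - ⟪quadGrad (Q.A p.1) (Q.b p.2) a.1, a.1 - a.2⟫

theorem risk_sub_le_inner_add_gradNoise (hA : Q.meanA.PosSemidef)
    (x y : EuclideanSpace ℝ (Fin d)) (p : Z × Z') :
    Q.risk x - Q.risk y
      ≤ ⟪quadGrad (Q.A p.1) (Q.b p.2) x, x - y⟫ + Q.gradNoise (x, y) p := by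
  have hgrad := inner_quadGrad_le_of_posSemidef (b := Q.meanb) (c := Q.c) (x := y) (y := x) hA
  rw [← neg_sub x y, inner_neg_right, ← risk_eq_quad] at hgrad
  rw [gradNoise]
  linarith

theorem sum_inner_grad_le (hW : Convex ℝ Q.W) (hγ : 0 ≤ γ) (hc : IsClosed K) (hK : Convex ℝ K)
    (hKW : K ⊆ Q.W) (hx : x ∈ K) (hy : y ∈ K) {s : ℕ → Z × Z'}
    (hs : ∀ t, ∀ x ∈ Q.W, ∀ y ∈ Q.W, |Q.loss x (s t) - Q.loss y (s t)| ≤ G * ‖x - y‖) (N : ℕ) :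
    ‖Q.ssgIter K γ x s N - y‖ ^ 2 + 2 * γ * ∑ t ∈ Finset.range N,
      ⟪quadGrad (Q.A (s t).1) (Q.b (s t).2) (Q.ssgIter K γ x s t), Q.ssgIter K γ x s t - y⟫
      ≤ ‖x - y‖ ^ 2 + N * (γ ^ 2 * G ^ 2) := by
  induction N with
  | zero => simp [ssgIter]
  | succ N ih =>
    have hmem (t : ℕ) : Q.ssgIter K γ x s t ∈ Q.W := hKW (ssgIter_mem hc hx s t)
    have := (isClosest_ssgIter_succ hc ⟨x, hx⟩ s N).norm_sub_sq_le_of_step hK hγ hy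
      (abs_inner_le_of_lipschitz hW (hs N) (hasGradientAt_loss _ _) (hmem N) (hmem (N + 1)))
    rw [Finset.sum_range_succ, mul_add]
    push_cast
    linarith

theorem sum_inner_grad_le_mul_sqrt (hW : Convex ℝ Q.W) (hr : 0 < r) (hG : 0 < G)
    (hc : IsClosed K) (hK : Convex ℝ K) (hKW : K ⊆ Q.W) (hx : x ∈ K) (hy : y ∈ K)
    (hxy : ‖x - y‖ ≤ r) {s : ℕ → Z × Z'}
    (hs : ∀ t, ∀ x ∈ Q.W, ∀ y ∈ Q.W, |Q.loss x (s t) - Q.loss y (s t)| ≤ G * ‖x - y‖) (N : ℕ)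
    (hγ : γ = r / (G * √((N : ℝ) + 1))) :
    ∑ t ∈ Finset.range N, ⟪quadGrad (Q.A (s t).1) (Q.b (s t).2) (Q.ssgIter K γ x s t),
      Q.ssgIter K γ x s t - y⟫ ≤ G * r * √((N : ℝ) + 1) := by
  have hq : √((N : ℝ) + 1) ^ 2 = N + 1 := Real.sq_sqrt (by positivity)
  have hq0 : 0 < √((N : ℝ) + 1) := Real.sqrt_pos.2 (by positivity)
  set q := √((N : ℝ) + 1)
  have hγ0 : 0 < γ := by rw [hγ]; positivity
  have hγr : γ * (G * q) = r := by rw [hγ]; field_simp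
  have hnoise : N * (γ ^ 2 * G ^ 2) ≤ r ^ 2 := by
    have : 0 ≤ γ ^ 2 * G ^ 2 := by positivity
    rw [← hγr, mul_pow, mul_pow, hq]
    linarith
  have hsum := sum_inner_grad_le hW hγ0.le hc hK hKW hx hy hs N
  have hdist : ‖x - y‖ ^ 2 ≤ r ^ 2 := pow_le_pow_left₀ (norm_nonneg _) hxy 2
  refine le_of_mul_le_mul_left ?_ (mul_pos two_pos hγ0)
  rw [show 2 * γ * (G * r * q) = 2 * r * (γ * (G * q)) by ring, hγr]
  linarith [sq_nonneg ‖Q.ssgIter K γ x s N - y‖]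

theorem HasFiniteMeans.abs_risk_sub_le (hQ : Q.HasFiniteMeans) (hG : 0 ≤ G)
    (hL : Q.LossLipschitz G) (hx : x ∈ Q.W) (hy : y ∈ Q.W) :
    |Q.risk x - Q.risk y| ≤ G * ‖x - y‖ := by
  have := hQ.isProbability
  simpa only [abs_of_nonneg hG] using (hQ.isLipschitzLoss hL).abs_sub_le hx hy

theorem HasFiniteMeans.risk_ssg_sub_le (hQ : Q.HasFiniteMeans) (hA : Q.meanA.PosSemidef)
    (hcW : IsClosed Q.W) (hW : Convex ℝ Q.W) (hr : 0 < r) (hG : 0 < G) (hL : Q.LossLipschitz G)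
    (hx : x ∈ Q.W) (hK : K = Q.W ∩ Metric.closedBall x r) (hy : y ∈ K) {s : ℕ → Z × Z'}
    (hs : ∀ t, ∀ x ∈ Q.W, ∀ y ∈ Q.W, |Q.loss x (s t) - Q.loss y (s t)| ≤ G * ‖x - y‖) (N : ℕ)
    (hγ : γ = r / (G * √((N : ℝ) + 1))) :
    ((N : ℝ) + 1) * (Q.risk (Q.ssg x γ N K s) - Q.risk y) ≤ 3 * (G * r * √((N : ℝ) + 1))
      + ∑ t ∈ Finset.range N, Q.gradNoise (Q.ssgIter K γ x s t, y) (s t) := by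
  have hc : IsClosed K := hK ▸ hcW.inter Metric.isClosed_closedBall
  have hKconv : Convex ℝ K := hK ▸ hW.inter (convex_closedBall x r)
  have hKW : K ⊆ Q.W := hK ▸ Set.inter_subset_left
  have hKball : K ⊆ Metric.closedBall x r := hK ▸ Set.inter_subset_right
  have hxK : x ∈ K := hK ▸ ⟨hx, Metric.mem_closedBall_self hr.le⟩
  have hxy : ‖x - y‖ ≤ r := by
    rw [norm_sub_rev]
    exact mem_closedBall_iff_norm.1 (hKball hy)
  have hlast : Q.risk (Q.ssgIter K γ x s N) - Q.risk y ≤ G * (2 * r) := by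
    have hmem : Q.ssgIter K γ x s N ∈ K := ssgIter_mem hc hxK s N
    exact (le_abs_self _).trans ((hQ.abs_risk_sub_le hG.le hL (hKW hmem) (hKW hy)).trans
      (mul_le_mul_of_nonneg_left
        (norm_sub_le_two_mul_of_mem_closedBall (hKball hmem) (hKball hy)) hG.le))
  have hfirst : ∑ t ∈ Finset.range N, (Q.risk (Q.ssgIter K γ x s t) - Q.risk y)
      ≤ G * r * √((N : ℝ) + 1)
        + ∑ t ∈ Finset.range N, Q.gradNoise (Q.ssgIter K γ x s t, y) (s t) := by
    refine (Finset.sum_le_sum fun t _ =>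
      risk_sub_le_inner_add_gradNoise hA _ y (s t)).trans ?_
    rw [Finset.sum_add_distrib]
    gcongr
    exact sum_inner_grad_le_mul_sqrt hW hr hG hc hKconv hKW hxK hy hxy hs N hγ
  have hsqrt : 1 ≤ √((N : ℝ) + 1) := Real.one_le_sqrt.2 (by linarith [N.cast_nonneg (α := ℝ)])
  have hjensen := mul_risk_ssg_sub_le hA (x := x) (γ := γ) (K := K) N s (Q.risk y)
  rw [Finset.sum_range_succ] at hjensen
  linarith [le_mul_of_one_le_right (mul_pos hG hr).le hsqrt]

end QuadProblem

namespace QuadProblem.HasFiniteMeans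

variable {d : ℕ} {Z : Type u} {Z' : Type v} [MeasurableSpace Z] [MeasurableSpace Z']
  {Q : QuadProblem d Z Z'} {G r : ℝ}

theorem measurable_inner_quadGrad (hQ : Q.HasFiniteMeans) {S : Type*} [MeasurableSpace S]
    {x h : S → EuclideanSpace ℝ (Fin d)} {p : S → Z × Z'} (hx : Measurable x) (hh : Measurable h)
    (hp : Measurable p) :
    Measurable fun a => ⟪quadGrad (Q.A (p a).1) (Q.b (p a).2) (x a), h a⟫ := by
  have hA (i j : Fin d) : Measurable fun a => Q.A (p a).1 i j := (hQ.measurable_A i j).comp hp.fst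
  simp only [inner_quadGrad]
  exact ((measurable_dotProduct_mulVec (by fun_prop) hA (by fun_prop)).add
    (measurable_dotProduct_mulVec (by fun_prop) hA (by fun_prop))).add
    (hh.inner (hQ.measurable_b.comp hp.snd))

theorem measurable_quadGrad (hQ : Q.HasFiniteMeans) {S : Type*} [MeasurableSpace S]
    {x : S → EuclideanSpace ℝ (Fin d)} {p : S → Z × Z'} (hx : Measurable x) (hp : Measurable p) :
    Measurable fun a => quadGrad (Q.A (p a).1) (Q.b (p a).2) (x a) := by
  refine (WithLp.measurable_toLp 2 _).comp (measurable_pi_lambda _ fun i => ?_)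
  have h := hQ.measurable_inner_quadGrad hx (measurable_const (a := EuclideanSpace.single i 1)) hp
  simp only [EuclideanSpace.inner_single_right, one_mul, conj_trivial] at h
  exact h

theorem measurable_gradNoise (hQ : Q.HasFiniteMeans) :
    Measurable (Function.uncurry Q.gradNoise) := by
  have hmean : Measurable fun z : (EuclideanSpace ℝ (Fin d) × EuclideanSpace ℝ (Fin d)) × Z × Z' =>
      ⟪quadGrad Q.meanA Q.meanb z.1.1, z.1.1 - z.1.2⟫ := by
    unfold quadGrad
    fun_prop
  exact hmean.sub (hQ.measurable_inner_quadGrad (by fun_prop) (by fun_prop) measurable_snd)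

theorem integrable_inner_quadGrad (hQ : Q.HasFiniteMeans) (x h : EuclideanSpace ℝ (Fin d)) :
    Integrable (fun p => ⟪quadGrad (Q.A p.1) (Q.b p.2) x, h⟫) Q.μ := by
  simp only [inner_quadGrad]
  exact ((hQ.integrable_dotProduct _ _).add (hQ.integrable_dotProduct _ _)).add
    (hQ.integrable_inner_b h)

theorem integral_inner_quadGrad (hQ : Q.HasFiniteMeans) (x h : EuclideanSpace ℝ (Fin d)) :
    ∫ p, ⟪quadGrad (Q.A p.1) (Q.b p.2) x, h⟫ ∂Q.μ = ⟪quadGrad Q.meanA Q.meanb x, h⟫ := by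
  have hhx := hQ.integrable_dotProduct h.ofLp x.ofLp
  have hxh := hQ.integrable_dotProduct x.ofLp h.ofLp
  simp only [inner_quadGrad]
  rw [integral_add (by exact hhx.add hxh) (hQ.integrable_inner_b h), integral_add hhx hxh,
    hQ.integral_dotProduct, hQ.integral_dotProduct, hQ.integral_inner_b]

theorem integral_gradNoise (hQ : Q.HasFiniteMeans)
    (a : EuclideanSpace ℝ (Fin d) × EuclideanSpace ℝ (Fin d)) :
    ∫ p, Q.gradNoise a p ∂Q.μ = 0 := by
  have := hQ.isProbability
  simp only [gradNoise]
  rw [integral_sub (integrable_const _) (hQ.integrable_inner_quadGrad _ _),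
    hQ.integral_inner_quadGrad, integral_const, probReal_univ, one_smul, sub_self]

theorem ae_abs_gradNoise_le (hQ : Q.HasFiniteMeans) (hW : Convex ℝ Q.W) (hG : 0 ≤ G)
    (hL : Q.LossLipschitz G) {a : EuclideanSpace ℝ (Fin d) × EuclideanSpace ℝ (Fin d)}
    (h₁ : a.1 ∈ Q.W) (h₂ : a.2 ∈ Q.W) :
    ∀ᵐ p ∂Q.μ, |Q.gradNoise a p| ≤ 2 * (G * ‖a.1 - a.2‖) := by
  have hderiv {F : EuclideanSpace ℝ (Fin d) → ℝ} {F' : EuclideanSpace ℝ (Fin d)}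
      (hF : ∀ x ∈ Q.W, ∀ y ∈ Q.W, |F x - F y| ≤ G * ‖x - y‖) (hF' : HasGradientAt F F' a.1) :
      |⟪F', a.1 - a.2⟫| ≤ G * ‖a.1 - a.2‖ := by
    rw [← neg_sub, inner_neg_right, abs_neg, norm_neg]
    exact abs_inner_le_of_lipschitz hW hF hF' h₁ h₂
  have hrisk : HasGradientAt Q.risk (quadGrad Q.meanA Q.meanb a.1) a.1 := hasGradientAt_quad _ _ _ _
  filter_upwards [hL] with p hp
  rw [gradNoise, two_mul]
  exact (abs_sub _ _).trans (add_le_add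
    (hderiv (fun x hx y hy => hQ.abs_risk_sub_le hG hL hx hy) hrisk)
    (hderiv hp (hasGradientAt_loss _ _)))

end QuadProblem.HasFiniteMeans

/-- The recursion behind methods whose radii `r k` are halved in every stage: `e k` is the error
and `D k` the distance to the solution set after `k` stages, and a stage either starts within its
radius of the solution set or does not increase the error by much. -/
theorem error_le_or_le_of_halving {e D r : ℕ → ℝ} {α b : ℝ} {m : ℕ} (hα : 0 ≤ α) (hb : 0 ≤ b)
    (hr : ∀ k, 0 < r k) (hhalf : ∀ k, r k = 2 * r (k + 1)) (hD : ∀ k, D k ^ 2 ≤ α * e k)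
    (hD₀ : D 0 ≤ r 0)
    (hstep : ∀ k < m, (D k ≤ r k ∧ e (k + 1) ≤ b * r k) ∨
      (r k < D k ∧ e (k + 1) ≤ e k + b * r k)) :
    ∀ k < m, e (k + 1) ≤ b * r k ∨ e (k + 1) ≤ 8 * α * b ^ 2 - b * r k := by
  intro k
  induction k with
  | zero =>
    exact fun hm => (hstep 0 hm).imp And.right fun hfar => absurd hfar.1 hD₀.not_gt
  | succ k ih =>
    intro hkm
    obtain hnear | ⟨hfar, hstep⟩ := hstep (k + 1) hkm
    · exact .inl hnear.2
    have := mul_nonneg hb (hr (k + 1)).le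
    right
    obtain he | he := ih (by omega)
    all_goals rw [hhalf k] at he
    · have hsmall : r (k + 1) < 2 * α * b := by
        refine lt_of_mul_lt_mul_right ?_ (hr (k + 1)).le
        calc r (k + 1) * r (k + 1) = r (k + 1) ^ 2 := (sq _).symm
          _ < D (k + 1) ^ 2 := pow_lt_pow_left₀ hfar (hr (k + 1)).le two_ne_zero
          _ ≤ α * e (k + 1) := hD (k + 1)
          _ ≤ α * (b * (2 * r (k + 1))) := mul_le_mul_of_nonneg_left he hα
          _ = 2 * α * b * r (k + 1) := by ring
      linarith [mul_le_mul_of_nonneg_left hsmall.le hb]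
    · linarith

namespace QuadProblem

variable {d : ℕ} {Z : Type u} {Z' : Type v} [MeasurableSpace Z] [MeasurableSpace Z']
  {Q : QuadProblem d Z Z'} {G R₀ r : ℝ} {n₀ : ℕ} {x x₁ : EuclideanSpace ℝ (Fin d)}

theorem isClosest_proj_argminOn_risk (hc : IsClosed Q.W) (hne : (argminOn Q.risk Q.W).Nonempty)
    (x : EuclideanSpace ℝ (Fin d)) :
    IsClosest (argminOn Q.risk Q.W) x (proj (argminOn Q.risk Q.W) x) :=
  isClosest_proj (isClosed_argminOn (continuous_quad _ _ _) hc) hne x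

theorem sq_norm_sub_proj_argminOn_risk_le {α : ℝ} (hE : EBC Q.W Q.risk 1 α) (hc : IsClosed Q.W)
    (hx : x ∈ Q.W) :
    ‖x - proj (argminOn Q.risk Q.W) x‖ ^ 2 ≤ α * (Q.risk x - Q.optRisk) := by
  obtain ⟨y, hy, h⟩ := hE.2.2.2 x hx
  rw [Real.rpow_one, ← optRisk_eq hy.1] at h
  have hproj := isClosest_proj_argminOn_risk hc ⟨y, hy.1⟩ x
  exact (pow_le_pow_left₀ (norm_nonneg _) (hproj.2 y hy.1) 2).trans h

/-- The point with which the output of a stage started at `x` with radius `r` is compared: the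
minimizer of the risk closest to `x` if the stage can reach it, and `x` otherwise. -/
noncomputable def stageComparator (Q : QuadProblem d Z Z') (r : ℝ)
    (x : EuclideanSpace ℝ (Fin d)) : EuclideanSpace ℝ (Fin d) :=
  open Classical in
  if ‖x - proj (argminOn Q.risk Q.W) x‖ ≤ r then proj (argminOn Q.risk Q.W) x else x

theorem stageComparator_mem (hc : IsClosed Q.W) (hne : (argminOn Q.risk Q.W).Nonempty)
    (hr : 0 ≤ r) (hx : x ∈ Q.W) : Q.stageComparator r x ∈ Q.W ∩ Metric.closedBall x r := by
  rw [stageComparator]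
  split_ifs with hnear
  · exact ⟨(isClosest_proj_argminOn_risk hc hne x).1.1,
      mem_closedBall_iff_norm'.2 hnear⟩
  · exact ⟨hx, Metric.mem_closedBall_self hr⟩

theorem measurable_stageComparator (hA : Q.meanA.PosSemidef) (hc : IsClosed Q.W)
    (hW : Convex ℝ Q.W) (hne : (argminOn Q.risk Q.W).Nonempty) (r : ℝ) :
    Measurable (Q.stageComparator r) := by
  have hproj : Continuous (proj (argminOn Q.risk Q.W)) :=
    continuous_proj (isClosed_argminOn (continuous_quad _ _ _) hc)
      (convex_argminOn (convexOn_quad hA hW)) hne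
  unfold stageComparator
  exact .ite (isClosed_le (by fun_prop) continuous_const).measurableSet hproj.measurable
    measurable_id

/-- The iterate number `t + 1` of the stage `k + 1` of ASA. -/
noncomputable def asaIter (Q : QuadProblem d Z Z') (G R₀ : ℝ) (n₀ : ℕ)
    (x₁ : EuclideanSpace ℝ (Fin d)) (s : ℕ → Z × Z') (k t : ℕ) : EuclideanSpace ℝ (Fin d) :=
  Q.ssgIter (Q.W ∩ Metric.closedBall (Q.asaStage G R₀ n₀ x₁ s k) (R₀ / 2 ^ k))
    (R₀ / 2 ^ k / (G * √((n₀ : ℝ) + 1))) (Q.asaStage G R₀ n₀ x₁ s k)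
    (fun i => s (k * n₀ + i)) t

theorem asaStage_succ_mem (hc : IsClosed Q.W) (hW : Convex ℝ Q.W) (hR₀ : 0 ≤ R₀)
    {s : ℕ → Z × Z'} {k : ℕ} (hk : Q.asaStage G R₀ n₀ x₁ s k ∈ Q.W) :
    Q.asaStage G R₀ n₀ x₁ s (k + 1)
      ∈ Q.W ∩ Metric.closedBall (Q.asaStage G R₀ n₀ x₁ s k) (R₀ / 2 ^ k) :=
  ssg_mem (hc.inter Metric.isClosed_closedBall) (hW.inter (convex_closedBall _ _))
    ⟨hk, Metric.mem_closedBall_self (by positivity)⟩ _ _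

theorem asaStage_mem (hc : IsClosed Q.W) (hW : Convex ℝ Q.W) (hR₀ : 0 ≤ R₀) (hx₁ : x₁ ∈ Q.W)
    (s : ℕ → Z × Z') (k : ℕ) : Q.asaStage G R₀ n₀ x₁ s k ∈ Q.W := by
  induction k with
  | zero => exact hx₁
  | succ k ih => exact (asaStage_succ_mem hc hW hR₀ ih).1

theorem asaStage_of_radius_eq_zero (hc : IsClosed Q.W) (hW : Convex ℝ Q.W) (hx₁ : x₁ ∈ Q.W)
    (s : ℕ → Z × Z') (k : ℕ) : Q.asaStage G 0 n₀ x₁ s k = x₁ := by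
  induction k with
  | zero => rfl
  | succ k ih =>
    have h := (asaStage_succ_mem (G := G) (n₀ := n₀) hc hW le_rfl
      (asaStage_mem hc hW le_rfl hx₁ s k)).2
    rwa [zero_div, Metric.closedBall_zero, Set.mem_singleton_iff, ih] at h

theorem asaIter_mem (hc : IsClosed Q.W) (hW : Convex ℝ Q.W) (hR₀ : 0 ≤ R₀) (hx₁ : x₁ ∈ Q.W)
    (s : ℕ → Z × Z') (k t : ℕ) :
    Q.asaIter G R₀ n₀ x₁ s k t
      ∈ Q.W ∩ Metric.closedBall (Q.asaStage G R₀ n₀ x₁ s k) (R₀ / 2 ^ k) :=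
  ssgIter_mem (hc.inter Metric.isClosed_closedBall)
    ⟨asaStage_mem hc hW hR₀ hx₁ s k, Metric.mem_closedBall_self (by positivity)⟩ _ t

section Measurability

variable {Ω : Type w} {ξ : ℕ → Ω → Z × Z'}

theorem measurable_ssgIter (hQ : Q.HasFiniteMeans) (hc : IsClosed Q.W) (hW : Convex ℝ Q.W)
    (hne : Q.W.Nonempty) (γ : ℝ) (hr : 0 < r) {x : Ω → EuclideanSpace ℝ (Fin d)}
    (hxW : ∀ ω, x ω ∈ Q.W) {s : ℕ} (hx : Measurable[samplePast ξ s] x) (t : ℕ) :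
    Measurable[samplePast ξ (s + t)] fun ω =>
      Q.ssgIter (Q.W ∩ Metric.closedBall (x ω) r) γ (x ω) (fun i => ξ (s + i) ω) t := by
  induction t with
  | zero => exact hx
  | succ t ih =>
    have hstep : Continuous fun a : EuclideanSpace ℝ (Fin d) × EuclideanSpace ℝ (Fin d) =>
        proj (Q.W ∩ Metric.closedBall (proj Q.W a.1) r) a.2 :=
      continuous_proj_inter_closedBall hc hW hr ((continuous_proj hc hW hne).comp continuous_fst)
        (fun _ => (isClosest_proj hc hne _).1) continuous_snd
    have hx' : Measurable[samplePast ξ (s + (t + 1))] x :=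
      hx.mono (samplePast_mono ξ (by omega)) le_rfl
    have hu := ih.mono (samplePast_mono ξ (show s + t ≤ s + (t + 1) by omega)) le_rfl
    have hξ : Measurable[samplePast ξ (s + (t + 1))] (ξ (s + t)) :=
      measurable_samplePast ξ (by omega)
    have hg := (hQ.measurable_quadGrad measurable_fst measurable_snd).comp (hu.prodMk hξ)
    convert hstep.measurable.comp (hx'.prodMk (hu.sub (hg.const_smul γ))) using 1
    funext ω
    simp only [Function.comp_apply, proj_eq_self (hxW ω), ssgIter,
      (hasGradientAt_loss _ _).gradient, Pi.sub_apply, Pi.smul_apply]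

theorem measurable_asaStage (hQ : Q.HasFiniteMeans) (hc : IsClosed Q.W) (hW : Convex ℝ Q.W)
    (hR₀ : 0 < R₀) (hx₁ : x₁ ∈ Q.W) (k : ℕ) :
    Measurable[samplePast ξ (k * n₀)] fun ω => Q.asaStage G R₀ n₀ x₁ (fun i => ξ i ω) k := by
  induction k with
  | zero => exact measurable_const
  | succ k ih =>
    have hiter (t : ℕ) (ht : t ∈ Finset.range (n₀ + 1)) : Measurable[samplePast ξ ((k + 1) * n₀)]
        fun ω => Q.asaIter G R₀ n₀ x₁ (fun i => ξ i ω) k t := by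
      refine (measurable_ssgIter hQ hc hW ⟨x₁, hx₁⟩ _ (by positivity)
        (fun ω => asaStage_mem hc hW hR₀.le hx₁ (fun i => ξ i ω) k) ih t).mono
        (samplePast_mono ξ ?_) le_rfl
      rw [Nat.succ_mul]
      exact Nat.add_le_add_left (Finset.mem_range_succ_iff.1 ht) _
    exact (Finset.measurable_fun_sum (m := samplePast ξ ((k + 1) * n₀)) _ hiter).const_smul
      (1 / ((n₀ : ℝ) + 1))

theorem measurable_asaIter (hQ : Q.HasFiniteMeans) (hc : IsClosed Q.W) (hW : Convex ℝ Q.W)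
    (hR₀ : 0 < R₀) (hx₁ : x₁ ∈ Q.W) (k t : ℕ) :
    Measurable[samplePast ξ (k * n₀ + t)]
      fun ω => Q.asaIter G R₀ n₀ x₁ (fun i => ξ i ω) k t :=
  measurable_ssgIter hQ hc hW ⟨x₁, hx₁⟩ _ (by positivity)
    (fun ω => asaStage_mem hc hW hR₀.le hx₁ (fun i => ξ i ω) k)
    (measurable_asaStage hQ hc hW hR₀ hx₁ k) t

end Measurability

/-- The gradient noise accumulated in the stage `k + 1` of ASA. -/
noncomputable def stageNoise (Q : QuadProblem d Z Z') (G R₀ : ℝ) (n₀ : ℕ)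
    (x₁ : EuclideanSpace ℝ (Fin d)) (s : ℕ → Z × Z') (k : ℕ) : ℝ :=
  ∑ t ∈ Finset.range n₀, Q.gradNoise (Q.asaIter G R₀ n₀ x₁ s k t,
    Q.stageComparator (R₀ / 2 ^ k) (Q.asaStage G R₀ n₀ x₁ s k)) (s (k * n₀ + t))

theorem withHighProb_stageNoise_le (hQ : Q.HasFiniteMeans) (hA : Q.meanA.PosSemidef)
    (hc : IsClosed Q.W) (hW : Convex ℝ Q.W) (hne : (argminOn Q.risk Q.W).Nonempty) (hR₀ : 0 < R₀)
    (hG : 0 < G) (hL : Q.LossLipschitz G) (hx₁ : x₁ ∈ Q.W) {Ω : Type w} [MeasurableSpace Ω]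
    {Pr : Measure Ω} {ξ : ℕ → Ω → Z × Z'} (hξ : IsIIDSample Pr Q.μ ξ) {ℓ : ℝ} (hℓ : 0 ≤ ℓ)
    (k : ℕ) :
    WithHighProb Pr (Real.exp (-ℓ)) fun ω => Q.stageNoise G R₀ n₀ x₁ (fun i => ξ i ω) k
      ≤ 4 * (G * (R₀ / 2 ^ k)) * √(2 * (n₀ * ℓ)) := by
  have hr : 0 < R₀ / 2 ^ k := by positivity
  have hmem (ω : Ω) := asaStage_mem (G := G) (n₀ := n₀) hc hW hR₀.le hx₁ (fun i => ξ i ω) k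
  refine hξ.withHighProb_sum_le hQ.measurable_gradNoise (by positivity)
    (T := {a | a.1 ∈ Q.W ∧ a.2 ∈ Q.W ∧ ‖a.1 - a.2‖ ≤ 2 * (R₀ / 2 ^ k)}) ?_
    (fun a _ => hQ.integral_gradNoise a) (fun t => ?_) (fun t ω => ?_) n₀ hℓ
  · rintro a ⟨h₁, h₂, hdist⟩
    filter_upwards [hQ.ae_abs_gradNoise_le hW hG.le hL h₁ h₂] with p hp
    linarith [mul_le_mul_of_nonneg_left hdist hG.le]
  · exact (measurable_asaIter hQ hc hW hR₀ hx₁ k t).prodMk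
      ((measurable_stageComparator hA hc hW hne _).comp ((measurable_asaStage hQ hc hW hR₀ hx₁
        k).mono (samplePast_mono ξ (Nat.le_add_right _ t)) le_rfl))
  · have hiter := asaIter_mem (G := G) (n₀ := n₀) hc hW hR₀.le hx₁ (fun i => ξ i ω) k t
    have hcomp := stageComparator_mem hc hne hr.le (hmem ω)
    exact ⟨hiter.1, hcomp.1, norm_sub_le_two_mul_of_mem_closedBall hiter.2 hcomp.2⟩

theorem risk_asaStage_succ_sub_le (hQ : Q.HasFiniteMeans) (hA : Q.meanA.PosSemidef)
    (hc : IsClosed Q.W) (hW : Convex ℝ Q.W) (hne : (argminOn Q.risk Q.W).Nonempty) (hR₀ : 0 < R₀)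
    (hG : 0 < G) (hL : Q.LossLipschitz G) (hx₁ : x₁ ∈ Q.W) {s : ℕ → Z × Z'}
    (hs : ∀ t, ∀ x ∈ Q.W, ∀ y ∈ Q.W, |Q.loss x (s t) - Q.loss y (s t)| ≤ G * ‖x - y‖) {ℓ : ℝ}
    (hℓ : 1 ≤ ℓ) {k : ℕ}
    (hnoise : Q.stageNoise G R₀ n₀ x₁ s k ≤ 4 * (G * (R₀ / 2 ^ k)) * √(2 * (n₀ * ℓ))) :
    Q.risk (Q.asaStage G R₀ n₀ x₁ s (k + 1))
      - Q.risk (Q.stageComparator (R₀ / 2 ^ k) (Q.asaStage G R₀ n₀ x₁ s k))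
      ≤ 9 * G * √(ℓ / (n₀ + 1)) * (R₀ / 2 ^ k) := by
  have hr : 0 < R₀ / 2 ^ k := by positivity
  have hmem := asaStage_mem (G := G) (n₀ := n₀) hc hW hR₀.le hx₁ s k
  have hstage := (hQ.risk_ssg_sub_le hA hc hW hr hG hL hmem rfl
    (stageComparator_mem hc hne hr.le hmem) (s := fun t => s (k * n₀ + t)) (fun t => hs _) n₀
    rfl).trans (add_le_add_right hnoise _)
  set r := R₀ / 2 ^ k
  have hq : 0 < √((n₀ : ℝ) + 1) := Real.sqrt_pos.2 (by positivity)
  have hq2 : √((n₀ : ℝ) + 1) ^ 2 = n₀ + 1 := Real.sq_sqrt (by positivity)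
  have hsqrt : √(2 * (n₀ * ℓ)) ≤ 3 / 2 * (√((n₀ : ℝ) + 1) * √ℓ) := by
    refine Real.sqrt_le_iff.2 ⟨by positivity, ?_⟩
    rw [mul_pow, mul_pow, hq2, Real.sq_sqrt (by positivity)]
    have : 0 ≤ (n₀ : ℝ) * ℓ := by positivity
    linarith
  refine le_of_mul_le_mul_left (hstage.trans ?_) (by positivity : (0 : ℝ) < n₀ + 1)
  rw [Real.sqrt_div (by positivity)]
  set q := √((n₀ : ℝ) + 1)
  calc 3 * (G * r * q) + 4 * (G * r) * √(2 * (n₀ * ℓ))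
      ≤ 3 * (G * r * q) * √ℓ + 4 * (G * r) * (3 / 2 * (q * √ℓ)) :=
        add_le_add (le_mul_of_one_le_right (by positivity) (Real.one_le_sqrt.2 hℓ)) (by gcongr)
    _ = q ^ 2 * (9 * G * (√ℓ / q) * r) := by
        field_simp
        ring
    _ = _ := by rw [hq2]

theorem risk_asaStage_sub_optRisk_le (hQ : Q.HasFiniteMeans) (hA : Q.meanA.PosSemidef)
    (hc : IsClosed Q.W) (hW : Convex ℝ Q.W) {α : ℝ} (hE : EBC Q.W Q.risk 1 α) (hR₀ : 0 < R₀)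
    (hG : 0 < G) (hL : Q.LossLipschitz G) {xs : EuclideanSpace ℝ (Fin d)} (hx₁ : x₁ ∈ Q.W)
    (hxs : xs ∈ argminOn Q.risk Q.W) (hdist : ‖x₁ - xs‖ ≤ R₀) {s : ℕ → Z × Z'}
    (hs : ∀ t, ∀ x ∈ Q.W, ∀ y ∈ Q.W, |Q.loss x (s t) - Q.loss y (s t)| ≤ G * ‖x - y‖) {ℓ : ℝ}
    (hℓ : 1 ≤ ℓ) {m : ℕ}
    (hnoise : ∀ k < m, Q.stageNoise G R₀ n₀ x₁ s k ≤ 4 * (G * (R₀ / 2 ^ k)) * √(2 * (n₀ * ℓ)))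
    {k : ℕ} (hk : k < m) :
    Q.risk (Q.asaStage G R₀ n₀ x₁ s (k + 1)) - Q.optRisk
        ≤ 9 * G * √(ℓ / (n₀ + 1)) * (R₀ / 2 ^ k) ∨
      Q.risk (Q.asaStage G R₀ n₀ x₁ s (k + 1)) - Q.optRisk
        ≤ 8 * α * (9 * G * √(ℓ / (n₀ + 1))) ^ 2 := by
  have hclosest := isClosest_proj_argminOn_risk hc ⟨xs, hxs⟩
  have hrec := error_le_or_le_of_halving (m := m) (r := fun k => R₀ / 2 ^ k)
    (b := 9 * G * √(ℓ / (n₀ + 1))) (e := fun k => Q.risk (Q.asaStage G R₀ n₀ x₁ s k) - Q.optRisk)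
    (D := fun k => ‖Q.asaStage G R₀ n₀ x₁ s k
      - proj (argminOn Q.risk Q.W) (Q.asaStage G R₀ n₀ x₁ s k)‖)
    hE.2.2.1.le (by positivity) (fun _ => by positivity) (fun _ => by rw [pow_succ]; field_simp)
    (fun k => sq_norm_sub_proj_argminOn_risk_le hE hc (asaStage_mem hc hW hR₀.le hx₁ s k))
    (by simpa [asaStage] using ((hclosest x₁).2 xs hxs).trans hdist) fun k hk => ?_
  · refine (hrec k hk).imp_right fun h => h.trans (sub_le_self _ (by positivity))
  · have h := risk_asaStage_succ_sub_le hQ hA hc hW ⟨xs, hxs⟩ hR₀ hG hL hx₁ hs hℓ (hnoise k hk)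
    rw [stageComparator] at h
    split_ifs at h with hnear
    · exact .inl ⟨hnear, (optRisk_eq (hclosest _).1).symm ▸ h⟩
    · exact .inr ⟨not_le.1 hnear, by linarith⟩

end QuadProblem

section NumStages

theorem three_le_log {x : ℝ} (hx : 100 ≤ x) : 3 ≤ Real.log x := by
  rw [Real.le_log_iff_exp_le (by linarith)]
  calc Real.exp 3 = Real.exp 1 ^ 3 := by rw [← Real.exp_nat_mul]; norm_num
    _ ≤ 2.72 ^ 3 := pow_le_pow_left₀ (Real.exp_pos 1).le (by linarith [Real.exp_one_lt_d9]) 3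
    _ ≤ x := by linarith

theorem log_le_two_add_div {x : ℝ} (hx : 0 < x) : Real.log x ≤ 2 + x / 20 := by
  have hexp : 20 ≤ Real.exp 3 := by
    calc (20 : ℝ) ≤ 2.718 ^ 3 := by norm_num
      _ ≤ Real.exp 1 ^ 3 := pow_le_pow_left₀ (by norm_num) (by linarith [Real.exp_one_gt_d9]) 3
      _ = Real.exp 3 := by rw [← Real.exp_nat_mul]; norm_num
  have htangent := Real.log_le_sub_one_of_pos (div_pos hx (Real.exp_pos 3))
  rw [Real.log_div hx.ne' (Real.exp_ne_zero 3), Real.log_exp] at htangent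
  have : x / Real.exp 3 ≤ x / 20 := by gcongr
  linarith

theorem two_mul_div_logb_two (x : ℝ) :
    2 * x / Real.logb 2 x = 2 * Real.log 2 * x / Real.log x := by
  rw [Real.logb, div_div_eq_mul_div, mul_right_comm]

theorem sixteen_le_two_mul_div_logb_two {x : ℝ} (hx : 100 ≤ x) :
    16 ≤ 2 * x / Real.logb 2 x := by
  rw [two_mul_div_logb_two, le_div_iff₀ (by linarith [three_le_log hx])]
  calc 16 * Real.log x ≤ 16 * (2 + x / 20) := by gcongr; exact log_le_two_add_div (by linarith)
    _ ≤ 2 * 0.69 * x := by linarith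
    _ ≤ 2 * Real.log 2 * x := by gcongr; linarith [Real.log_two_gt_d9]

theorem two_mul_div_logb_two_le {x : ℝ} (hx : 100 ≤ x) : 2 * x / Real.logb 2 x ≤ x := by
  have hlog := three_le_log hx
  rw [two_mul_div_logb_two, div_le_iff₀ (by linarith), mul_comm]
  gcongr
  linarith [Real.log_two_lt_d9]

theorem div_log_le_two_mul_div_logb_two {x : ℝ} (hx : 1 ≤ x) :
    x / Real.log x ≤ 2 * x / Real.logb 2 x := by
  rw [two_mul_div_logb_two]
  have := Real.log_nonneg hx
  gcongr
  exact le_mul_of_one_le_left (by linarith) (by linarith [Real.log_two_gt_d9])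

variable {n : ℕ}

theorem two_le_half_mul_logb (hn : 100 ≤ n) :
    2 ≤ 1 / 2 * Real.logb 2 (2 * n / Real.logb 2 n) := by
  have hq := sixteen_le_two_mul_div_logb_two (x := n) (by exact_mod_cast hn)
  have : 4 ≤ Real.logb 2 (2 * n / Real.logb 2 n) := by
    rw [Real.le_logb_iff_rpow_le one_lt_two (by linarith)]
    norm_num
    exact hq
  linarith

theorem asaNumStages_pos (hn : 100 ≤ n) : 0 < asaNumStages n :=
  Nat.sub_pos_of_lt (Nat.le_floor (two_le_half_mul_logb hn))

theorem asaNumStages_le_log (hn : 100 ≤ n) : asaNumStages n ≤ Real.log n := by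
  have hn' : (100 : ℝ) ≤ n := by exact_mod_cast hn
  have hq := sixteen_le_two_mul_div_logb_two hn'
  have hlogq := Real.log_le_log (by linarith) (two_mul_div_logb_two_le hn')
  have hlogb : Real.logb 2 (2 * n / Real.logb 2 n) ≤ 2 * Real.log n := by
    rw [Real.logb, div_le_iff₀ (Real.log_pos one_lt_two)]
    nlinarith [Real.log_two_gt_d9, three_le_log hn']
  calc (asaNumStages n : ℝ) ≤ ⌊1 / 2 * Real.logb 2 (2 * n / Real.logb 2 n)⌋₊ :=
        Nat.cast_le.2 (Nat.sub_le _ 1)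
    _ ≤ 1 / 2 * Real.logb 2 (2 * n / Real.logb 2 n) :=
        Nat.floor_le (by linarith [two_le_half_mul_logb hn])
    _ ≤ Real.log n := by linarith

theorem sqrt_le_eight_mul_two_pow_asaNumStages (hn : 100 ≤ n) :
    √(2 * n / Real.logb 2 n) ≤ 8 * 2 ^ (asaNumStages n - 1) := by
  have hx := two_le_half_mul_logb hn
  have hq := sixteen_le_two_mul_div_logb_two (x := n) (by exact_mod_cast hn)
  set q := 2 * n / Real.logb 2 n
  set x := 1 / 2 * Real.logb 2 q with hxdef
  have hfloor : x ≤ 3 + (asaNumStages n - 1 : ℕ) := by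
    have hm : ⌊x⌋₊ = 2 + (asaNumStages n - 1) := by
      have := asaNumStages_pos hn
      change 0 < ⌊x⌋₊ - 1 at this
      change _ = 2 + (⌊x⌋₊ - 1 - 1)
      omega
    have hlt := Nat.lt_floor_add_one x
    rw [hm] at hlt
    push_cast at hlt
    linarith
  calc √q = 2 ^ x := by
        rw [hxdef, mul_comm, Real.rpow_mul two_pos.le, Real.rpow_logb two_pos (by norm_num)
          (by linarith), Real.sqrt_eq_rpow]
    _ ≤ 2 ^ ((3 : ℝ) + (asaNumStages n - 1 : ℕ)) :=
        Real.rpow_le_rpow_of_exponent_le one_le_two hfloor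
    _ = 8 * 2 ^ (asaNumStages n - 1) := by
        rw [Real.rpow_add two_pos, Real.rpow_natCast]
        norm_num

theorem one_div_two_pow_asaNumStages_le (hn : 100 ≤ n) :
    1 / 2 ^ (asaNumStages n - 1) ≤ 8 * √(Real.log n / n) := by
  have hn' : (100 : ℝ) ≤ n := by exact_mod_cast hn
  have hpos : 0 < √(n / Real.log n) :=
    Real.sqrt_pos.2 (div_pos (by linarith) (by linarith [three_le_log hn']))
  have hle := (Real.sqrt_le_sqrt (div_log_le_two_mul_div_logb_two (by linarith))).trans
    (sqrt_le_eight_mul_two_pow_asaNumStages hn)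
  rw [← inv_div (n : ℝ) (Real.log n), Real.sqrt_inv, ← div_eq_mul_inv,
    div_le_div_iff₀ (by positivity) hpos, one_mul]
  exact hle

end NumStages

section ASARate

variable {n : ℕ} {ℓ : ℝ}

theorem one_le_log_log_div (hn : 100 ≤ n) {δ : ℝ} (hδ : 0 < δ) (hδ1 : δ ≤ 1) :
    1 ≤ Real.log (Real.log n / δ) := by
  have hlog := three_le_log (x := n) (by exact_mod_cast hn)
  rw [Real.le_log_iff_exp_le (by positivity), le_div_iff₀ hδ]
  calc Real.exp 1 * δ ≤ Real.exp 1 := mul_le_of_le_one_right (Real.exp_pos 1).le hδ1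
    _ ≤ Real.log n := by linarith [Real.exp_one_lt_d9]

theorem div_asaStageLength_le (hn : 100 ≤ n) (hℓ : 0 ≤ ℓ) :
    ℓ / ((n / asaNumStages n : ℕ) + 1) ≤ Real.log n * ℓ / n := by
  have hm := asaNumStages_pos hn
  have hcover : (n : ℝ) ≤ asaNumStages n * ((n / asaNumStages n : ℕ) + 1) := by
    have := Nat.lt_div_mul_add (a := n) hm
    exact_mod_cast (by linarith : n ≤ asaNumStages n * (n / asaNumStages n + 1))
  rw [div_le_div_iff₀ (by positivity) (by positivity)]
  calc ℓ * n ≤ ℓ * (asaNumStages n * ((n / asaNumStages n : ℕ) + 1)) := by gcongr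
    _ ≤ ℓ * (Real.log n * ((n / asaNumStages n : ℕ) + 1)) := by
      gcongr
      exact asaNumStages_le_log hn
    _ = Real.log n * ℓ * ((n / asaNumStages n : ℕ) + 1) := by ring

theorem sqrt_div_asaStageLength_mul_le (hn : 100 ≤ n) (hℓ : 1 ≤ ℓ) :
    √(ℓ / ((n / asaNumStages n : ℕ) + 1)) * (1 / 2 ^ (asaNumStages n - 1))
      ≤ 8 * (Real.log n * ℓ / n) := by
  have hlog := three_le_log (x := n) (by exact_mod_cast hn)
  have hpow : 1 / 2 ^ (asaNumStages n - 1) ≤ 8 * √(Real.log n * ℓ / n) := by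
    refine (one_div_two_pow_asaNumStages_le hn).trans ?_
    gcongr
    exact le_mul_of_one_le_right (by linarith) hℓ
  calc √(ℓ / ((n / asaNumStages n : ℕ) + 1)) * (1 / 2 ^ (asaNumStages n - 1))
      ≤ √(Real.log n * ℓ / n) * (8 * √(Real.log n * ℓ / n)) :=
        mul_le_mul (Real.sqrt_le_sqrt (div_asaStageLength_le hn (by linarith))) hpow
          (by positivity) (by positivity)
    _ = 8 * (Real.log n * ℓ / n) := by
        rw [mul_left_comm, Real.mul_self_sqrt (by positivity)]

theorem asaStage_bound_le_rate (hn : 100 ≤ n) (hℓ : 1 ≤ ℓ) {α G R₀ E : ℝ} (hα : 0 ≤ α)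
    (hG : 0 ≤ G) (hR₀ : 0 ≤ R₀)
    (hE : E ≤ 9 * G * √(ℓ / ((n / asaNumStages n : ℕ) + 1)) * (R₀ / 2 ^ (asaNumStages n - 1)) ∨
      E ≤ 8 * α * (9 * G * √(ℓ / ((n / asaNumStages n : ℕ) + 1))) ^ 2) :
    E ≤ 648 * (max (α * G ^ 2) (R₀ * G) * (Real.log n * ℓ) / n) := by
  have hlog := three_le_log (x := n) (by exact_mod_cast hn)
  set n₀ := n / asaNumStages n
  set k := asaNumStages n - 1
  rw [mul_div_assoc]
  rcases hE with hE | hE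
  · calc E ≤ 9 * (R₀ * G) * (√(ℓ / (n₀ + 1)) * (1 / 2 ^ k)) := hE.trans_eq (by ring)
      _ ≤ 9 * (R₀ * G) * (8 * (Real.log n * ℓ / n)) :=
        mul_le_mul_of_nonneg_left (sqrt_div_asaStageLength_mul_le hn hℓ) (by positivity)
      _ = 72 * (R₀ * G * (Real.log n * ℓ / n)) := by ring
      _ ≤ 648 * (max (α * G ^ 2) (R₀ * G) * (Real.log n * ℓ / n)) := by
        gcongr
        · norm_num
        · exact le_max_right _ _
  · have hsq : √(ℓ / (n₀ + 1)) ^ 2 ≤ Real.log n * ℓ / n :=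
      (Real.sq_sqrt (by positivity)).trans_le (div_asaStageLength_le hn (by linarith))
    calc E ≤ 648 * (α * G ^ 2 * √(ℓ / (n₀ + 1)) ^ 2) := hE.trans_eq (by ring)
      _ ≤ 648 * (max (α * G ^ 2) (R₀ * G) * (Real.log n * ℓ / n)) := by
        gcongr
        exact le_max_left _ _

end ASARate

namespace QuadProblem

variable {d : ℕ} {Z : Type u} {Z' : Type v} [MeasurableSpace Z] [MeasurableSpace Z']
  {Q : QuadProblem d Z Z'} {α G R₀ : ℝ} {x₁ xs : EuclideanSpace ℝ (Fin d)} {n : ℕ}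

theorem risk_asa_sub_optRisk_of_radius_eq_zero (hc : IsClosed Q.W) (hW : Convex ℝ Q.W)
    (hx₁ : x₁ ∈ argminOn Q.risk Q.W) (s : ℕ → Z × Z') :
    Q.risk (Q.asa G x₁ n 0 s) - Q.optRisk = 0 := by
  rw [asa, asaStage_of_radius_eq_zero hc hW hx₁.1, optRisk_eq hx₁, sub_self]

theorem withHighProb_risk_asa_le_of_pos (hQ : Q.HasFiniteMeans) (hA : Q.meanA.PosSemidef)
    (hc : IsClosed Q.W) (hW : Convex ℝ Q.W) (hE : EBC Q.W Q.risk 1 α) (hG : 0 < G)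
    (hL : Q.LossLipschitz G) (hx₁ : x₁ ∈ Q.W) (hxs : xs ∈ argminOn Q.risk Q.W)
    (hdist : ‖x₁ - xs‖ ≤ R₀) (hR₀ : 0 < R₀) {Ω : Type w} [MeasurableSpace Ω] {Pr : Measure Ω}
    {ξ : ℕ → Ω → Z × Z'} (hξ : IsIIDSample Pr Q.μ ξ) (hn : 100 ≤ n) {δ : ℝ} (hδ : 0 < δ)
    (hδ1 : δ ≤ 1) :
    WithHighProb Pr δ fun ω => Q.risk (Q.asa G x₁ n R₀ fun i => ξ i ω) - Q.optRisk
      ≤ 648 * (max (α * G ^ 2) (R₀ * G) * (Real.log n * Real.log (Real.log n / δ)) / n) := by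
  have hlog := three_le_log (x := n) (by exact_mod_cast hn)
  have hℓ := one_le_log_log_div hn hδ hδ1
  have hexp : Real.exp (-Real.log (Real.log n / δ)) = δ / Real.log n := by
    rw [Real.exp_neg, Real.exp_log (by positivity), inv_div]
  set ℓ := Real.log (Real.log n / δ)
  set m := asaNumStages n
  have hm0 : 0 < m := asaNumStages_pos hn
  refine WithHighProb.of_forall_mem (V := Finset.range m) (fun k _ =>
    withHighProb_stageNoise_le (n₀ := n / m) hQ hA hc hW ⟨xs, hxs⟩ hR₀ hG hL hx₁ hξ
      (zero_le_one.trans hℓ) k) ?_ ?_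
  · rw [hexp, Finset.card_range, mul_div_left_comm]
    exact mul_le_of_le_one_right hδ.le
      ((div_le_one (by linarith)).2 (asaNumStages_le_log hn))
  · filter_upwards [hξ.ae_forall hL] with ω hlip hnoise
    have hstage := risk_asaStage_sub_optRisk_le hQ hA hc hW hE hR₀ hG hL hx₁ hxs hdist hlip hℓ
      (fun k hk => hnoise k (Finset.mem_range.2 hk)) (Nat.sub_one_lt_of_lt hm0)
    rw [Nat.sub_add_cancel hm0] at hstage
    exact asaStage_bound_le_rate hn hℓ hE.2.2.1.le hG.le hR₀.le hstage

theorem withHighProb_risk_asa_le (hQ : Q.HasFiniteMeans) (hA : Q.meanA.PosSemidef)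
    (hc : IsClosed Q.W) (hW : Convex ℝ Q.W) (hE : EBC Q.W Q.risk 1 α) (hG : 0 < G)
    (hL : Q.LossLipschitz G) (hx₁ : x₁ ∈ Q.W) (hxs : xs ∈ argminOn Q.risk Q.W)
    (hdist : ‖x₁ - xs‖ ≤ R₀) {Ω : Type w} [MeasurableSpace Ω] {Pr : Measure Ω}
    {ξ : ℕ → Ω → Z × Z'} (hξ : IsIIDSample Pr Q.μ ξ) (hn : 100 ≤ n) {δ : ℝ} (hδ : 0 < δ)
    (hδ1 : δ ≤ 1) :
    WithHighProb Pr δ fun ω => Q.risk (Q.asa G x₁ n R₀ fun i => ξ i ω) - Q.optRisk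
      ≤ 648 * (max (α * G ^ 2) (R₀ * G) * (Real.log n * Real.log (Real.log n / δ)) / n) := by
  rcases ((norm_nonneg _).trans hdist).eq_or_lt with rfl | hR₀
  · obtain rfl := sub_eq_zero.1 (norm_le_zero_iff.1 hdist)
    refine WithHighProb.of_forall fun ω => ?_
    rw [risk_asa_sub_optRisk_of_radius_eq_zero hc hW hxs]
    have := one_le_log_log_div hn hδ hδ1
    have := hE.2.2.1
    positivity
  · exact withHighProb_risk_asa_le_of_pos hQ hA hc hW hE hG hL hx₁ hxs hdist hR₀ hξ hn hδ hδ1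

end QuadProblem

theorem corollary1_general :
    (∀ (d : ℕ) (Z : Type u) (Z' : Type v) [MeasurableSpace Z] [MeasurableSpace Z']
        (Q : QuadProblem d Z Z'), Q.Standing → ∃ α : ℝ, EBC Q.W Q.risk 1 α) ∧
    (∀ α G R : ℝ, ∃ C : ℝ, 0 < C ∧
      ∀ (d : ℕ) (Z : Type u) (Z' : Type v) [MeasurableSpace Z] [MeasurableSpace Z']
        (Q : QuadProblem d Z Z'), Q.HasFiniteMeans → EBC Q.W Q.risk 1 α →
        (∀ x ∈ Q.W, ‖x‖ ≤ R) → Q.LossLipschitz G →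
        QuadProblem.ERMRate.{u, v, w} Q (fun n => 2 ≤ n)
          (fun n δ => C * ((d * Real.log n + Real.log (1 / δ)) / n))) ∧
    (∀ α σ R : ℝ, ∃ C : ℝ, 0 < C ∧
      ∀ (d : ℕ) (Z : Type u) (Z' : Type v) [MeasurableSpace Z] [MeasurableSpace Z']
        (Q : QuadProblem d Z Z'), Q.HasFiniteMeans → EBC Q.W Q.risk 1 α →
        (∀ x ∈ Q.W, ‖x‖ ≤ R) → Q.BoundedBy σ → (∀ᵐ p ∂Q.μ, ∀ x, 0 ≤ Q.loss x p) →
        QuadProblem.ERMRate.{u, v, w} Q (fun n => 2 ≤ n)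
          (fun n δ => C * (((d * Real.log n + Real.log (1 / δ)) / n) ^ 2
            + (d * Real.log n + Real.log (1 / δ)) * Q.optRisk / n))) ∧
    (∀ α G R P : ℝ, ∃ C : ℝ, 0 < C ∧
      ∀ (d : ℕ) (Z : Type u) (Z' : Type v) [MeasurableSpace Z] [MeasurableSpace Z']
        (Q : QuadProblem d Z Z'), Q.HasFiniteMeans → EBC Q.W Q.risk 1 α →
        (∀ x ∈ Q.W, ‖x‖ ≤ R) → Q.LossLipschitz G → (∀ᵐ p ∂Q.μ, ∀ x ∈ Q.W, 0 ≤ Q.loss x p) →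
        Q.optRisk = P →
        QuadProblem.ERMRate.{u, v, w} Q (fun n => 2 ≤ n)
          (fun n δ => C * (((d * Real.log n + Real.log (1 / δ)) / n) ^ 2
            + (d * Real.log n + Real.log (1 / δ)) * Q.optRisk / n))) ∧
    (∃ C : ℝ, 0 < C ∧
      ∀ (d : ℕ) (Z : Type u) (Z' : Type v) [MeasurableSpace Z] [MeasurableSpace Z']
        (Q : QuadProblem d Z Z') (α G R₀ : ℝ) (x₁ xs : EuclideanSpace ℝ (Fin d)),
        Q.HasFiniteMeans → Q.meanA.PosSemidef → IsClosed Q.W → Convex ℝ Q.W →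
        EBC Q.W Q.risk 1 α → 0 < G → Q.LossLipschitz G →
        x₁ ∈ Q.W → xs ∈ argminOn Q.risk Q.W → ‖x₁ - xs‖ ≤ R₀ →
        ∀ (Ω : Type w) [MeasurableSpace Ω] (Pr : Measure Ω) (ξ : ℕ → Ω → Z × Z'),
          IsIIDSample Pr Q.μ ξ →
          ∀ n : ℕ, 100 ≤ n → ∀ δ : ℝ, 0 < δ → δ < 1 →
            WithHighProb Pr δ fun ω =>
              Q.risk (Q.asa G x₁ n R₀ fun i => ξ i ω) - Q.optRisk ≤
                C * (max (α * G ^ 2) (R₀ * G) *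
                  (Real.log n * Real.log (Real.log n / δ)) / n)) := by
  simp only [← div_mul_eq_mul_div _ _ (QuadProblem.optRisk _)]
  refine ⟨fun d Z Z' _ _ Q hQ => exists_EBC_quad hQ.posSemidef hQ.polyhedron hQ.bounded hQ.nonempty,
    fun α G R => ⟨_, mul_pos (ermFactor_pos α |G| R 0 0)
      (by positivity : 0 < G ^ 2 * |α| + 1),
      fun d Z Z' _ _ Q hQ hE hR hG => hQ.ermRate_of_lossLipschitz hG hR hE⟩,
    fun α σ R => ⟨_, mul_pos (ermFactor_pos α |2 * σ * R + σ| R 0 (2 * σ ^ 2 * α ^ 2))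
      (by positivity : 0 < 8 * |σ| * |α| + 1),
      fun d Z Z' _ _ Q hQ hE hR hσ hpos => hQ.ermRate_of_nonneg hσ hpos hR hE⟩,
    fun α G R P => ?_,
    ⟨648, by norm_num, fun d Z Z' _ _ Q α G R₀ x₁ xs hQ hA hc hW hE hG hL hx₁ hxs hdist
      Ω _ Pr ξ hξ n hn δ hδ hδ1 => QuadProblem.withHighProb_risk_asa_le hQ hA hc hW hE hG hL hx₁
        hxs hdist hξ hn hδ hδ1.le⟩⟩
  obtain ⟨C, hC, hrate⟩ :=
    QuadProblem.HasFiniteMeans.exists_ermRate_of_nonnegOn.{u, v, w} α G R P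
  exact ⟨C, hC, fun d Z Z' _ _ Q hQ hE hR hG hpos hP => hrate hQ hG hpos hR hE hP⟩

theorem corollary1 :
    -- (i) the error bound condition with exponent 1
    (∀ (d : ℕ) (Z : Type u) (Z' : Type v) [MeasurableSpace Z] [MeasurableSpace Z']
        (Q : QuadProblem d Z Z'), Q.Standing → ∃ α : ℝ, EBC Q.W Q.risk 1 α) ∧
    -- (ii) ERM, bounded data
    (∀ α σ R : ℝ, ∃ C : ℝ, 0 < C ∧
      ∀ (d : ℕ) (Z : Type u) (Z' : Type v) [MeasurableSpace Z] [MeasurableSpace Z']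
        (Q : QuadProblem d Z Z'), Q.Standing → EBC Q.W Q.risk 1 α →
        (∀ x ∈ Q.W, ‖x‖ ≤ R) → Q.BoundedBy σ →
        QuadProblem.ERMRate.{u, v, w} Q (fun n => 2 ≤ n)
          (fun n δ => C * ((d * Real.log n + Real.log (1 / δ)) / n))) ∧
    -- (iii) ERM, bounded data and non-negative, convex, smooth losses
    (∀ α σ R L : ℝ, ∃ C N : ℝ, 0 < C ∧ 0 < N ∧
      ∀ (d : ℕ) (Z : Type u) (Z' : Type v) [MeasurableSpace Z] [MeasurableSpace Z']
        (Q : QuadProblem d Z Z'), Q.Standing → EBC Q.W Q.risk 1 α →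
        (∀ x ∈ Q.W, ‖x‖ ≤ R) → Q.BoundedBy σ →
        (∀ᵐ p ∂Q.μ, ∀ x, 0 ≤ Q.loss x p) → Q.LossConvexSmooth L →
        QuadProblem.ERMRate.{u, v, w} Q (fun n => 2 ≤ n ∧ N * (d * Real.log n) ≤ n)
          (fun n δ => C * (((d * Real.log n + Real.log (1 / δ)) / n) ^ 2
            + (d * Real.log n + Real.log (1 / δ)) * Q.optRisk / n))) ∧
    -- (iii') the same rate for each single problem when non-negativity is known only on `W`
    (∀ (d : ℕ) (Z : Type u) (Z' : Type v) [MeasurableSpace Z] [MeasurableSpace Z']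
        (Q : QuadProblem d Z Z') (σ L : ℝ), Q.Standing → Q.BoundedBy σ →
        (∀ᵐ p ∂Q.μ, ∀ x ∈ Q.W, 0 ≤ Q.loss x p) → Q.LossConvexSmooth L →
        ∃ C N : ℝ, 0 < C ∧ 0 < N ∧
          QuadProblem.ERMRate.{u, v, w} Q (fun n => 2 ≤ n ∧ N * (d * Real.log n) ≤ n)
            (fun n δ => C * (((d * Real.log n + Real.log (1 / δ)) / n) ^ 2
              + (d * Real.log n + Real.log (1 / δ)) * Q.optRisk / n))) ∧
    -- (iv) ASA, bounded data, with an absolute constant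
    (∃ C : ℝ, 0 < C ∧
      ∀ (d : ℕ) (Z : Type u) (Z' : Type v) [MeasurableSpace Z] [MeasurableSpace Z']
        (Q : QuadProblem d Z Z') (α σ G R₀ : ℝ) (x₁ xs : EuclideanSpace ℝ (Fin d)),
        Q.Standing → EBC Q.W Q.risk 1 α → Q.BoundedBy σ →
        0 < G → Q.LossLipschitz G →
        x₁ ∈ Q.W → IsClosest (argminOn Q.risk Q.W) x₁ xs → ‖x₁ - xs‖ ≤ R₀ →
        ∀ (Ω : Type w) [MeasurableSpace Ω] (Pr : Measure Ω) [IsProbabilityMeasure Pr]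
          (ξ : ℕ → Ω → Z × Z'), IsIIDSample Pr Q.μ ξ →
          ∀ n : ℕ, 100 ≤ n → ∀ δ : ℝ, 0 < δ → δ < 1 →
            WithHighProb Pr δ fun ω =>
              Q.risk (Q.asa G x₁ n R₀ fun i => ξ i ω) - Q.optRisk ≤
                C * (max (α * G ^ 2) (R₀ * G) *
                  (Real.log n * Real.log (Real.log n / δ)) / n)) := by
  obtain ⟨hEBC, hslow, hfast, hfast', C, hC, hasa⟩ := corollary1_general.{u, v, w}
  refine ⟨hEBC, fun α σ R => ?_, fun α σ R L => ?_, fun d Z Z' _ _ Q σ L hQ hσ hpos _ => ?_,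
    C, hC, fun d Z Z' _ _ Q α σ G R₀ x₁ xs hQ hE _ hG hL hx₁ hxs hdist Ω _ Pr _ =>
      hasa d Z Z' Q α G R₀ x₁ xs hQ.hasFiniteMeans hQ.posSemidef hQ.polyhedron.isClosed
        hQ.polyhedron.convex hE hG hL hx₁ hxs.1 hdist Ω Pr⟩
  · obtain ⟨C, hC, hrate⟩ := hslow α (2 * σ * R + σ) R
    exact ⟨C, hC, fun d Z Z' _ _ Q hQ hE hR hσ =>
      hrate d Z Z' Q hQ.hasFiniteMeans hE hR (hσ.lossLipschitz hR)⟩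
  · obtain ⟨C, hC, hrate⟩ := hfast α σ R
    exact ⟨C, 1, hC, one_pos, fun d Z Z' _ _ Q hQ hE hR hσ hpos _ =>
      (hrate d Z Z' Q hQ.hasFiniteMeans hE hR hσ hpos).mono (fun _ => And.left)
        fun _ _ _ _ => le_rfl⟩
  · obtain ⟨α, hE⟩ := hEBC d Z Z' Q hQ
    obtain ⟨R, hR⟩ := hQ.bounded.exists_norm_le
    obtain ⟨C, hC, hrate⟩ := hfast' α (2 * σ * R + σ) R Q.optRisk
    exact ⟨C, 1, hC, one_pos, (hrate d Z Z' Q hQ.hasFiniteMeans hE hR (hσ.lossLipschitz hR) hpos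
      rfl).mono (fun _ => And.left) fun _ _ _ _ => le_rfl⟩
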